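/- For a linear code $C\le\mathbb F_2^N$ let $G_C\le S_5^N$ be the preimage of $C$ under the coordinatewise sign homomorphism $S_5^N\to\mathbb F_2^N$. A group is Fitting-free if it has no nontrivial abelian normal subgroup. Every $G_C$ is Fitting-free, and for all $N$ and all codes $C,C'\le\mathbb F_2^N$ one has $G_C\cong G_{C'}$ (as abstract groups) if and only if some permutation of the coordinates carries $C$ to $C'$. Moreover, there is a many-one reduction, computable by a DLOGTIME-uniform family of constant-depth, polynomial-size Boolean circuits with unbounded fan-in (uniform $\mathsf{AC}^0$), from Linear Code Equivalence over $\mathbb F_2$ (given two generator matrices of the same size, decide whether the codes they generate are permutation-equivalent) to isomorphism of Fitting-free permutation groups (given two sequences of permutations, each generating a Fitting-free group, decide whether the two groups are isomorphic as abstract groups). All of its outputs are pairs of sequences generating Fitting-free groups, and it sends generator matrices of codes $C,C'\le\mathbb F_2^N$ to sequences of permutations generating $G_C$ and $G_{C'}$, where $S_5^N$ acts naturally on $N$ disjoint blocks of five points and fixes the remaining points of the permutation domain, if there are any. There is also a uniform $\mathsf{AC}^0$ many-one reduction from Graph Isomorphism to isomorphism of Fitting-free permutation groups, all of whose outputs are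 pairs of sequences generating Fitting-free groups. -/

import Mathlib

noncomputable section

/-! ## Boolean circuits with unbounded fan-in -/

/-- The types of the gates of an AC circuit: an input variable (numbered from `0`), negation,
conjunction and disjunction, the last two of unbounded fan-in. -/
inductive GateKind where
  | input (p : ℕ)
  | notGate
  | andGate
  | orGate

/-- The bit a gate of the given type emits on the input string `x`, when its incoming wires carry
the bits `bs`. -/
def GateKind.output (x : List Bool) : GateKind → List Bool → Bool
  | .input p, _ => x.getD p false
  | .notGate, bs => !(bs.headD false)
  | .andGate, bs => bs.all id
  | .orGate, bs => bs.any id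

/-- A Boolean circuit with `n` input bits and with multiple output gates. Gates are named by bit
strings, and `preds u` is the numbered list of the gates feeding into `u`. The levels witness that
the circuit is acyclic; a circuit has levels at most `D` exactly if it has depth at most `D`. -/
structure BoolCircuit (n : ℕ) where
  gates : Finset (List Bool)
  kind : List Bool → GateKind
  preds : List Bool → List (List Bool)
  outputs : List (List Bool)
  level : List Bool → ℕ
  preds_mem : ∀ u ∈ gates, ∀ w ∈ preds u, w ∈ gates
  outputs_mem : ∀ u ∈ outputs, u ∈ gates
  level_lt : ∀ u ∈ gates, ∀ w ∈ preds u, level w < level u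
  input_wf : ∀ u ∈ gates, ∀ p, kind u = .input p → p < n ∧ preds u = []
  not_wf : ∀ u ∈ gates, kind u = .notGate → (preds u).length = 1

namespace BoolCircuit

variable {n : ℕ} (C : BoolCircuit n)

/-- Evaluation of a gate, unfolding the circuit `k` times. -/
def evalAux (x : List Bool) : ℕ → List Bool → Bool
  | 0, _ => false
  | k + 1, u => (C.kind u).output x ((C.preds u).map (evalAux x k))

/-- The bit emitted by the gate `u` on the input string `x`. -/
def value (x : List Bool) (u : List Bool) : Bool :=
  C.evalAux x (C.level u + 1) u

/-- The output string of the circuit on the input string `x`. -/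
def run (x : List Bool) : List Bool :=
  C.outputs.map (C.value x)

theorem evalAux_eq (x : List Bool) : ∀ (k l : ℕ) (u : List Bool), u ∈ C.gates →
    C.level u < k → C.level u < l → C.evalAux x k u = C.evalAux x l u
  | 0, _, _, _, h, _ => absurd h (Nat.not_lt_zero _)
  | _ + 1, 0, _, _, _, h => absurd h (Nat.not_lt_zero _)
  | k + 1, l + 1, u, hu, hk, hl => by
    unfold evalAux
    congr 1
    refine List.map_congr_left fun w hw => ?_
    have hlt := C.level_lt u hu w hw
    exact evalAux_eq x k l w (C.preds_mem u hu w hw) (by omega) (by omega)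

/-- Every gate emits the bit prescribed by its type and the bits on its incoming wires. -/
theorem value_eq (x : List Bool) (u : List Bool) (hu : u ∈ C.gates) :
    C.value x u = (C.kind u).output x ((C.preds u).map (C.value x)) := by
  unfold value
  rw [evalAux]
  congr 1
  refine List.map_congr_left fun w hw => ?_
  exact C.evalAux_eq x _ _ w (C.preds_mem u hu w hw) (C.level_lt u hu w hw) (Nat.lt_succ_self _)

end BoolCircuit

/-! ## DLOGTIME-uniform AC⁰ -/

/-- Several bit strings written on one tape, each followed by the separator `none`. -/
def fields (ws : List (List Bool)) : List (Option Bool) :=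
  ws.flatMap fun w => w.map some ++ [none]

/-- The code of a gate type; `none` stands for `this string is not a gate`. -/
def kindCode : Option GateKind → List Bool
  | none => []
  | some (.input p) => false :: p.bits
  | some .notGate => [true]
  | some .andGate => [true, false]
  | some .orGate => [true, true]

/-- Some deterministic multi-stack Turing machine, given `inp a`, halts with output `out a` within
`t * (size a + 1)` steps, for a constant `t` and for every query `a` satisfying `valid`. -/
def LinearTimeOn {α : Type} (valid : α → Prop) (size : α → ℕ)
    (inp : α → List (Option Bool)) (out : α → List Bool) : Prop :=
  ∃ (M : Turing.TM2ComputableAux (Option Bool) Bool) (t : ℕ), ∀ a, valid a →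
    Nonempty (Turing.TM2OutputsInTime M.tm ((inp a).map M.inputAlphabet.symm)
      (some ((out a).map M.outputAlphabet.symm)) (t * (size a + 1)))

open Classical in
/-- `f` is computed by a DLOGTIME-uniform family of AC circuits of constant depth and polynomial
size. All numbers are given to the machines in binary, the number `n` of input bits included, and
`Nat.size n` is the length of `n` in binary. -/
def UniformAC0 (f : List Bool → List Bool) : Prop :=
  ∃ (C : ∀ n : ℕ, BoolCircuit n) (D e c : ℕ),
    -- the circuit for strings of length `n` computes `f` on them
    (∀ x : List Bool, (C x.length).run x = f x) ∧
    -- constant depth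
    (∀ n, ∀ u ∈ (C n).gates, (C n).level u ≤ D) ∧
    -- polynomial size
    (∀ n, (C n).gates.card ≤ (n + 2) ^ e) ∧
    -- gates are named by strings of length `O(log n)`, and `O(log n)` bits number their wires
    (∀ n, ∀ u ∈ (C n).gates, u.length ≤ c * (n.size + 1)) ∧
    (∀ n, ∀ u ∈ (C n).gates, ((C n).preds u).length ≤ 2 ^ (c * (n.size + 1))) ∧
    (∀ n, (C n).outputs.length ≤ 2 ^ (c * (n.size + 1))) ∧
    -- in time `O(log n)`: is `u` a gate, and of which type?
    LinearTimeOn (α := ℕ × List Bool)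
      (fun q => q.2.length ≤ c * (q.1.size + 1))
      (fun q => q.1.size)
      (fun q => fields [q.1.bits, q.2])
      (fun q => kindCode (if q.2 ∈ (C q.1).gates then some ((C q.1).kind q.2) else none)) ∧
    -- in time `O(log n)`: is the gate `u` the `i`-th input of the gate `v`?
    LinearTimeOn (α := ℕ × List Bool × List Bool × ℕ)
      (fun q => q.2.1 ∈ (C q.1).gates ∧ q.2.2.1 ∈ (C q.1).gates ∧
        q.2.2.2 < 2 ^ (c * (q.1.size + 1)))
      (fun q => q.1.size)
      (fun q => fields [q.1.bits, q.2.1, q.2.2.1, q.2.2.2.bits])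
      (fun q => [decide (((C q.1).preds q.2.2.1)[q.2.2.2]? = some q.2.1)]) ∧
    -- in time `O(log n)`: is the gate `u` the `j`-th output gate?
    LinearTimeOn (α := ℕ × List Bool × ℕ)
      (fun q => q.2.1 ∈ (C q.1).gates ∧ q.2.2 < 2 ^ (c * (q.1.size + 1)))
      (fun q => q.1.size)
      (fun q => fields [q.1.bits, q.2.1, q.2.2.bits])
      (fun q => [decide ((C q.1).outputs[q.2.2]? = some q.2.1)])

/-- `f` is a uniform AC⁰ many-one reduction from the language `A` to the language `B`. -/
def IsUniformAC0Reduction (f : List Bool → List Bool) (A B : Set (List Bool)) : Prop :=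
  UniformAC0 f ∧ ∀ x, x ∈ A ↔ f x ∈ B

/-! ## Codes and graphs -/

/-- Permutation equivalence of binary linear codes of length `N`: some permutation of the
coordinates carries `C` to `C'`. -/
def CodeEquivalent {N : ℕ} (C C' : Submodule (ZMod 2) (Fin N → ZMod 2)) : Prop :=
  ∃ σ : Equiv.Perm (Fin N), C.map (LinearMap.funLeft (ZMod 2) (ZMod 2) σ) = C'

/-- The code generated by the rows of a matrix. -/
def rowCode {d m : ℕ} (A : Matrix (Fin d) (Fin m) (ZMod 2)) :
    Submodule (ZMod 2) (Fin m → ZMod 2) :=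
  Submodule.span (ZMod 2) (Set.range A)

/-- The `k`-th digit of `p` in base `2 ^ s`. -/
def digit (s k p : ℕ) : ℕ := p / 2 ^ (s * k) % 2 ^ s

open Classical in
/-- The bit string of length `len` whose `p`-th bit is `1` if and only if `P p`. -/
def bitString (len : ℕ) (P : ℕ → Prop) : List Bool :=
  (List.range len).map fun p => decide (P p)

/-- The encoding of a pair of `d × m` generator matrices, where `d, m ≤ 2 ^ s`. It consists of four
`2 ^ s × 2 ^ s` bit tables: in the first, the first `d` rows are `1`; in the second, the first `m`
rows are `1`; the third and the fourth are `A` and `B`, padded with zeros. -/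
def encodeMatrices (s : ℕ) {d m : ℕ} (A B : Matrix (Fin d) (Fin m) (ZMod 2)) : List Bool :=
  bitString (4 * 2 ^ (2 * s)) fun p =>
    let b := p / 2 ^ (2 * s)
    let i := digit s 1 p
    let j := digit s 0 p
    (b = 0 ∧ i < d) ∨ (b = 1 ∧ i < m) ∨
    (b = 2 ∧ ∃ (hi : i < d) (hj : j < m), A ⟨i, hi⟩ ⟨j, hj⟩ = 1) ∨
    (b = 3 ∧ ∃ (hi : i < d) (hj : j < m), B ⟨i, hi⟩ ⟨j, hj⟩ = 1)

/-- Linear Code Equivalence over `𝔽₂`, for codes given by generator matrices. -/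
def LinearCodeEquivalence : Set (List Bool) :=
  {x | ∃ (s d m : ℕ) (A B : Matrix (Fin d) (Fin m) (ZMod 2)), d ≤ 2 ^ s ∧ m ≤ 2 ^ s ∧
    x = encodeMatrices s A B ∧ CodeEquivalent (rowCode A) (rowCode B)}

/-- The encoding of a pair of graphs on `n ≤ 2 ^ s` vertices: the two adjacency matrices, with `1`
on the diagonal, padded with zeros to size `2 ^ s × 2 ^ s`. -/
def encodeGraphs (s : ℕ) {n : ℕ} (G H : SimpleGraph (Fin n)) : List Bool :=
  bitString (2 * 2 ^ (2 * s)) fun p =>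
    let b := p / 2 ^ (2 * s)
    let i := digit s 1 p
    let j := digit s 0 p
    (i = j ∧ i < n) ∨
    (b = 0 ∧ ∃ (hi : i < n) (hj : j < n), G.Adj ⟨i, hi⟩ ⟨j, hj⟩) ∨
    (b = 1 ∧ ∃ (hi : i < n) (hj : j < n), H.Adj ⟨i, hi⟩ ⟨j, hj⟩)

/-- Graph Isomorphism, for graphs given by adjacency matrices. -/
def GraphIsomorphism : Set (List Bool) :=
  {x | ∃ (s n : ℕ) (G H : SimpleGraph (Fin n)), n ≤ 2 ^ s ∧
    x = encodeGraphs s G H ∧ Nonempty (G ≃g H)}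

/-! ## Fitting-free permutation groups -/

/-- A group is Fitting-free if it has no nontrivial abelian normal subgroup. -/
def IsFittingFree (G : Type*) [Group G] : Prop :=
  ∀ K : Subgroup G, K.Normal → (∀ a ∈ K, ∀ b ∈ K, a * b = b * a) → K = ⊥

/-- The permutation group generated by a sequence of permutations. -/
def generated {L M : ℕ} (S : Fin L → Equiv.Perm (Fin M)) : Subgroup (Equiv.Perm (Fin M)) :=
  Subgroup.closure (Set.range S)

/-- The encoding of a pair of sequences of `L` permutations of `M` points, where `L, M ≤ 2 ^ s`. It
consists of four `2 ^ s × 2 ^ s × 2 ^ s` bit tables: in the first, the first `L` layers are `1`; in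
the second, the first `M` layers are `1`; the layers of the third and the fourth are the permutation
matrices of the two sequences, padded with zeros. -/
def encodePermutations (s : ℕ) {L M : ℕ} (S T : Fin L → Equiv.Perm (Fin M)) : List Bool :=
  bitString (4 * 2 ^ (3 * s)) fun p =>
    let b := p / 2 ^ (3 * s)
    let g := digit s 2 p
    let i := digit s 1 p
    let j := digit s 0 p
    (b = 0 ∧ g < L) ∨ (b = 1 ∧ g < M) ∨
    (b = 2 ∧ ∃ (hg : g < L) (hi : i < M) (hj : j < M), S ⟨g, hg⟩ ⟨i, hi⟩ = ⟨j, hj⟩) ∨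
    (b = 3 ∧ ∃ (hg : g < L) (hi : i < M) (hj : j < M), T ⟨g, hg⟩ ⟨i, hi⟩ = ⟨j, hj⟩)

/-- The instances of the isomorphism problem for Fitting-free permutation groups: pairs of sequences
of permutations that each generate a Fitting-free group. -/
def FittingFreeInstance : Set (List Bool) :=
  {x | ∃ (s L M : ℕ) (S T : Fin L → Equiv.Perm (Fin M)), L ≤ 2 ^ s ∧ M ≤ 2 ^ s ∧
    x = encodePermutations s S T ∧ IsFittingFree (generated S) ∧ IsFittingFree (generated T)}

/-- The instances of `FittingFreeInstance` whose two groups are isomorphic as abstract groups. -/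
def FittingFreeIsomorphism : Set (List Bool) :=
  {x | ∃ (s L M : ℕ) (S T : Fin L → Equiv.Perm (Fin M)), L ≤ 2 ^ s ∧ M ≤ 2 ^ s ∧
    x = encodePermutations s S T ∧ IsFittingFree (generated S) ∧ IsFittingFree (generated T) ∧
    Nonempty (generated S ≃* generated T)}

/-! ## The groups attached to a code -/

/-- The sign of a permutation as an element of `𝔽₂`. -/
def signBit (σ : Equiv.Perm (Fin 5)) : ZMod 2 :=
  if Equiv.Perm.sign σ = 1 then 0 else 1

theorem signBit_mul (σ τ : Equiv.Perm (Fin 5)) : signBit (σ * τ) = signBit σ + signBit τ := by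
  unfold signBit
  rw [map_mul]
  rcases Int.units_eq_one_or (Equiv.Perm.sign σ) with h | h <;>
    rcases Int.units_eq_one_or (Equiv.Perm.sign τ) with h' | h' <;>
    rw [h, h'] <;> decide

/-- The coordinatewise sign homomorphism `S₅ ^ N → 𝔽₂ ^ N`. -/
def coordSign (N : ℕ) : (Fin N → Equiv.Perm (Fin 5)) →* Multiplicative (Fin N → ZMod 2) where
  toFun σ := Multiplicative.ofAdd fun i => signBit (σ i)
  map_one' := by
    refine congrArg Multiplicative.ofAdd (funext fun i => ?_)
    simp [signBit]
  map_mul' σ τ := by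
    refine congrArg Multiplicative.ofAdd (funext fun i => ?_)
    exact signBit_mul (σ i) (τ i)

/-- The group `G_C`: the preimage of the code `C` under the coordinatewise sign map. -/
def codeGroup {N : ℕ} (C : Submodule (ZMod 2) (Fin N → ZMod 2)) :
    Subgroup (Fin N → Equiv.Perm (Fin 5)) :=
  (AddSubgroup.toSubgroup C.toAddSubgroup).comap (coordSign N)

/-- The natural action of `S₅ ^ N` on `N` disjoint blocks of five points, when these points are
identified by `e` with points of `Fin M`; the other points are fixed. -/
def blockAction {N M : ℕ} (e : (Σ _ : Fin N, Fin 5) ↪ Fin M) :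
    (Fin N → Equiv.Perm (Fin 5)) →* Equiv.Perm (Fin M) :=
  (Equiv.Perm.viaEmbeddingHom e).comp (Equiv.Perm.sigmaCongrRightHom fun _ : Fin N => Fin 5)

end

/-! Group theory. `G_C` contains `A₅ ^ N`, and each factor `A₅` is normal in `G_C`. If an element
`g` of a normal subgroup `K` acts nontrivially on block `i`, its commutator with a suitable even
permutation of that block is a nontrivial element of `K` inside the `i`-th factor; by simplicity of
`A₅`, `K` contains the whole factor (`altBlock_le_of_normal`). Hence `G_C` has no nontrivial abelian
normal subgroup, and the factors are its minimal normal subgroups, so an isomorphism `G_C ≃* G_C'`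
permutes the blocks (`exists_map_altBlock_eq`). The centralizer of `A₅` in `S₅` is trivial, so the
`i`-th component of `g` is even exactly if `g` acts on the `i`-th factor as an inner automorphism of
that factor (`sign_eq_one_iff_inner`). Signs are therefore preserved as well, and the permutation of
the blocks carries `C` to `C'`.

The reduction from codes. `G_C` is generated by one product of transpositions for each row, on the
support of the row, and by two 3-cycles for each block, which generate its `A₅`
(`closure_blockGen`). Each bit of the permutation matrices of these generators depends on at most
one input bit, provided that the input is a legitimate encoding, and legitimacy is a conjunction of
implications between pairs of input bits. Such a function is a `GuardedProjection` and has circuits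
of depth 5. Illegitimate inputs are sent to generators of `A₅` and of the trivial group, which are
Fitting-free and not isomorphic.

Uniformity. All tables are padded to powers of two, so quotients, remainders and table look-ups of
gate numbers amount to cutting binary strings at positions `α * s + β`. Legitimate inputs have
length `2 ^ (2 * s + par)` with `par` equal to `1` or `2`; the length in binary has `2 * s + par +
1` digits, and half of this, rounded down, less one, is `s`. The circuit queries are thus
comparisons of chunks of strings, which finite automata reading several shifted copies in parallel
can decide (`Regular`). A stack machine finds the shifts by counting and simulates the automaton in
linear time (`Regular.linearTimeOn`).

The reduction from graphs goes through codes. With `U` the padded vertex set, the coordinates are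
eight copies of `U × U`: one records incidences of vertices and edges, and in the seven others each
vertex has `card U` private coordinates per copy. The word of a vertex has weight at most `9 * card
U`, while a sum of several such words has weight at least `14 * card U`. A permutation of
coordinates that carries one code to another therefore maps words of vertices to words of vertices,
and distinct vertices are adjacent exactly if the supports of their words meet
(`exists_map_of_codeEquivalent`). -/

/-! ## Stack machines that act on all their stacks at once -/

namespace StackMachine

open Turing Turing.TM2

noncomputable section

variable {K : Type} {Γ : K → Type} {Q : Type}

/-- What a machine does in one step, given its state and the top symbols of its stacks: it enters a
new state or halts, drops some symbols from every stack, and pushes a list on every stack. -/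
abbrev Program (Γ : K → Type) (Q : Type) :=
  Q → (∀ k, Option (Γ k)) → Option Q × (∀ k, ℕ × List (Γ k))

/-- The effect of dropping and pushing symbols on the stacks. -/
def act (a : ∀ k, ℕ × List (Γ k)) (S : ∀ k, List (Γ k)) : ∀ k, List (Γ k) :=
  fun k => (a k).2 ++ (S k).drop (a k).1

/-- One step of the machine. -/
def step (δ : Program Γ Q) : Option Q × (∀ k, List (Γ k)) → Option Q × (∀ k, List (Γ k))
  | (none, S) => (none, S)
  | (some q, S) => ((δ q fun k => (S k).head?).1, act (δ q fun k => (S k).head?).2 S)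

theorem step_none (δ : Program Γ Q) (n : ℕ) (S : ∀ k, List (Γ k)) :
    (step δ)^[n] (none, S) = (none, S) := by
  induction n with
  | zero => rfl
  | succ n ih => rw [Function.iterate_succ_apply, step, ih]

variable [DecidableEq K]

/-- The labels of the simulating machine. -/
abbrev Label (Γ : K → Type) (Q : Type) := Q ⊕ (Q × (∀ k, Option (Γ k)))

/-- The local variables of the simulating machine. -/
abbrev Var (Γ : K → Type) := ∀ k, Option (Γ k)

/-- Read the top symbols of the stacks in the list. -/
def peekAll : List K → Stmt Γ (Label Γ Q) (Var Γ) → Stmt Γ (Label Γ Q) (Var Γ)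
  | [], s => s
  | k :: l, s => .peek k (fun v o => Function.update v k o) (peekAll l s)

/-- Push a list on a stack, its head last. -/
def pushList (k : K) : List (Γ k) → Stmt Γ (Label Γ Q) (Var Γ) → Stmt Γ (Label Γ Q) (Var Γ)
  | [], s => s
  | a :: l, s => pushList k l (.push k (fun _ => a) s)

/-- Drop a number of symbols from a stack. -/
def popN (k : K) : ℕ → Stmt Γ (Label Γ Q) (Var Γ) → Stmt Γ (Label Γ Q) (Var Γ)
  | 0, s => s
  | n + 1, s => .pop k (fun v _ => v) (popN k n s)

/-- Drop and push symbols on the stacks in the list. -/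
def actAll (a : ∀ k, ℕ × List (Γ k)) :
    List K → Stmt Γ (Label Γ Q) (Var Γ) → Stmt Γ (Label Γ Q) (Var Γ)
  | [], s => s
  | k :: l, s => popN k (a k).1 (pushList k (a k).2 (actAll a l s))

theorem stepAux_peekAll (l : List K) (s : Stmt Γ (Label Γ Q) (Var Γ)) (v : Var Γ)
    (S : ∀ k, List (Γ k)) :
    stepAux (peekAll l s) v S = stepAux s (fun k => if k ∈ l then (S k).head? else v k) S := by
  induction l generalizing v with
  | nil => simp [peekAll]
  | cons k l ih =>
    rw [peekAll, stepAux, ih]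
    congr 1
    funext j
    by_cases hj : j = k
    · subst hj; simp
    · simp [hj]

theorem stepAux_pushList (k : K) (l : List (Γ k)) (s : Stmt Γ (Label Γ Q) (Var Γ)) (v : Var Γ)
    (S : ∀ k, List (Γ k)) :
    stepAux (pushList k l s) v S = stepAux s v (Function.update S k (l ++ S k)) := by
  induction l generalizing s with
  | nil => simp [pushList]
  | cons a l ih => rw [pushList, ih]; simp [stepAux]

theorem stepAux_popN (k : K) (n : ℕ) (s : Stmt Γ (Label Γ Q) (Var Γ)) (v : Var Γ)
    (S : ∀ k, List (Γ k)) :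
    stepAux (popN k n s) v S = stepAux s v (Function.update S k ((S k).drop n)) := by
  induction n generalizing S with
  | zero => simp [popN]
  | succ n ih => rw [popN, stepAux, ih]; simp

/-- Without `Nodup`, a stack listed twice would be acted on twice. -/
theorem stepAux_actAll (a : ∀ k, ℕ × List (Γ k)) (l : List K) (hl : l.Nodup)
    (s : Stmt Γ (Label Γ Q) (Var Γ)) (v : Var Γ) (S : ∀ k, List (Γ k)) :
    stepAux (actAll a l s) v S = stepAux s v (fun k => if k ∈ l then act a S k else S k) := by
  induction l generalizing S with
  | nil => simp [actAll]
  | cons k l ih =>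
    rw [List.nodup_cons] at hl
    rw [actAll, stepAux_popN, stepAux_pushList, ih hl.2]
    congr 1
    funext j
    by_cases hj : j = k
    · subst hj; simp [hl.1, act]
    · simp [hj, act]

variable [Fintype K]

/-- The statements of the simulating machine. -/
def stmts (δ : Program Γ Q) : Label Γ Q → Stmt Γ (Label Γ Q) (Var Γ)
  | .inl q => peekAll Finset.univ.toList (.goto fun v => .inr (q, v))
  | .inr (q, v) => .load (fun _ _ => none) (actAll (δ q v).2 Finset.univ.toList
      (match (δ q v).1 with
        | none => .halt
        | some q' => .goto fun _ => .inl q'))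

/-- The configuration of the simulating machine between two simulated steps. -/
def toCfg (c : Option Q × (∀ k, List (Γ k))) : Cfg Γ (Label Γ Q) (Var Γ) :=
  ⟨c.1.map Sum.inl, fun _ => none, c.2⟩

/-- The first step moves the top symbols into the label, so that in the second step the statement
itself can depend on them. The `load` in the second step clears the local variables, which restores
the form `toCfg`. -/
theorem stmts_step_step (δ : Program Γ Q) (q : Q) (S : ∀ k, List (Γ k)) :
    (TM2.step (stmts δ) (toCfg (some q, S))).bind (TM2.step (stmts δ)) =
      some (toCfg (step δ (some q, S))) := by
  simp only [toCfg, Option.map_some, TM2.step, stmts, stepAux_peekAll, stepAux, Option.bind_some]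
  rw [stepAux_actAll _ _ (Finset.nodup_toList _)]
  simp only [Finset.mem_toList, Finset.mem_univ, if_true, step]
  cases (δ q fun k => (S k).head?).1 <;> rfl

variable [∀ k, Fintype (Γ k)] [Fintype Q]

/-- The simulating machine. -/
def toTM2 (δ : Program Γ Q) (q₀ : Q) (k₀ k₁ : K) : FinTM2 where
  K := K
  k₀ := k₀
  k₁ := k₁
  Γ := Γ
  Λ := Label Γ Q
  ΛFin := Fintype.ofFinite _
  main := .inl q₀
  σ := Var Γ
  σFin := Fintype.ofFinite _
  initialState := fun _ => none
  m := stmts δ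

theorem evalsTo_of_iterate (δ : Program Γ Q) (q₀ : Q) (k₀ k₁ : K) (n : ℕ) (q : Q)
    (S S' : ∀ k, List (Γ k)) (h : (step δ)^[n] (some q, S) = (none, S')) :
    Nonempty (StateTransition.EvalsToInTime (toTM2 δ q₀ k₀ k₁).step (toCfg (some q, S))
      (some (toCfg (none, S'))) (2 * n)) := by
  induction n generalizing q S with
  | zero => simp at h
  | succ n ih =>
    rw [Function.iterate_succ_apply] at h
    have first : StateTransition.EvalsToInTime (toTM2 δ q₀ k₀ k₁).step
        (toCfg (some q, S)) (some (toCfg (step δ (some q, S)))) 2 :=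
      ⟨⟨2, stmts_step_step δ q S⟩, le_rfl⟩
    obtain ⟨o, S1, hc⟩ : ∃ o S1, step δ (some q, S) = (o, S1) := ⟨_, _, rfl⟩
    rw [hc] at h
    replace first : StateTransition.EvalsToInTime (toTM2 δ q₀ k₀ k₁).step
        (toCfg (some q, S)) (some (toCfg (o, S1))) 2 := hc ▸ first
    cases o with
    -- The machine has halted early; the remaining iterations change nothing.
    | none =>
      rw [step_none] at h
      obtain rfl : S1 = S' := congrArg Prod.snd h
      exact ⟨⟨first.toEvalsTo, by have := first.steps_le_m; omega⟩⟩
    | some q1 =>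
      obtain ⟨second⟩ := ih q1 S1 h
      have := StateTransition.EvalsToInTime.trans _ _ _ _ _ _ first second
      exact ⟨⟨this.toEvalsTo, by have := this.steps_le_m; omega⟩⟩

/-- The stacks with a single nonempty one. -/
def single (k : K) (l : List (Γ k)) : ∀ k, List (Γ k) :=
  fun j => if h : j = k then (by rw [h]; exact l) else []

theorem outputsInTime (δ : Program Γ Q) (q₀ : Q) (k₀ k₁ : K) (n : ℕ)
    (l : List (Γ k₀)) (l' : List (Γ k₁))
    (h : (step δ)^[n] (some q₀, single k₀ l) = (none, single k₁ l')) :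
    Nonempty (TM2OutputsInTime (toTM2 δ q₀ k₀ k₁) l (some l') (2 * n)) := by
  obtain ⟨e⟩ := evalsTo_of_iterate δ q₀ k₀ k₁ n q₀ _ _ h
  exact ⟨e⟩

end

end StackMachine

/-! ## Functions of several bit strings computed by synchronous automata -/

/-- A suffix of one of several bit strings. It starts at a position that is a linear function of the
parameter `scale` below. -/
structure BitStream where
  field : ℕ
  slope : ℕ
  shift : ℕ

/-- Half the length of the first bit string, less one. -/
def scale (fs : ℕ → List Bool) : ℕ := (fs 0).length / 2 - 1

/-- The first position of the stream. -/
def BitStream.start (d : BitStream) (fs : ℕ → List Bool) : ℕ := d.slope * scale fs + d.shift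

/-- The `t`-th symbol of the stream. -/
def BitStream.get (d : BitStream) (fs : ℕ → List Bool) (t : ℕ) : Option Bool :=
  (fs d.field)[d.start fs + t]?

/-- An automaton that reads several streams in parallel; it also sees whether its head is at one of
the first `scale` positions. -/
structure SyncAutomaton (ι σ : Type) where
  stream : ι → BitStream
  init : σ
  next : σ → Bool → (ι → Option Bool) → σ

namespace SyncAutomaton

variable {ι σ : Type}

/-- The state after reading `t` symbols of each stream. -/
def run (A : SyncAutomaton ι σ) (fs : ℕ → List Bool) : ℕ → σ
  | 0 => A.init
  | t + 1 => A.next (A.run fs t) (decide (t < scale fs)) fun i => (A.stream i).get fs t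

/-- At position `T` all the streams are exhausted. -/
def Exhausted (A : SyncAutomaton ι σ) (fs : ℕ → List Bool) (T : ℕ) : Prop :=
  scale fs ≤ T ∧ ∀ i t, T ≤ t → (A.stream i).get fs t = none

end SyncAutomaton

/-- The function is determined by the state in which some automaton exhausts its streams. -/
def Regular {τ : Type} (F : (ℕ → List Bool) → τ) : Prop :=
  ∃ (ι σ : Type) (_ : Finite ι) (_ : Finite σ) (A : SyncAutomaton ι σ) (out : σ → τ),
    ∀ fs T, A.Exhausted fs T → out (A.run fs T) = F fs

namespace SyncAutomaton

noncomputable section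

variable {ι σ : Type}

/-- The stacks of the machine that simulates an automaton. -/
inductive Stack (ι : Type)
  | tape
  | buf (j : Option (Option ι))
  | str (i : ι)
  | una
  | out

/-- The alphabets of the stacks. -/
abbrev Stack.Alphabet : Stack ι → Type
  | .tape => Option Bool
  | _ => Bool

/-- The states of the machine that simulates an automaton on `m` bit strings. -/
inductive State (m : ℕ) (σ : Type)
  | read (c : Fin (m + 1))
  | reverse
  | skip
  | run (q : σ)
  | write (q : σ)

instance [Finite ι] : Finite (Stack ι) :=
  Finite.of_injective (β := Option (Option (Option (ι ⊕ Option (Option ι)))))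
    (fun k => match k with
      | .tape => none
      | .una => some none
      | .out => some (some none)
      | .str i => some (some (some (.inl i)))
      | .buf j => some (some (some (.inr j))))
    (by rintro (_ | _ | _ | _ | _) (_ | _ | _ | _ | _) h <;> simp_all)

instance [Finite σ] (m : ℕ) : Finite (State m σ) :=
  Finite.of_injective (β := Option (Option (Fin (m + 1) ⊕ (σ ⊕ σ))))
    (fun k => match k with
      | .reverse => none
      | .skip => some none
      | .read c => some (some (.inl c))
      | .run q => some (some (.inr (.inl q)))
      | .write q => some (some (.inr (.inr q))))
    (by rintro (_ | _ | _ | _ | _) (_ | _ | _ | _ | _) h <;> simp_all)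

instance (k : Stack ι) : Fintype k.Alphabet := by
  cases k <;> unfold Stack.Alphabet <;> infer_instance

/-- The contents of the stacks. -/
def contents (tape : List (Option Bool)) (buf : Option (Option ι) → List Bool) (str : ι → List Bool)
    (una out : List Bool) : ∀ k : Stack ι, List k.Alphabet
  | .tape => tape
  | .buf j => buf j
  | .str i => str i
  | .una => una
  | .out => out

/-- Actions on the stacks. -/
def actions (tape : ℕ × List (Option Bool)) (buf : Option (Option ι) → ℕ × List Bool)
    (str : ι → ℕ × List Bool) (una out : ℕ × List Bool) : ∀ k : Stack ι, ℕ × List k.Alphabet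
  | .tape => tape
  | .buf j => buf j
  | .str i => str i
  | .una => una
  | .out => out

/-- The action that does nothing. -/
abbrev idle {α : Type} : ℕ × List α := (0, [])

theorem act_contents (tape : List (Option Bool)) (buf : Option (Option ι) → List Bool)
    (str : ι → List Bool) (una out : List Bool) (tape' : ℕ × List (Option Bool))
    (buf' : Option (Option ι) → ℕ × List Bool) (str' : ι → ℕ × List Bool)
    (una' out' : ℕ × List Bool) :
    StackMachine.act (actions tape' buf' str' una' out') (contents tape buf str una out) =
      contents (tape'.2 ++ tape.drop tape'.1) (fun j => (buf' j).2 ++ (buf j).drop (buf' j).1)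
        (fun i => (str' i).2 ++ (str i).drop (str' i).1) (una'.2 ++ una.drop una'.1)
        (out'.2 ++ out.drop out'.1) := by
  funext k
  cases k <;> rfl

/-- The bit string that is collected in the buffer. -/
def bufField (A : SyncAutomaton ι σ) : Option (Option ι) → ℕ
  | none => 0
  | some none => 1
  | some (some i) => (A.stream i).field

open Classical in
/-- The machine that simulates an automaton. The output consists of a prefix and, optionally, of the
second bit string without its first four bits. -/
def program (A : SyncAutomaton ι σ) (m : ℕ) (pre : σ → List Bool) (copy : σ → Bool) :
    StackMachine.Program (Γ := fun k : Stack ι => k.Alphabet) (State m σ)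
  | .read c, tops =>
    match (tops .tape : Option (Option Bool)) with
    | none => (some .reverse, actions idle (fun _ => idle) (fun _ => idle) idle idle)
    | some none => (some (.read (Fin.ofNat (m + 1) (c + 1))),
        actions (1, []) (fun _ => idle) (fun _ => idle) idle idle)
    | some (some b) => (some (.read c),
        actions (1, []) (fun j => (0, if A.bufField j = c then [b] else [])) (fun _ => idle)
          idle idle)
  | .reverse, tops =>
    if ∀ j, tops (.buf (some j)) = none then
      (some .skip, actions idle (fun j => if j = none then (3, []) else idle)
        (fun i => ((A.stream i).shift, [])) idle idle)
    else
      (some .reverse, actions idle (fun j => if j = none then idle else (1, []))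
        (fun i => (0, (tops (.buf (some (some i))) : Option Bool).toList)) idle
        (0, (tops (.buf (some none)) : Option Bool).toList))
  | .skip, tops =>
    if tops (.buf none) = none then
      (some (.run A.init), actions idle (fun _ => idle) (fun _ => idle) idle idle)
    else
      (some .skip, actions idle (fun j => if j = none then (2, []) else idle)
        (fun i => ((A.stream i).slope, [])) (0, [true]) idle)
  | .run q, tops =>
    if tops .una = none ∧ ∀ i, tops (.str i) = none then
      (some (.write q), actions idle (fun _ => idle) (fun _ => idle) idle idle)
    else
      (some (.run (A.next q (tops .una : Option Bool).isSome fun i => tops (.str i))),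
        actions idle (fun _ => idle) (fun _ => (1, [])) (1, []) idle)
  | .write q, tops =>
    if copy q = true then
      (none, actions idle (fun _ => idle) (fun _ => idle) idle (4, pre q))
    else if tops .out = none then
      (none, actions idle (fun _ => idle) (fun _ => idle) idle (0, pre q))
    else
      (some (.write q), actions idle (fun _ => idle) (fun _ => idle) idle (1, []))

/-! ### The phases of the simulation -/

variable (A : SyncAutomaton ι σ) (m : ℕ) (pre : σ → List Bool) (copy : σ → Bool)

theorem read_word (c : Fin (m + 1)) (w : List Bool) (rest : List (Option Bool))
    (buf : Option (Option ι) → List Bool) (str : ι → List Bool) (una out : List Bool) :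
    (StackMachine.step (A.program m pre copy))^[w.length + 1]
      (some (.read c), contents (w.map some ++ none :: rest) buf str una out) =
      (some (.read (Fin.ofNat (m + 1) (c + 1))),
        contents rest (fun j => if A.bufField j = c then w.reverse ++ buf j else buf j)
          str una out) := by
  induction w generalizing buf with
  | nil =>
    rw [List.length_nil, Nat.zero_add, Function.iterate_one, List.map_nil, List.nil_append]
    simp only [StackMachine.step, program, contents, List.head?_cons, act_contents]
    congr 2
    funext j
    simp
  | cons b w ih =>
    rw [List.length_cons, Function.iterate_succ_apply]
    have : StackMachine.step (A.program m pre copy)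
        (some (.read c), contents ((b :: w).map some ++ none :: rest) buf str una out) =
        (some (.read c), contents (w.map some ++ none :: rest)
          (fun j => if A.bufField j = c then b :: buf j else buf j) str una out) := by
      simp only [StackMachine.step, program]
      simp only [contents, List.map_cons, List.cons_append, List.head?_cons, act_contents]
      congr 2
      · funext j
        by_cases h : A.bufField j = c <;> simp [h]
    rw [this, ih]
    congr 2
    funext j
    by_cases h : A.bufField j = c <;> simp [h]

theorem read_fields (ws : List (List Bool)) (c : ℕ) (hc : c + ws.length ≤ m)
    (buf : Option (Option ι) → List Bool) (str : ι → List Bool) (una out : List Bool) :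
    (StackMachine.step (A.program m pre copy))^[(fields ws).length]
      (some (.read (Fin.ofNat (m + 1) c)), contents (fields ws) buf str una out) =
      (some (.read (Fin.ofNat (m + 1) (c + ws.length))),
        contents [] (fun j => (if c ≤ A.bufField j then
          (ws.getD (A.bufField j - c) []).reverse else []) ++ buf j) str una out) := by
  induction ws generalizing c buf with
  | nil => simp [fields]
  | cons w ws ih =>
    have h1 : fields (w :: ws) = w.map some ++ none :: fields ws := by simp [fields]
    rw [h1, List.length_append, List.length_map, List.length_cons, Nat.add_comm _ 1, ← Nat.add_assoc,
      Nat.add_comm, Nat.add_comm, Nat.add_comm (w.length + 1), Function.iterate_add_apply, read_word]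
    rw [List.length_cons] at hc
    have h2 : (Fin.ofNat (m + 1) c).1 = c := by
      simp only [Fin.ofNat]
      exact Nat.mod_eq_of_lt (by omega)
    rw [h2, ih (c + 1) (by omega), List.length_cons, Nat.add_assoc, Nat.add_comm 1]
    congr 2
    funext j
    rcases lt_trichotomy (A.bufField j) c with h | h | h
    · rw [if_neg (by omega), if_neg (by omega), if_neg (by omega)]
    · rw [if_neg (by omega), if_pos h, if_pos (by omega), h]
      simp
    · rw [if_pos (by omega), if_neg (by omega), if_pos (by omega),
        show A.bufField j - c = A.bufField j - (c + 1) + 1 by omega]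
      simp

/-- Reading has stored every string in a buffer with its last bit on top. Popping all buffers in
parallel restores the order. The buffer `none` stays as it is, because only its length is used: it
serves to compute `scale`, and `3` of its symbols are dropped for this purpose. -/
theorem reverse_phase (T : ℕ) (buf : Option (Option ι) → List Bool) (str : ι → List Bool)
    (una out : List Bool) (hT : ∀ j, (buf (some j)).length ≤ T) :
    ∃ n ≤ T + 1, (StackMachine.step (A.program m pre copy))^[n]
      (some .reverse, contents [] buf str una out) =
      (some .skip, contents [] (fun j => if j = none then (buf none).drop 3 else [])
        (fun i => ((buf (some (some i))).reverse ++ str i).drop (A.stream i).shift) una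
        ((buf (some none)).reverse ++ out)) := by
  induction T generalizing buf str out with
  | zero =>
    have h0 : ∀ j, buf (some j) = [] := fun j => List.eq_nil_of_length_eq_zero (by have := hT j; omega)
    refine ⟨1, le_rfl, ?_⟩
    rw [Function.iterate_one]
    simp only [StackMachine.step, program, contents, h0, List.head?_nil, implies_true, if_true,
      act_contents]
    congr 2
    funext j
    cases j <;> simp [h0]
  | succ T ih =>
    by_cases h0 : ∀ j, buf (some j) = []
    · obtain ⟨n, hn, h⟩ := ih buf str out (by simp [h0])
      exact ⟨n, by omega, h⟩
    · obtain ⟨n, hn, h⟩ := ih (fun j => if j = none then buf none else (buf j).tail)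
        (fun i => (buf (some (some i))).head?.toList ++ str i)
        ((buf (some none)).head?.toList ++ out)
        (fun j => by have := hT j; simp; omega)
      refine ⟨n + 1, by omega, ?_⟩
      rw [Function.iterate_succ_apply]
      have h1 : StackMachine.step (A.program m pre copy)
          (some .reverse, contents [] buf str una out) =
          (some .reverse, contents [] (fun j => if j = none then buf none else (buf j).tail)
            (fun i => (buf (some (some i))).head?.toList ++ str i) una
            ((buf (some none)).head?.toList ++ out)) := by
        have h2 : ¬ ∀ j, (contents [] buf str una out (.buf (some j))).head? = none := by
          simpa [contents] using h0
        simp only [StackMachine.step, program]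
        rw [if_neg h2]
        simp only [contents, act_contents]
        congr 2
        funext j
        cases j <;> simp
      rw [h1, h]
      congr 2
      · funext i
        congr 1
        cases buf (some (some i)) <;> simp
      · cases buf (some none) <;> simp

/-- Each pair of symbols of the counter removes `slope` symbols from every stream and adds a unit to
`una`. The streams thus reach their starting positions without any arithmetic, and `una` becomes a
clock of length `scale`. -/
theorem skip_phase (T : ℕ) (cnt : List Bool) (hT : cnt.length ≤ T) (str : ι → List Bool)
    (una out : List Bool) :
    ∃ n ≤ T + 1, (StackMachine.step (A.program m pre copy))^[n]
      (some .skip, contents [] (fun j => if j = none then cnt else []) str una out) =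
      (some (.run A.init), contents [] (fun _ => [])
        (fun i => (str i).drop ((A.stream i).slope * ((cnt.length + 1) / 2)))
        (List.replicate ((cnt.length + 1) / 2) true ++ una) out) := by
  induction T generalizing cnt str una with
  | zero =>
    obtain rfl : cnt = [] := List.eq_nil_of_length_eq_zero (by omega)
    refine ⟨1, le_rfl, ?_⟩
    rw [Function.iterate_one]
    simp [StackMachine.step, program, contents, act_contents]
  | succ T ih =>
    by_cases h0 : cnt = []
    · obtain ⟨n, hn, h⟩ := ih cnt (by simp [h0]) str una
      exact ⟨n, by omega, h⟩
    · have hpos := List.length_pos_iff.mpr h0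
      obtain ⟨n, hn, h⟩ := ih (cnt.drop 2) (by rw [List.length_drop]; omega)
        (fun i => (str i).drop (A.stream i).slope) (true :: una)
      refine ⟨n + 1, by omega, ?_⟩
      rw [Function.iterate_succ_apply]
      have h1 : StackMachine.step (A.program m pre copy)
          (some .skip, contents [] (fun j => if j = none then cnt else []) str una out) =
          (some .skip, contents [] (fun j => if j = none then cnt.drop 2 else [])
            (fun i => (str i).drop (A.stream i).slope) (true :: una) out) := by
        simp only [StackMachine.step, program, contents]
        rw [if_neg (by simpa using h0)]
        simp only [act_contents]
        congr 2
        funext j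
        cases j <;> simp
      rw [h1, h, List.length_drop]
      have h2 : (cnt.length + 1) / 2 = (cnt.length - 2 + 1) / 2 + 1 := by omega
      rw [h2, List.replicate_succ']
      congr 2
      · funext i
        rw [List.drop_drop, Nat.mul_succ, Nat.add_comm]
      · simp

/-- `R` bounds what is left of the streams and of the clock. The machine stops at some exhausted
time `T` that need not be specified further, since `Regular` asks for the right answer at every such
time. -/
theorem run_phase (fs : ℕ → List Bool) (R t : ℕ) (hs : scale fs ≤ t + R)
    (hR : ∀ i, ((fs (A.stream i).field).drop ((A.stream i).start fs)).length ≤ t + R)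
    (out : List Bool) :
    ∃ n ≤ R + 1, ∃ T, A.Exhausted fs T ∧ (StackMachine.step (A.program m pre copy))^[n]
      (some (.run (A.run fs t)), contents [] (fun _ => [])
        (fun i => (fs (A.stream i).field).drop ((A.stream i).start fs + t))
        (List.replicate (scale fs - t) true) out) =
      (some (.write (A.run fs T)), contents [] (fun _ => []) (fun _ => []) [] out) := by
  have key : ∀ t, (∀ i, (fs (A.stream i).field).drop ((A.stream i).start fs + t) = []) →
      scale fs ≤ t → A.Exhausted fs t ∧
      (StackMachine.step (A.program m pre copy))^[1]
      (some (.run (A.run fs t)), contents [] (fun _ => [])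
        (fun i => (fs (A.stream i).field).drop ((A.stream i).start fs + t))
        (List.replicate (scale fs - t) true) out) =
      (some (.write (A.run fs t)), contents [] (fun _ => []) (fun _ => []) [] out) := by
    intro t h0 hs
    refine ⟨⟨hs, fun i u hu => ?_⟩, ?_⟩
    · have := h0 i
      rw [List.drop_eq_nil_iff] at this
      exact List.getElem?_eq_none (by omega)
    · rw [Function.iterate_one, Nat.sub_eq_zero_of_le hs]
      simp only [h0]
      simp [StackMachine.step, program, contents, act_contents]
  induction R generalizing t with
  | zero =>
    obtain ⟨h1, h2⟩ := key t (fun i => by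
      have := hR i
      rw [List.length_drop] at this
      rw [List.drop_eq_nil_iff]; omega) hs
    exact ⟨1, le_rfl, t, h1, h2⟩
  | succ R ih =>
    by_cases h0 : (∀ i, (fs (A.stream i).field).drop ((A.stream i).start fs + t) = []) ∧ scale fs ≤ t
    · obtain ⟨h1, h2⟩ := key t h0.1 h0.2
      exact ⟨1, by omega, t, h1, h2⟩
    · obtain ⟨n, hn, T, hT, h⟩ := ih (t + 1) (by omega) (fun i => by have := hR i; omega)
      refine ⟨n + 1, by omega, T, hT, ?_⟩
      rw [Function.iterate_succ_apply, ← h]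
      congr 1
      simp only [StackMachine.step, program]
      rw [if_neg]
      · simp only [contents, act_contents, run]
        congr 3
        · congr 1
          · rw [List.head?_replicate]
            by_cases ht : t < scale fs
            · rw [if_neg (by omega)]; simp [ht]
            · rw [if_pos (by omega)]; simp [ht]
          · funext i
            rw [List.head?_drop]; rfl
        · funext i
          simp [Nat.add_assoc]
        · simp [Nat.sub_sub]
      · rintro ⟨h1, h2⟩
        refine h0 ⟨fun i => List.head?_eq_none_iff.mp (h2 i), ?_⟩
        have h1 : (List.replicate (scale fs - t) true).head? = none := h1
        have := List.head?_eq_none_iff.mp h1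
        rw [List.replicate_eq_nil_iff] at this
        omega

/-- The stack `out` already holds the second string, so copying it takes one step. Otherwise it is
emptied symbol by symbol, because the output is the whole stack. -/
theorem write_phase (q : σ) (out : List Bool) :
    ∃ n ≤ out.length + 1, (StackMachine.step (A.program m pre copy))^[n]
      (some (.write q), contents [] (fun _ => []) (fun _ => []) [] out) =
      (none, contents [] (fun _ => []) (fun _ => []) []
        (pre q ++ if copy q = true then out.drop 4 else [])) := by
  by_cases hc : copy q = true
  · refine ⟨1, by omega, ?_⟩
    rw [Function.iterate_one]
    simp [StackMachine.step, program, act_contents, hc]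
  · rw [if_neg hc]
    induction out with
    | nil =>
      refine ⟨1, by omega, ?_⟩
      rw [Function.iterate_one]
      simp [StackMachine.step, program, contents, act_contents, hc]
    | cons b out ih =>
      obtain ⟨n, hn, h⟩ := ih
      refine ⟨n + 1, by simp; omega, ?_⟩
      rw [Function.iterate_succ_apply, ← h]
      congr 1
      simp only [StackMachine.step, program, hc, Bool.false_eq_true, if_false]
      rw [if_neg (by simp [contents])]
      congr 1
      funext k
      cases k <;> rfl

/-- Five phases run one after the other, and each takes at most one step more than the length of the
tape, so the factor `6` leaves some slack. -/
theorem program_run (ws : List (List Bool)) (hm : ws.length = m) :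
    ∃ n ≤ 6 * ((fields ws).length + 1), ∃ T, A.Exhausted (fun j => ws.getD j []) T ∧
      (StackMachine.step (A.program m pre copy))^[n]
        (some (.read 0), contents (fields ws) (fun _ => []) (fun _ => []) [] []) =
      (none, contents [] (fun _ => []) (fun _ => []) []
        (pre (A.run (fun j => ws.getD j []) T) ++
          if copy (A.run (fun j => ws.getD j []) T) = true then (ws.getD 1 []).drop 4 else [])) := by
  set fs : ℕ → List Bool := fun j => ws.getD j [] with hfs
  have hlen : ∀ j, (fs j).length ≤ (fields ws).length := by
    intro j
    by_cases hj : j < ws.length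
    · have : ws[j] ∈ ws := List.getElem_mem hj
      have h2 : (ws[j].map some ++ [none]).Sublist (fields ws) :=
        List.sublist_flatten_of_mem (List.mem_map_of_mem (f := fun w => w.map some ++ [none]) this)
      have h3 := h2.length_le
      rw [List.length_append, List.length_map] at h3
      simp only [hfs, List.getD_eq_getElem _ _ hj]
      omega
    · simp only [hfs]
      rw [List.getD_eq_default _ _ (by omega)]
      simp
  have h1 := A.read_fields m pre copy ws 0 (by rw [hm]; omega) (fun _ => []) (fun _ => []) [] []
  rw [show Fin.ofNat (m + 1) 0 = 0 from rfl] at h1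
  simp only [Nat.zero_le, if_true, Nat.sub_zero, List.append_nil] at h1
  have h2 : StackMachine.step (A.program m pre copy)
      (some (.read (Fin.ofNat (m + 1) (0 + ws.length))),
        contents [] (fun j => (fs (A.bufField j)).reverse) (fun _ => []) [] []) =
      (some .reverse, contents [] (fun j => (fs (A.bufField j)).reverse) (fun _ => []) [] []) := by
    simp [StackMachine.step, program, contents, act_contents]
  obtain ⟨n3, hn3, h3⟩ := A.reverse_phase m pre copy (fields ws).length
    (fun j => (fs (A.bufField j)).reverse) (fun _ => []) [] []
    (fun j => by rw [List.length_reverse]; exact hlen _)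
  obtain ⟨n4, hn4, h4⟩ := A.skip_phase m pre copy (fields ws).length
    ((fs (A.bufField none)).reverse.drop 3)
    (by rw [List.length_drop, List.length_reverse]; have := hlen (A.bufField none); omega)
    (fun i => ((fs (A.stream i).field).drop (A.stream i).shift)) [] (fs 1)
  -- After three symbols are dropped, the number of pairs, rounded up, is half the original length,
  -- rounded down, less one; truncated subtraction makes this hold for short strings too.
  have hscale : (((fs (A.bufField none)).reverse.drop 3).length + 1) / 2 = scale fs := by
    rw [List.length_drop, List.length_reverse, scale, bufField]
    omega
  rw [hscale] at h4
  obtain ⟨n5, hn5, T, hT, h5⟩ := A.run_phase m pre copy fs (fields ws).length 0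
    (by have := hlen 0; unfold scale; omega)
    (fun i => by rw [List.length_drop]; have := hlen (A.stream i).field; omega) (fs 1)
  obtain ⟨n6, hn6, h6⟩ := A.write_phase m pre copy (A.run fs T) (fs 1)
  have h7 := hlen 1
  refine ⟨n6 + (n5 + (n4 + (n3 + (1 + (fields ws).length)))), by omega, T, hT, ?_⟩
  rw [Function.iterate_add_apply, Function.iterate_add_apply, Function.iterate_add_apply,
    Function.iterate_add_apply, Function.iterate_add_apply, h1, Function.iterate_one]
  change _ = (none, contents [] (fun _ => []) (fun _ => []) []
        (pre (A.run fs T) ++ if copy (A.run fs T) = true then (fs 1).drop 4 else []))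
  rw [← h6, ← h5]
  change _^[n6] (_^[n5] (_^[n4] (_^[n3] (StackMachine.step (A.program m pre copy)
      (some (.read (Fin.ofNat (m + 1) (0 + ws.length))),
        contents [] (fun j => (fs (A.bufField j)).reverse) (fun _ => []) [] [])))) ) = _
  rw [h2, h3]
  simp only [List.reverse_reverse, List.append_nil]
  have h8 : (fun i : ι => (fs (A.bufField (some (some i)))).drop (A.stream i).shift) =
      fun i => (fs (A.stream i).field).drop (A.stream i).shift := rfl
  rw [show (fs (A.bufField (some none))) = fs 1 from rfl, h8, h4]
  congr 2
  simp [List.drop_drop, BitStream.start, run, Nat.add_comm]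

end

end SyncAutomaton

/-- A function computed by a synchronous automaton can be evaluated in linear time. The output may
also contain the second bit string without its first four bits. -/
theorem Regular.linearTimeOn {α τ : Type} {F : (ℕ → List Bool) → τ} (hF : Regular F)
    (m : ℕ) (ws : α → List (List Bool)) (hm : ∀ a, (ws a).length = m)
    (valid : α → Prop) (size : α → ℕ) (c : ℕ)
    (hc : ∀ a, valid a → (fields (ws a)).length ≤ c * (size a + 1))
    (pre : τ → List Bool) (copy : τ → Bool) :
    LinearTimeOn valid size (fun a => fields (ws a))
      (fun a => pre (F fun j => (ws a).getD j []) ++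
        if copy (F fun j => (ws a).getD j []) = true then ((ws a).getD 1 []).drop 4 else []) := by
  classical
  obtain ⟨ι, σ, _, _, A, out, hA⟩ := hF
  let _ : Fintype (SyncAutomaton.Stack ι) := Fintype.ofFinite _
  let _ : Fintype (SyncAutomaton.State m σ) := Fintype.ofFinite _
  let δ := A.program m (fun q => pre (out q)) (fun q => copy (out q))
  refine ⟨⟨StackMachine.toTM2 δ (.read 0) .tape .out, Equiv.refl _, Equiv.refl _⟩,
    12 * (c + 1), fun a ha => ?_⟩
  obtain ⟨n, hn, T, hT, h⟩ := A.program_run m (fun q => pre (out q)) (fun q => copy (out q)) (ws a) (hm a)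
  simp only [hA _ T hT] at h
  have h1 : ∀ l : List (Option Bool),
      (SyncAutomaton.contents l (fun _ => []) (fun _ => []) [] [] :
        ∀ k : SyncAutomaton.Stack ι, List k.Alphabet) = StackMachine.single .tape l := by
    intro l
    funext k
    cases k <;> simp [SyncAutomaton.contents, StackMachine.single]
  have h2 : ∀ l : List Bool,
      (SyncAutomaton.contents [] (fun _ => []) (fun _ => []) [] l :
        ∀ k : SyncAutomaton.Stack ι, List k.Alphabet) = StackMachine.single .out l := by
    intro l
    funext k
    cases k <;> simp [SyncAutomaton.contents, StackMachine.single]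
  rw [h1, h2] at h
  obtain ⟨e⟩ := StackMachine.outputsInTime δ (.read 0) .tape .out n _ _ h
  refine ⟨⟨⟨e.steps, ?_⟩, e.steps_le_m.trans ?_⟩⟩
  · convert e.evals_in_steps using 2
    · exact congrArg (fun l => some (Turing.initList _ l)) (List.map_id _)
    · exact congrArg some (List.map_id _)
  -- Two machine steps for each of at most `6 * (length + 1)` simulated steps give the factor `12`;
  -- the tape has length at most `c * (size a + 1)`.
  · have := hc a ha
    nlinarith

/-! ## Closure properties of regular functions -/

namespace Regular

variable {τ τ₁ τ₂ : Type}

theorem const (a : τ) : Regular fun _ => a :=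
  ⟨Empty, Unit, inferInstance, inferInstance, ⟨Empty.elim, (), fun _ _ _ => ()⟩, fun _ => a,
    fun _ _ _ => rfl⟩

theorem map {F : (ℕ → List Bool) → τ₁} (hF : Regular F) (g : τ₁ → τ) :
    Regular fun fs => g (F fs) := by
  obtain ⟨ι, σ, h1, h2, A, out, h⟩ := hF
  exact ⟨ι, σ, h1, h2, A, fun q => g (out q), fun fs T hT => congrArg g (h fs T hT)⟩

/-- The product automaton. An exhausted time for the product is one for both factors. -/
theorem map₂ {F : (ℕ → List Bool) → τ₁} {G : (ℕ → List Bool) → τ₂} (hF : Regular F)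
    (hG : Regular G) (g : τ₁ → τ₂ → τ) : Regular fun fs => g (F fs) (G fs) := by
  obtain ⟨ι, σ, h1, h2, A, out, h⟩ := hF
  obtain ⟨ι', σ', h1', h2', A', out', h'⟩ := hG
  let P : SyncAutomaton (ι ⊕ ι') (σ × σ') :=
    ⟨Sum.elim A.stream A'.stream, (A.init, A'.init), fun q b c =>
      (A.next q.1 b fun i => c (.inl i), A'.next q.2 b fun i => c (.inr i))⟩
  refine ⟨ι ⊕ ι', σ × σ', inferInstance, inferInstance, P,
    fun q => g (out q.1) (out' q.2), fun fs T hT => ?_⟩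
  have hrun : ∀ t, P.run fs t = (A.run fs t, A'.run fs t) := by
    intro t
    induction t with
    | zero => rfl
    | succ t ih => rw [SyncAutomaton.run, ih]; rfl
  rw [hrun]
  exact congrArg₂ g (h fs T ⟨hT.1, fun i => hT.2 (.inl i)⟩) (h' fs T ⟨hT.1, fun i => hT.2 (.inr i)⟩)

theorem and {P Q : (ℕ → List Bool) → Prop} (hP : Regular P) (hQ : Regular Q) :
    Regular fun fs => P fs ∧ Q fs := hP.map₂ hQ And

theorem or {P Q : (ℕ → List Bool) → Prop} (hP : Regular P) (hQ : Regular Q) :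
    Regular fun fs => P fs ∨ Q fs := hP.map₂ hQ Or

theorem not {P : (ℕ → List Bool) → Prop} (hP : Regular P) : Regular fun fs => ¬ P fs := hP.map Not

/-- The first symbol of a stream. -/
theorem head (d : BitStream) : Regular fun fs => d.get fs 0 := by
  let A : SyncAutomaton Unit (Option (Option Bool)) :=
    ⟨fun _ => d, none, fun q _ c => if q = none then some (c ()) else q⟩
  refine ⟨Unit, _, inferInstance, inferInstance, A, fun q => q.getD none, fun fs T hT => ?_⟩
  have hrun : ∀ t, A.run fs (t + 1) = some (d.get fs 0) := by
    intro t
    induction t with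
    | zero => simp [SyncAutomaton.run, A]
    | succ t ih => rw [SyncAutomaton.run, ih]; simp [A]
  cases T with
  | zero => exact (hT.2 () 0 le_rfl).symm
  | succ t => simp [hrun]

/-- A condition on all the columns of several streams. -/
theorem all {ι : Type} [Finite ι] (d : ι → BitStream) (φ : Bool → (ι → Option Bool) → Prop)
    (hφ : φ false fun _ => none) :
    Regular fun fs => ∀ t, φ (decide (t < scale fs)) fun i => (d i).get fs t := by
  classical
  let A : SyncAutomaton ι Bool := ⟨d, true, fun q b c => q && decide (φ b c)⟩
  refine ⟨ι, Bool, inferInstance, inferInstance, A, fun q => q = true, fun fs T hT => ?_⟩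
  have hrun : ∀ t, A.run fs t = true ↔
      ∀ u < t, φ (decide (u < scale fs)) fun i => (d i).get fs u := by
    intro t
    induction t with
    | zero => simp [SyncAutomaton.run, A]
    | succ t ih =>
      rw [SyncAutomaton.run, Nat.forall_lt_succ_right, ← ih]
      simp [A]
  refine propext ((hrun T).trans ?_)
  refine ⟨fun h t => ?_, fun h u _ => h u⟩
  by_cases ht : t < T
  · exact h t ht
  -- From `T` on all columns are empty and the clock is off, which is the case covered by `hφ`.
  · have h1 : (fun i => (d i).get fs t) = fun _ => none :=
      funext fun i => hT.2 i t (by omega)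
    have h2 : ¬ t < scale fs := by have := hT.1; omega
    rw [h1, decide_eq_false h2]
    exact hφ

end Regular

/-- A bit of one of several bit strings; it is `0` behind the end of the string. -/
def bitAt (fs : ℕ → List Bool) (f o : ℕ) : Bool := ((fs f)[o]?).getD false

/-- The comparison of two binary numbers with `t` digits. -/
def leBits (a b : ℕ → Bool) : ℕ → Prop
  | 0 => True
  | t + 1 => if a t = b t then leBits a b t else a t = false

namespace Regular

theorem bit (f α β : ℕ) : Regular fun fs => bitAt fs f (α * scale fs + β) = true :=
  (head ⟨f, α, β⟩).map fun o => o.getD false = true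

theorem lt_length (f α β : ℕ) : Regular fun fs => α * scale fs + β < (fs f).length := by
  have := (head ⟨f, α, β⟩).map fun o => o.isSome = true
  simpa [BitStream.get, BitStream.start] using this

/-- A finite automaton cannot count to `scale`; the clock bit it sees tells it where to stop
comparing. -/
theorem chunk_eq (f α β f' α' β' : ℕ) : Regular fun fs => ∀ t < scale fs,
    bitAt fs f (α * scale fs + β + t) = bitAt fs f' (α' * scale fs + β' + t) := by
  have := all (ι := Bool) (fun i => cond i ⟨f, α, β⟩ ⟨f', α', β'⟩)
    (fun b c => b = true → (c true).getD false = (c false).getD false) (by simp)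
  simpa [BitStream.get, BitStream.start, bitAt] using this

/-- Missing digits count as `0`, so strings of different lengths may agree. -/
theorem tail_eq (f α β f' α' β' : ℕ) : Regular fun fs => ∀ t,
    bitAt fs f (α * scale fs + β + t) = bitAt fs f' (α' * scale fs + β' + t) := by
  have := all (ι := Bool) (fun i => cond i ⟨f, α, β⟩ ⟨f', α', β'⟩)
    (fun b c => (c true).getD false = (c false).getD false) (by simp)
  simpa [BitStream.get, BitStream.start, bitAt] using this

/-- The digits arrive with the least significant one first, so at each position where they differ
the verdict is overwritten. A single bit of state suffices. -/
theorem chunk_le (f α β f' α' β' : ℕ) : Regular fun fs =>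
    leBits (fun t => bitAt fs f (α * scale fs + β + t))
      (fun t => bitAt fs f' (α' * scale fs + β' + t)) (scale fs) := by
  let A : SyncAutomaton Bool Bool := ⟨fun i => cond i ⟨f, α, β⟩ ⟨f', α', β'⟩, true,
    fun q b c => if b = true then
      (if (c true).getD false = (c false).getD false then q else !(c true).getD false) else q⟩
  refine ⟨Bool, Bool, inferInstance, inferInstance, A, fun q => q = true, fun fs T hT => ?_⟩
  have hrun : ∀ t, (A.run fs t = true) ↔ leBits (fun t => bitAt fs f (α * scale fs + β + t))
      (fun t => bitAt fs f' (α' * scale fs + β' + t)) (min t (scale fs)) := by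
    intro t
    induction t with
    | zero => simp [SyncAutomaton.run, A, leBits]
    | succ t ih =>
      rw [SyncAutomaton.run]
      by_cases ht : t < scale fs
      · rw [min_eq_left (by omega)] at ih
        rw [min_eq_left (by omega), leBits, ← ih]
        have aux : ∀ c d q : Bool,
            ((if c = d then q else !c) = true) ↔ (if c = d then q = true else c = false) := by
          decide
        simp only [A, ht, decide_true, if_true]
        exact aux _ _ _
      · rw [min_eq_right (by omega)] at ih
        rw [min_eq_right (by omega), ← ih]
        simp [A, ht]
  refine propext ((hrun T).trans ?_)
  rw [min_eq_right hT.1]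

end Regular

/-! ## Numbers in binary -/

theorem getD_bits (k o : ℕ) : (k.bits[o]?).getD false = k.testBit o := by
  rw [Nat.testBit_eq_inth, List.getI, List.getD]
  rfl

theorem lt_length_bits (k o : ℕ) : o < k.bits.length ↔ 2 ^ o ≤ k := by
  rw [Nat.size_eq_bits_len, Nat.lt_size]

theorem bits_injective {k l : ℕ} (h : k.bits = l.bits) : k = l :=
  Nat.eq_of_testBit_eq fun i => by rw [← getD_bits, ← getD_bits, h]

theorem testBit_chunk_eq_iff (x y o o' s : ℕ) :
    (∀ t < s, x.testBit (o + t) = y.testBit (o' + t)) ↔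
      x / 2 ^ o % 2 ^ s = y / 2 ^ o' % 2 ^ s := by
  constructor
  · intro h
    refine Nat.eq_of_testBit_eq fun i => ?_
    rw [Nat.testBit_mod_two_pow, Nat.testBit_mod_two_pow, Nat.testBit_div_two_pow,
      Nat.testBit_div_two_pow]
    by_cases hi : i < s
    · simp [hi, Nat.add_comm i, h i hi]
    · simp [hi]
  · intro h t ht
    have := congrArg (fun z => z.testBit t) h
    simpa [Nat.testBit_mod_two_pow, Nat.testBit_div_two_pow, ht, Nat.add_comm t] using this

theorem testBit_tail_eq_iff (x y o o' : ℕ) :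
    (∀ t, x.testBit (o + t) = y.testBit (o' + t)) ↔ x / 2 ^ o = y / 2 ^ o' := by
  constructor
  · intro h
    refine Nat.eq_of_testBit_eq fun i => ?_
    rw [Nat.testBit_div_two_pow, Nat.testBit_div_two_pow, Nat.add_comm i, Nat.add_comm i, h]
  · intro h t
    have := congrArg (fun z => z.testBit t) h
    simpa [Nat.testBit_div_two_pow, Nat.add_comm t] using this

theorem leBits_testBit_iff (x y o o' s : ℕ) :
    leBits (fun t => x.testBit (o + t)) (fun t => y.testBit (o' + t)) s ↔
      x / 2 ^ o % 2 ^ s ≤ y / 2 ^ o' % 2 ^ s := by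
  have key : ∀ x y s, leBits (fun t => x.testBit t) (fun t => y.testBit t) s ↔
      x % 2 ^ s ≤ y % 2 ^ s := by
    intro x y s
    induction s with
    | zero => simp [leBits, Nat.mod_one]
    | succ s ih =>
      rw [leBits, Nat.mod_pow_succ, Nat.mod_pow_succ, Nat.testBit_eq_decide_div_mod_eq,
        Nat.testBit_eq_decide_div_mod_eq]
      have hx := Nat.mod_lt x (Nat.two_pow_pos s)
      have hy := Nat.mod_lt y (Nat.two_pow_pos s)
      rcases Nat.mod_two_eq_zero_or_one (x / 2 ^ s) with h | h <;>
        rcases Nat.mod_two_eq_zero_or_one (y / 2 ^ s) with h' | h' <;>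
        simp [ih, h, h'] <;> omega
  rw [← key]
  simp [Nat.testBit_div_two_pow, Nat.add_comm]

/-! ## Guarded projections -/

theorem Regular.pi {ι : Type} [Finite ι] {τ : ι → Type} {F : ∀ i, (ℕ → List Bool) → τ i}
    (hF : ∀ i, Regular (F i)) : Regular fun fs i => F i fs := by
  choose κ σ h1 h2 A out h using hF
  let P : SyncAutomaton (Σ i, κ i) (∀ i, σ i) :=
    ⟨fun j => (A j.1).stream j.2, fun i => (A i).init, fun q b c i =>
      (A i).next (q i) b fun j => c ⟨i, j⟩⟩
  refine ⟨Σ i, κ i, ∀ i, σ i, inferInstance, inferInstance, P, fun q i => out i (q i),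
    fun fs T hT => ?_⟩
  have hrun : ∀ t, P.run fs t = fun i => (A i).run fs t := by
    intro t
    induction t with
    | zero => rfl
    | succ t ih => rw [SyncAutomaton.run, ih]; rfl
  rw [hrun]
  exact funext fun i => h i fs T ⟨hT.1, fun j => hT.2 ⟨i, j⟩⟩

theorem Regular.forall_lt (c : ℕ) {P : ℕ → (ℕ → List Bool) → Prop} (hP : ∀ j, Regular (P j)) :
    Regular fun fs => ∀ j < c, P j fs := by
  have := (Regular.pi (ι := Fin c) fun j => hP j).map fun q => ∀ j, q j
  simpa [Fin.forall_iff] using this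

/-- The clock only measures `scale` positions, so the range is cut into two chunks of this length
and `c` individually compared bits. -/
theorem Regular.low_eq (c f β f' β' : ℕ) : Regular fun fs => ∀ t < 2 * scale fs + c,
    bitAt fs f (β + t) = bitAt fs f' (β' + t) := by
  have h1 := Regular.chunk_eq f 0 β f' 0 β'
  have h2 := Regular.chunk_eq f 1 β f' 1 β'
  have h3 := Regular.forall_lt c (P := fun j fs =>
      (bitAt fs f (2 * scale fs + (β + j)) = true ↔
        bitAt fs f' (2 * scale fs + (β' + j)) = true))
    fun j => (Regular.bit f 2 (β + j)).map₂ (Regular.bit f' 2 (β' + j)) Iff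
  have := (h1.and h2).and h3
  convert this using 2 with fs
  constructor
  · intro h
    refine ⟨⟨fun t ht => ?_, fun t ht => ?_⟩, fun j hj => ?_⟩
    · simpa using h t (by omega)
    · have := h (scale fs + t) (by omega)
      rw [show 1 * scale fs + β + t = β + (scale fs + t) by omega, this]
      congr 1; omega
    · have := h (2 * scale fs + j) (by omega)
      rw [show 2 * scale fs + (β + j) = β + (2 * scale fs + j) by omega, this,
        show 2 * scale fs + (β' + j) = β' + (2 * scale fs + j) by omega]
  · rintro ⟨⟨h1, h2⟩, h3⟩ t ht
    rcases lt_or_ge t (scale fs) with h | h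
    · simpa using h1 t h
    · obtain ⟨t, rfl⟩ := Nat.exists_eq_add_of_le h
      rcases lt_or_ge t (scale fs) with h' | h'
      · have := h2 t h'
        rw [show β + (scale fs + t) = 1 * scale fs + β + t by omega, this]
        congr 1; omega
      · obtain ⟨t, rfl⟩ := Nat.exists_eq_add_of_le h'
        have := Bool.eq_iff_iff.mpr (h3 t (by omega))
        rw [show β + (scale fs + (scale fs + t)) = 2 * scale fs + (β + t) by omega, this]
        congr 1; omega

theorem Regular.take (c f : ℕ) : Regular fun fs => (fs f).take c := by
  have := (Regular.pi (ι := Fin c) fun j => Regular.head ⟨f, 0, j⟩).map fun q =>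
    (List.ofFn q).reduceOption
  convert this using 2 with fs
  simp only [BitStream.get, BitStream.start, Nat.zero_mul, Nat.zero_add, Nat.add_zero]
  clear this
  generalize fs f = l
  induction c generalizing l with
  | zero => simp
  | succ c ih =>
    rw [List.ofFn_succ]
    cases l with
    | nil =>
      have h := ih []
      simp only [List.take_nil, List.getElem?_nil] at h ⊢
      rw [List.reduceOption_cons_of_none]
      exact h
    | cons b l =>
      rw [List.take_succ_cons, ih l]
      simp [List.reduceOption_cons_of_some]

/-! ### Gates and circuits of guarded projections -/

/-- The roles of the gates of the circuit for a guarded projection. -/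
inductive GateRole
  | input
  | neg
  | clause
  | valid
  | invalid
  | guarded
  | guardedNeg
  | zero
  | out
  deriving DecidableEq

namespace GateRole

instance : Fintype GateRole :=
  ⟨{input, neg, clause, valid, invalid, guarded, guardedNeg, zero, out}, by
    intro t; cases t <;> decide⟩

instance : Nonempty (GateRole × ℕ) := ⟨(zero, 0)⟩

/-- The first four bits of the name of a gate. -/
def code : GateRole → List Bool
  | input => [true, false, false, false]
  | neg => [false, true, false, false]
  | clause => [true, true, false, false]
  | valid => [false, false, true, false]
  | invalid => [true, false, true, false]
  | guarded => [false, true, true, false]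
  | guardedNeg => [true, true, true, false]
  | zero => [false, false, false, true]
  | out => [true, false, false, true]

theorem length_code (t : GateRole) : t.code.length = 4 := by cases t <;> rfl

theorem code_injective : Function.Injective code := by decide

/-- The name of the `k`-th gate with a given role. -/
def name (g : GateRole × ℕ) : List Bool := g.1.code ++ g.2.bits

theorem name_injective : Function.Injective name := by
  rintro ⟨t, k⟩ ⟨t', k'⟩ h
  obtain ⟨h1, h2⟩ := List.append_inj h (by simp [length_code])
  exact Prod.ext (code_injective h1) (bits_injective h2)

/-- The role and the number of the gate with a given name. -/
noncomputable def ofName : List Bool → GateRole × ℕ := Function.invFun name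

theorem ofName_name (g : GateRole × ℕ) : ofName (name g) = g :=
  Function.leftInverse_invFun name_injective g

theorem take_name (g : GateRole × ℕ) : (name g).take 4 = g.1.code := by
  rw [name, List.take_append_of_le_length (by rw [length_code]), ← length_code g.1,
    List.take_length]

theorem drop_name (g : GateRole × ℕ) : (name g).drop 4 = g.2.bits := by
  rw [name, ← length_code g.1, List.drop_left]

theorem length_name (g : GateRole × ℕ) : (name g).length = 4 + g.2.size := by
  rw [name, List.length_append, length_code, Nat.size_eq_bits_len]

/-- The level of a gate. -/
def level : GateRole → ℕ
  | input => 0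
  | zero => 0
  | neg => 1
  | clause => 2
  | valid => 3
  | invalid => 4
  | guarded => 4
  | guardedNeg => 4
  | out => 5

end GateRole

/-- A bit string is the binary representation of a number unless it ends with a zero. -/
theorem exists_eq_bits_iff (l : List Bool) :
    (∃ k : ℕ, l = k.bits) ↔ ∀ t, l[t]? = some false → l[t + 1]? ≠ none := by
  constructor
  · rintro ⟨k, rfl⟩ t ht hn
    have h1 : t < k.bits.length := by
      by_contra h
      rw [List.getElem?_eq_none (by omega)] at ht
      cases ht
    have h2 : k.bits.length ≤ t + 1 := List.getElem?_eq_none_iff.mp hn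
    have h3 : 2 ^ t ≤ k := (lt_length_bits k t).mp h1
    have h4 : k < 2 ^ (t + 1) := by
      by_contra h
      have := (lt_length_bits k (t + 1)).mpr (by omega)
      omega
    have h5 := getD_bits k t
    rw [ht, Option.getD_some, Nat.testBit_eq_decide_div_mod_eq] at h5
    have h6 : k / 2 ^ t = 1 := by
      apply Nat.div_eq_of_lt_le
      · omega
      · rw [pow_succ] at h4; omega
    rw [h6] at h5
    simp at h5
  · intro h
    induction l with
    | nil => exact ⟨0, by simp⟩
    | cons b l ih =>
      obtain ⟨k, hk⟩ := ih fun t => by simpa using h (t + 1)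
      refine ⟨Nat.bit b k, ?_⟩
      rw [hk, Nat.bits_append_bit]
      rintro rfl
      simp only [Nat.zero_bits] at hk
      have := h 0
      rw [hk] at this
      cases b <;> simp_all

/-- What a guarded projection writes at an output position. -/
inductive Slot
  | const (b : Bool)
  | pos
  | neg

/-- A guarded projection inspects inputs of length `2 ^ (2 * s + par)`. The input is valid if it
satisfies certain implications between its bits. Every output bit on valid inputs is constant, an
input bit or a negated input bit, and on other inputs it is a default value. -/
structure GuardedProjection where
  par : ℕ
  par_pos : 1 ≤ par
  par_le : par ≤ 2
  slope : ℕ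
  shift : ℕ
  imp : ℕ → ℕ → ℕ → Prop
  slot : ℕ → ℕ → Slot
  addr : ℕ → ℕ → ℕ
  dflt : ℕ → ℕ → Prop
  addr_lt : ∀ s p, p < 2 ^ (slope * s + shift) → addr s p < 2 ^ (2 * s + par)

namespace GuardedProjection

noncomputable section

variable (P : GuardedProjection)

/-- The parameter `s` for inputs of length `n`. -/
def param (n : ℕ) : ℕ := n.size / 2 - 1

/-- The lengths of valid inputs. -/
def Good (n : ℕ) : Prop := n = 2 ^ (2 * param n + P.par)

/-- The valid inputs. -/
def Valid (x : List Bool) : Prop :=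
  P.Good x.length ∧ ∀ a < x.length, ∀ b < x.length, P.imp (param x.length) a b →
    x.getD a false = true → x.getD b false = true

/-- The bit that a guarded projection writes at an output position on a valid input. -/
def bit (x : List Bool) (p : ℕ) : Prop :=
  match P.slot (param x.length) p with
  | .const b => b = true
  | .pos => x.getD (P.addr (param x.length) p) false = true
  | .neg => x.getD (P.addr (param x.length) p) false = false

/-- The logarithm of the length of the output. -/
def width (s : ℕ) : ℕ := P.slope * s + P.shift

open Classical in
/-- The function computed by a guarded projection. -/
def eval (x : List Bool) : List Bool :=
  bitString (2 ^ P.width (param x.length)) fun p =>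
    if P.Valid x then P.bit x p else P.dflt (param x.length) p

open Classical in
/-- The number of gates with a given role. -/
def bound (n : ℕ) : GateRole → ℕ
  | .input => if P.Good n then n else 0
  | .neg => if P.Good n then n else 0
  | .clause => if P.Good n then n * n else 0
  | .valid => 1
  | .invalid => 1
  | .guarded => if P.Good n then n else 0
  | .guardedNeg => if P.Good n then n else 0
  | .zero => 1
  | .out => 2 ^ P.width (param n)

open Classical in
/-- The first gate that feeds into an output gate. -/
def first (n p : ℕ) : GateRole × ℕ :=
  if P.Good n then
    match P.slot (param n) p with
    | .const b => if b = true then (.valid, 0) else (.zero, 0)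
    | .pos => (.guarded, P.addr (param n) p)
    | .neg => (.guardedNeg, P.addr (param n) p)
  else (.zero, 0)

open Classical in
/-- The gates that feed into a gate. -/
def preds (n : ℕ) : GateRole × ℕ → List (GateRole × ℕ)
  | (.input, _) => []
  | (.neg, k) => [(.input, k)]
  | (.clause, k) =>
      [(.neg, k % n), (.input, if P.imp (param n) (k % n) (k / n) then k / n else k % n)]
  | (.valid, _) => if P.Good n then (List.range (n * n)).map fun k => (.clause, k) else [(.zero, 0)]
  | (.invalid, _) => [(.valid, 0)]
  | (.guarded, k) => [(.valid, 0), (.input, k)]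
  | (.guardedNeg, k) => [(.valid, 0), (.neg, k)]
  | (.zero, _) => []
  | (.out, p) => [P.first n p, if P.dflt (param n) p then (.invalid, 0) else (.zero, 0)]

/-- The type of a gate. -/
def kind : GateRole × ℕ → GateKind
  | (.input, k) => .input k
  | (.neg, _) => .notGate
  | (.clause, _) => .orGate
  | (.valid, _) => .andGate
  | (.invalid, _) => .notGate
  | (.guarded, _) => .andGate
  | (.guardedNeg, _) => .andGate
  | (.zero, _) => .orGate
  | (.out, _) => .orGate

/-- `addr_lt` gives the bound `2 ^ (2 * s + par)`, which is the number of inputs only for good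
lengths. This is why `first` falls back to the zero gate at other lengths. -/
theorem preds_bound (n : ℕ) (g h : GateRole × ℕ) (hg : g.2 < P.bound n g.1)
    (hh : h ∈ P.preds n g) : h.2 < P.bound n h.1 ∧ h.1.level < g.1.level := by
  obtain ⟨t, k⟩ := g
  have hout : t = .out → (P.first n k).2 < P.bound n (P.first n k).1 ∧
      (P.first n k).1.level < 5 := by
    rintro rfl
    simp only [bound] at hg
    have hlt := P.addr_lt (param n) k hg
    unfold first
    split_ifs with hG
    · unfold Good at hG
      rw [← hG] at hlt
      cases P.slot (param n) k with
      | const b => cases b <;> simp [bound, GateRole.level]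
      | pos => simpa [bound, GateRole.level, show P.Good n from hG] using hlt
      | neg => simpa [bound, GateRole.level, show P.Good n from hG] using hlt
    · simp [bound, GateRole.level]
  cases t <;> simp only [preds, List.not_mem_nil, List.mem_cons, or_false] at hh
  case neg => subst hh; exact ⟨hg, by simp [GateRole.level]⟩
  case clause =>
    by_cases hG : P.Good n
    · simp only [bound, hG, if_true] at hg
      have hn : 0 < n := by by_contra h; simp_all
      have h1 : k % n < n := Nat.mod_lt _ hn
      have h2 : k / n < n := Nat.div_lt_of_lt_mul hg
      rcases hh with rfl | rfl
      · simpa [bound, hG, GateRole.level] using h1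
      · split_ifs <;> simpa [bound, hG, GateRole.level]
    · simp [bound, hG] at hg
  case valid =>
    split_ifs at hh with hG
    · simp only [List.mem_map, List.mem_range] at hh
      obtain ⟨a, ha, rfl⟩ := hh
      simpa [bound, hG, GateRole.level] using ha
    · simp only [List.mem_singleton] at hh
      subst hh; simp [bound, GateRole.level]
  case invalid => subst hh; simp [bound, GateRole.level]
  case guarded =>
    rcases hh with rfl | rfl
    · simp [bound, GateRole.level]
    · exact ⟨hg, by simp [GateRole.level]⟩
  case guardedNeg =>
    rcases hh with rfl | rfl
    · simp [bound, GateRole.level]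
    · exact ⟨hg, by simp [GateRole.level]⟩
  case out =>
    rcases hh with rfl | rfl
    · exact hout rfl
    · split_ifs <;> simp [bound, GateRole.level]

/-- The names of the gates. -/
def gates (n : ℕ) : Finset (List Bool) :=
  Finset.univ.biUnion fun t => (Finset.range (P.bound n t)).image fun k => GateRole.name (t, k)

theorem mem_gates (n : ℕ) (u : List Bool) :
    u ∈ P.gates n ↔ ∃ g : GateRole × ℕ, g.2 < P.bound n g.1 ∧ GateRole.name g = u := by
  simp [gates]

theorem name_mem_gates (n : ℕ) (g : GateRole × ℕ) :
    GateRole.name g ∈ P.gates n ↔ g.2 < P.bound n g.1 := by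
  rw [mem_gates]
  exact ⟨fun ⟨h, hb, he⟩ => GateRole.name_injective he ▸ hb, fun h => ⟨g, h, rfl⟩⟩

/-- The circuit that computes a guarded projection on inputs of length `n`. -/
def circuit (n : ℕ) : BoolCircuit n where
  gates := P.gates n
  kind u := kind (GateRole.ofName u)
  preds u := (P.preds n (GateRole.ofName u)).map GateRole.name
  outputs := (List.range (2 ^ P.width (param n))).map fun p => GateRole.name (.out, p)
  level u := (GateRole.ofName u).1.level
  preds_mem u hu w hw := by
    obtain ⟨g, hg, rfl⟩ := (P.mem_gates n u).mp hu
    rw [GateRole.ofName_name, List.mem_map] at hw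
    obtain ⟨h, hh, rfl⟩ := hw
    exact (P.name_mem_gates n h).mpr (P.preds_bound n g h hg hh).1
  outputs_mem u hu := by
    obtain ⟨p, hp, rfl⟩ := List.mem_map.mp hu
    exact (P.name_mem_gates n _).mpr (List.mem_range.mp hp)
  level_lt u hu w hw := by
    obtain ⟨g, hg, rfl⟩ := (P.mem_gates n u).mp hu
    rw [GateRole.ofName_name, List.mem_map] at hw
    obtain ⟨h, hh, rfl⟩ := hw
    rw [GateRole.ofName_name, GateRole.ofName_name]
    exact (P.preds_bound n g h hg hh).2
  input_wf u hu p hp := by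
    obtain ⟨⟨t, k⟩, hg, rfl⟩ := (P.mem_gates n u).mp hu
    rw [GateRole.ofName_name] at hp ⊢
    cases t <;> simp [kind] at hp
    subst hp
    simp only [bound] at hg
    split_ifs at hg with hG
    · exact ⟨hg, by simp [preds]⟩
    · omega
  not_wf u hu hk := by
    obtain ⟨⟨t, k⟩, hg, rfl⟩ := (P.mem_gates n u).mp hu
    rw [GateRole.ofName_name] at hk ⊢
    cases t <;> simp [kind] at hk <;> simp [preds]

theorem value_name (n : ℕ) (x : List Bool) (g : GateRole × ℕ) (hg : g.2 < P.bound n g.1) :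
    (P.circuit n).value x (GateRole.name g) =
      (kind g).output x ((P.preds n g).map fun h => (P.circuit n).value x (GateRole.name h)) := by
  rw [BoolCircuit.value_eq _ _ _ ((P.name_mem_gates n g).mpr hg)]
  simp only [circuit, GateRole.ofName_name, List.map_map]
  rfl

/-- An output gate computes `(valid ∧ literal) ∨ (invalid ∧ default)`, where `valid` is the
conjunction of all clauses. A constant literal `1` is replaced by `valid` itself. -/
theorem run_circuit (x : List Bool) : (P.circuit x.length).run x = P.eval x := by
  classical
  set n := x.length with hn
  have hval := P.value_name n x
  set val : GateRole × ℕ → Bool := fun g => (P.circuit n).value x (GateRole.name g) with hvaldef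
  replace hval : ∀ g : GateRole × ℕ, g.2 < P.bound n g.1 →
      val g = (kind g).output x ((P.preds n g).map val) := hval
  have hinput : P.Good n → ∀ k < n, val (.input, k) = x.getD k false := fun hG k hk => by
    rw [hval _ (by simpa [bound, hG] using hk)]; rfl
  have hneg : P.Good n → ∀ k < n, val (.neg, k) = !x.getD k false := fun hG k hk => by
    rw [hval _ (by simpa [bound, hG] using hk)]
    simp [kind, preds, GateKind.output, hinput hG k hk]
  -- A disjunction without inputs is false, which supplies the constant `0`.
  have hzero : val (.zero, 0) = false := by
    rw [hval _ (by simp [bound])]; rfl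
  -- Clause number `k` belongs to the pair `(k % n, k / n)`. If no implication is imposed on this
  -- pair, the gate has a bit and its own negation as inputs and is always true, so all `n * n`
  -- numbers can be used.
  have hclause : P.Good n → ∀ k < n * n, (val (.clause, k) = true ↔
      (P.imp (param n) (k % n) (k / n) → x.getD (k % n) false = true →
        x.getD (k / n) false = true)) := fun hG k hk => by
    have h0 : 0 < n := by by_contra h; simp_all
    have h1 : k % n < n := Nat.mod_lt _ h0
    have h2 : k / n < n := Nat.div_lt_of_lt_mul hk
    rw [hval _ (by simpa [bound, hG] using hk)]
    by_cases hi : P.imp (param n) (k % n) (k / n)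
    · simp only [kind, preds, GateKind.output, List.map_cons, List.map_nil, hneg hG _ h1, hi,
        if_true, hinput hG _ h2]
      cases x.getD (k % n) false <;> cases x.getD (k / n) false <;> simp
    · simp only [kind, preds, GateKind.output, List.map_cons, List.map_nil, hneg hG _ h1, hi,
        if_false, hinput hG _ h1]
      cases x.getD (k % n) false <;> simp
  have hvalid : val (.valid, 0) = true ↔ P.Valid x := by
    rw [hval _ (by simp [bound])]
    by_cases hG : P.Good n
    · simp only [kind, preds, GateKind.output, hG, if_true, List.map_map, List.all_map,
        List.all_eq_true, List.mem_range, Function.comp_apply, id_eq]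
      unfold Valid
      rw [← hn]
      constructor
      · refine fun h => ⟨hG, fun a ha b hb => ?_⟩
        have h0 : a + n * b < n * n := by nlinarith
        have h1 := (hclause hG _ h0).mp (h _ h0)
        rwa [Nat.add_mul_mod_self_left, Nat.mod_eq_of_lt ha, Nat.add_mul_div_left _ _ (by omega),
          Nat.div_eq_of_lt ha, Nat.zero_add] at h1
      · intro h k hk
        have h0 : 0 < n := by by_contra h; simp_all
        exact (hclause hG k hk).mpr (h.2 _ (Nat.mod_lt _ h0) _ (Nat.div_lt_of_lt_mul hk))
    · simp [kind, preds, GateKind.output, hG, Valid, ← hn, hzero]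
  have hinvalid : val (.invalid, 0) = true ↔ ¬ P.Valid x := by
    rw [hval _ (by simp [bound]), ← hvalid]
    simp [kind, preds, GateKind.output]
  have hguarded : P.Good n → ∀ k < n, (val (.guarded, k) = true ↔
      P.Valid x ∧ x.getD k false = true) := fun hG k hk => by
    rw [hval _ (by simpa [bound, hG] using hk)]
    simp [kind, preds, GateKind.output, hinput hG k hk, hvalid]
  have hguardedNeg : P.Good n → ∀ k < n, (val (.guardedNeg, k) = true ↔
      P.Valid x ∧ x.getD k false = false) := fun hG k hk => by
    rw [hval _ (by simpa [bound, hG] using hk)]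
    simp [kind, preds, GateKind.output, hneg hG k hk, hvalid]
  have hfirst : ∀ p < 2 ^ P.width (param n), (val (P.first n p) = true ↔
      P.Valid x ∧ P.bit x p) := fun p hp => by
    unfold first bit
    rw [← hn]
    by_cases hG : P.Good n
    · have hlt := P.addr_lt (param n) p hp
      have hG' := hG
      unfold Good at hG'
      rw [← hG'] at hlt
      rw [if_pos hG]
      cases P.slot (param n) p with
      | const b => cases b <;> simp [hzero, hvalid]
      | pos => simpa using hguarded hG _ hlt
      | neg => simpa using hguardedNeg hG _ hlt
    · simp [hG, hzero, Valid, ← hn]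
  have hrun : (P.circuit n).run x =
      (List.range (2 ^ P.width (param n))).map fun p => val (.out, p) := by
    simp [BoolCircuit.run, circuit, hvaldef, Function.comp_def]
  rw [hrun, eval, bitString, ← hn]
  refine List.map_congr_left fun p hp => ?_
  rw [List.mem_range] at hp
  rw [hval _ hp, Bool.eq_iff_iff]
  refine Iff.trans ?_ (@decide_eq_true_iff _ (Classical.propDecidable _)).symm
  simp only [kind, preds, GateKind.output, List.map_cons, List.map_nil, List.any_cons, id_eq,
    List.any_nil, Bool.or_false, Bool.or_eq_true, hfirst p hp]
  by_cases hv : P.Valid x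
  · by_cases hd : P.dflt (param n) p <;> simp [hv, hd, hinvalid, hzero]
  · by_cases hd : P.dflt (param n) p <;> simp [hv, hd, hinvalid, hzero]

end

end GuardedProjection

/-! ## Uniformity of guarded projections -/

theorem LinearTimeOn.congr {α : Type} {valid : α → Prop} {size : α → ℕ}
    {inp : α → List (Option Bool)} {out out' : α → List Bool}
    (h : LinearTimeOn valid size inp out) (ho : ∀ a, valid a → out a = out' a) :
    LinearTimeOn valid size inp out' := by
  obtain ⟨M, t, hM⟩ := h
  exact ⟨M, t, fun a ha => ho a ha ▸ hM a ha⟩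

theorem length_fields (ws : List (List Bool)) :
    (fields ws).length = (ws.map fun w => w.length + 1).sum := by
  simp [fields, List.length_flatMap]

/-- A predicate on several bit strings that is decided by an automaton is decided in linear time. -/
theorem Regular.linearTimeOn_decide {α : Type} {R : (ℕ → List Bool) → Prop} (hR : Regular R)
    (m : ℕ) (ws : α → List (List Bool)) (hm : ∀ a, (ws a).length = m)
    (valid : α → Prop) (size : α → ℕ) (c : ℕ)
    (hc : ∀ a, valid a → (fields (ws a)).length ≤ c * (size a + 1))
    (p : α → Prop) (dp : ∀ a, Decidable (p a))
    (hp : ∀ a, valid a → (R (fun j => (ws a).getD j []) ↔ p a)) :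
    LinearTimeOn valid size (fun a => fields (ws a)) (fun a => [decide (p a)]) := by
  classical
  refine (hR.linearTimeOn m ws hm valid size c hc (fun q => [decide q]) fun _ => false).congr
    fun a ha => ?_
  have h := hp a ha
  simp only [Bool.false_eq_true, if_false, List.append_nil]
  congr 1
  exact decide_eq_decide.mpr h

/-- The string `f`, without its first four bits, is the number `k` in binary. -/
def Represents (fs : ℕ → List Bool) (f k : ℕ) : Prop := ∀ o, bitAt fs f (4 + o) = k.testBit o

theorem represents_of_eq_name {fs : ℕ → List Bool} {f : ℕ} {g : GateRole × ℕ}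
    (h : fs f = GateRole.name g) : Represents fs f g.2 := fun o => by
  rw [bitAt, h, ← List.getElem?_drop, GateRole.drop_name, getD_bits]

/-- This makes an output of length `2 ^ (slope * s + shift)` polynomial in `n`. -/
theorem two_pow_scale_le (n : ℕ) : 2 ^ GuardedProjection.param n ≤ n + 2 := by
  unfold GuardedProjection.param
  rcases Nat.eq_zero_or_pos n.size with h | h
  · simp [h]
  · have h1 : n.size - 1 < n.size := by omega
    have h2 := Nat.lt_size.mp h1
    calc 2 ^ (n.size / 2 - 1) ≤ 2 ^ (n.size - 1) := Nat.pow_le_pow_right (by norm_num) (by omega)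
      _ ≤ n + 2 := by omega

namespace GuardedProjection

variable (P : GuardedProjection)

theorem param_le_size (n : ℕ) : param n ≤ n.size := by unfold param; omega

theorem size_of_good {n : ℕ} (h : P.Good n) : n.size = 2 * param n + P.par + 1 := by
  conv_lhs => rw [show n = 2 ^ (2 * param n + P.par) from h]
  exact Nat.size_pow

/-- In a power of two the leading digit is the only `1`, and the number of digits determines the
exponent. This replaces an equation between numbers by a condition on adjacent digits and one on the
length. -/
theorem good_iff (n : ℕ) : P.Good n ↔ n.bits.length = 2 * param n + P.par + 1 ∧
    ∀ t, n.bits[t]? = some true → n.bits[t + 1]? = none := by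
  set A := 2 * param n + P.par with hA
  have hget : ∀ i, n.bits[i]? = some true ↔ n.testBit i = true := fun i => by
    rw [← getD_bits]
    cases n.bits[i]? <;> simp
  constructor
  · intro h
    have h1 : n.bits.length = A + 1 := by rw [Nat.size_eq_bits_len, P.size_of_good h]
    refine ⟨h1, fun t ht => ?_⟩
    rw [hget, show n = 2 ^ A from h, Nat.testBit_two_pow] at ht
    have : A = t := by simpa using ht
    exact List.getElem?_eq_none (by omega)
  · rintro ⟨h1, h2⟩
    have hlow : 2 ^ A ≤ n := (lt_length_bits n A).mp (by omega)
    have hhigh : n < 2 ^ (A + 1) := by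
      by_contra h
      have := (lt_length_bits n (A + 1)).mpr (by omega)
      omega
    refine Nat.eq_of_testBit_eq fun i => ?_
    rw [Nat.testBit_two_pow, Bool.eq_iff_iff, decide_eq_true_iff]
    constructor
    · intro hi
      have h3 := List.getElem?_eq_none_iff.mp (h2 i ((hget i).mpr hi))
      have h4 : i < n.bits.length := by
        by_contra h
        have := (hget i).mpr hi
        rw [List.getElem?_eq_none (by omega)] at this
        cases this
      omega
    · rintro rfl
      have : n / 2 ^ A = 1 := by
        apply Nat.div_eq_of_lt_le
        · omega
        · rw [pow_succ] at hhigh; omega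
      rw [Nat.testBit_eq_decide_div_mod_eq, this]
      rfl

theorem exists_regular_good : ∃ R, Regular R ∧ ∀ fs n, fs 0 = Nat.bits n → (R fs ↔ P.Good n) := by
  have h1 := Regular.all (ι := Bool) (fun i => cond i ⟨0, 0, 0⟩ ⟨0, 0, 1⟩)
    (fun _ c => c true = some true → c false = none) (by simp)
  have h2 := (Regular.lt_length 0 2 P.par).and (Regular.lt_length 0 2 (P.par + 1)).not
  refine ⟨_, h2.and h1, fun fs n h => ?_⟩
  have hs : scale fs = param n := by rw [scale, h, Nat.size_eq_bits_len, param]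
  rw [good_iff]
  simp only [BitStream.get, BitStream.start, cond_true, cond_false, h, hs, Nat.zero_mul,
    Nat.zero_add, Nat.add_comm 1]
  refine and_congr ?_ Iff.rfl
  omega

open Classical in
theorem bound_le (n : ℕ) (t : GateRole) :
    P.bound n t ≤ 2 ^ ((P.slope + P.shift + 2) * (n.size + 1)) := by
  have h1 := Nat.lt_size_self n
  have h0 : 1 ≤ 2 ^ n.size := Nat.one_le_two_pow
  have h2 : 2 ^ n.size * 2 ^ n.size ≤ 2 ^ ((P.slope + P.shift + 2) * (n.size + 1)) := by
    rw [← pow_add]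
    exact Nat.pow_le_pow_right (by norm_num) (by nlinarith)
  have h3 : 2 ^ P.width (param n) ≤ 2 ^ ((P.slope + P.shift + 2) * (n.size + 1)) := by
    refine Nat.pow_le_pow_right (by norm_num) ?_
    have := param_le_size n
    unfold width
    nlinarith
  cases t <;> simp only [bound] <;> (try split_ifs) <;> nlinarith

open Classical in
theorem bound_le_pow (n : ℕ) (t : GateRole) :
    P.bound n t ≤ (n + 2) ^ (P.slope + P.shift + 2) := by
  have h1 : 2 ^ P.width (param n) ≤ (n + 2) ^ (P.slope + P.shift) := by
    rw [width, pow_add, pow_add]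
    refine Nat.mul_le_mul ?_ (Nat.pow_le_pow_left (by omega) _)
    rw [Nat.mul_comm, pow_mul]
    exact Nat.pow_le_pow_left (two_pow_scale_le n) _
  have h2 : 1 ≤ (n + 2) ^ (P.slope + P.shift) := Nat.one_le_pow _ _ (by omega)
  rw [pow_add]
  generalize (n + 2) ^ (P.slope + P.shift) = X at h1 h2
  have h3 : (n + 2) ^ 2 ≤ X * (n + 2) ^ 2 := Nat.le_mul_of_pos_left _ h2
  have h4 : X ≤ X * (n + 2) ^ 2 := Nat.le_mul_of_pos_right _ (by positivity)
  cases t <;> simp only [bound] <;> (try split_ifs) <;> nlinarith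

theorem card_gates_le (n : ℕ) : (P.gates n).card ≤ (n + 2) ^ (P.slope + P.shift + 6) := by
  calc (P.gates n).card ≤ ∑ t : GateRole, P.bound n t := by
        refine Finset.card_biUnion_le.trans (Finset.sum_le_sum fun t _ => ?_)
        exact Finset.card_image_le.trans (by simp)
    _ ≤ ∑ _t : GateRole, (n + 2) ^ (P.slope + P.shift + 2) :=
        Finset.sum_le_sum fun t _ => P.bound_le_pow n t
    -- There are nine roles; the estimate `9 ≤ 2 ^ 4` costs the additional exponent `4`.
    _ = 9 * (n + 2) ^ (P.slope + P.shift + 2) := by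
        rw [Finset.sum_const, Finset.card_univ, smul_eq_mul]; rfl
    _ ≤ (n + 2) ^ 4 * (n + 2) ^ (P.slope + P.shift + 2) := by
        refine Nat.mul_le_mul ?_ le_rfl
        calc 9 ≤ 2 ^ 4 := by norm_num
          _ ≤ (n + 2) ^ 4 := Nat.pow_le_pow_left (by omega) _
    _ = (n + 2) ^ (P.slope + P.shift + 6) := by rw [← pow_add]; congr 1; omega

/-- The constant in the bound on the lengths of the names of the gates. -/
def nameConst : ℕ := P.slope + P.shift + 6

theorem length_name_le (n : ℕ) (g : GateRole × ℕ) (hg : g.2 < P.bound n g.1) :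
    (GateRole.name g).length ≤ P.nameConst * (n.size + 1) := by
  rw [GateRole.length_name, nameConst]
  have h := Nat.size_le.mpr (hg.trans_le (P.bound_le n g.1))
  nlinarith

/-- The bound on the length of the name of a gate, for a given role. -/
def lengthBound : GateRole → ℕ × ℕ
  | .clause => (4, 2 * P.par)
  | .valid => (0, 0)
  | .invalid => (0, 0)
  | .zero => (0, 0)
  | .out => (P.slope, P.shift)
  | _ => (2, P.par)

/-- The roles that only occur for inputs of the right length. -/
def needsGood : GateRole → Prop
  | .valid => False
  | .invalid => False
  | .zero => False
  | .out => False
  | _ => True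

/-- For good `n` every bound, including `n` and `n * n`, is a power of two, so comparing a gate
number with it only requires the number of binary digits. -/
theorem lt_bound_iff (n : ℕ) (g : GateRole × ℕ) : g.2 < P.bound n g.1 ↔
    (needsGood g.1 → P.Good n) ∧
      g.2.size ≤ (P.lengthBound g.1).1 * param n + (P.lengthBound g.1).2 := by
  classical
  obtain ⟨t, k⟩ := g
  rw [Nat.size_le]
  have hn : P.Good n → n = 2 ^ (2 * param n + P.par) := id
  have hnn : P.Good n → n * n = 2 ^ (4 * param n + 2 * P.par) := fun h => by
    conv_lhs => rw [hn h]
    rw [← pow_add]; congr 1; omega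
  by_cases hG : P.Good n
  · have h1 := hn hG
    have h2 := hnn hG
    cases t <;> simp only [bound, needsGood, lengthBound, width, hG, if_true, ← h1, ← h2] <;> simp
  · cases t <;> simp [bound, needsGood, lengthBound, width, hG]

/-- A string names a gate if it consists of four role bits and a binary number without superfluous
zero, is not too long, and, for certain roles, `n` is good. All four conditions are visible to an
automaton. -/
theorem exists_regular_isGate (t : GateRole) : ∃ R, Regular R ∧ ∀ fs n, fs 0 = Nat.bits n →
    (R fs ↔ ∃ k < P.bound n t, fs 1 = GateRole.name (t, k)) := by
  obtain ⟨G, hG, hG'⟩ := P.exists_regular_good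
  have hcanon := Regular.all (ι := Bool) (fun i => cond i ⟨1, 0, 4⟩ ⟨1, 0, 5⟩)
    (fun _ c => c true = some false → c false ≠ none) (by simp)
  have htake := (Regular.take 4 1).map fun l => l = t.code
  have hlen := (Regular.lt_length 1 (P.lengthBound t).1 ((P.lengthBound t).2 + 4)).not
  have hgood := hG.map fun q => needsGood t → q
  refine ⟨_, (htake.and hcanon).and (hgood.and hlen), fun fs n h => ?_⟩
  have hs : scale fs = param n := by rw [scale, h, Nat.size_eq_bits_len, param]
  have hc : (∀ t, (fs 1)[4 + t]? = some false → (fs 1)[5 + t]? ≠ none) ↔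
      ∃ k : ℕ, (fs 1).drop 4 = k.bits := by
    rw [exists_eq_bits_iff]
    simp only [List.getElem?_drop]
    simp only [show ∀ t, 4 + (t + 1) = 5 + t by omega]
  simp only [BitStream.get, BitStream.start, cond_true, cond_false, hs, Nat.zero_mul,
    Nat.zero_add, hG' fs n h, hc]
  constructor
  · rintro ⟨⟨h1, k, h2⟩, h3, h4⟩
    have h5 : fs 1 = GateRole.name (t, k) := by
      rw [← List.take_append_drop 4 (fs 1), h1, h2]; rfl
    refine ⟨k, (P.lt_bound_iff n (t, k)).mpr ⟨h3, ?_⟩, h5⟩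
    rw [h5, GateRole.length_name] at h4
    simp only at h4 ⊢
    omega
  · rintro ⟨k, hk, h5⟩
    obtain ⟨h3, h4⟩ := (P.lt_bound_iff n (t, k)).mp hk
    refine ⟨⟨by rw [h5, GateRole.take_name], k, by rw [h5, GateRole.drop_name]⟩, h3, ?_⟩
    rw [h5, GateRole.length_name]
    simp only at h4 ⊢
    omega

/-- The part of the description of a gate type that does not depend on the number of the gate. -/
def kindPrefix : GateRole → List Bool
  | .input => [false]
  | .neg => [true]
  | .clause => [true, true]
  | .valid => [true, false]
  | .invalid => [true]
  | .guarded => [true, false]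
  | .guardedNeg => [true, false]
  | .zero => [true, true]
  | .out => [true, true]

open Classical in
-- The description of an input gate contains its number, which no finite set of outputs can express.
-- It is the part of the queried name behind the role bits, and this is the purpose of the copying
-- option of `Regular.linearTimeOn`.
theorem kind_query : LinearTimeOn (α := ℕ × List Bool)
    (fun q => q.2.length ≤ P.nameConst * (q.1.size + 1)) (fun q => q.1.size)
    (fun q => fields [q.1.bits, q.2])
    (fun q => kindCode
      (if q.2 ∈ (P.circuit q.1).gates then some ((P.circuit q.1).kind q.2) else none)) := by
  choose R hR hR' using P.exists_regular_isGate
  have := (Regular.pi hR).linearTimeOn (α := ℕ × List Bool) 2 (fun q => [q.1.bits, q.2])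
    (fun _ => rfl) (fun q => q.2.length ≤ P.nameConst * (q.1.size + 1)) (fun q => q.1.size)
    (P.nameConst + 2)
    (fun q hq => by
      rw [length_fields]
      simp only [List.map_cons, List.map_nil, List.sum_cons, List.sum_nil, Nat.size_eq_bits_len]
      nlinarith)
    (fun F => if h : ∃ t, F t then kindPrefix h.choose else [])
    (fun F => decide (F .input))
  refine this.congr fun q hq => ?_
  set fs : ℕ → List Bool := fun j => [q.1.bits, q.2].getD j []
  have hiff : ∀ t, R t fs ↔ ∃ k < P.bound q.1 t, q.2 = GateRole.name (t, k) :=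
    fun t => hR' t fs q.1 rfl
  by_cases hu : q.2 ∈ P.gates q.1
  · obtain ⟨g, hg, he⟩ := (P.mem_gates _ _).mp hu
    have hiff' : ∀ t, R t fs ↔ t = g.1 := fun t => by
      rw [hiff]
      constructor
      · rintro ⟨k, hk, h⟩
        exact congrArg Prod.fst (GateRole.name_injective (h.symm.trans he.symm))
      · rintro rfl
        exact ⟨g.2, hg, he.symm⟩
    have hex : ∃ t, R t fs := ⟨g.1, (hiff' _).mpr rfl⟩
    have hch : hex.choose = g.1 := (hiff' _).mp hex.choose_spec
    have hmem : q.2 ∈ (P.circuit q.1).gates := hu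
    have hk : (P.circuit q.1).kind q.2 = kind g := by
      simp only [circuit, ← he, GateRole.ofName_name]
    rw [if_pos hmem, hk, dif_pos hex, hch]
    have hd : ([q.1.bits, q.2].getD 1 []).drop 4 = g.2.bits := by
      rw [← GateRole.drop_name g, he]; rfl
    rw [hd]
    obtain ⟨t, k⟩ := g
    cases t <;> simp [hiff', kindPrefix, kind, kindCode]
  · have hnone : ∀ t, ¬ R t fs := fun t h => by
      obtain ⟨k, hk, he⟩ := (hiff t).mp h
      exact hu ((P.mem_gates _ _).mpr ⟨(t, k), hk, he.symm⟩)
    have hmem : ¬ q.2 ∈ (P.circuit q.1).gates := hu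
    rw [if_neg hmem, dif_neg (by simpa using hnone)]
    simp [hnone, kindCode]

/-- The `j`-th output gate carries the number `j`, so the query compares the number in the name with
the index. -/
theorem output_query : LinearTimeOn (α := ℕ × List Bool × ℕ)
    (fun q => q.2.1 ∈ (P.circuit q.1).gates ∧ q.2.2 < 2 ^ (P.nameConst * (q.1.size + 1)))
    (fun q => q.1.size)
    (fun q => fields [q.1.bits, q.2.1, q.2.2.bits])
    (fun q => [decide ((P.circuit q.1).outputs[q.2.2]? = some q.2.1)]) := by
  have hR := ((Regular.take 4 1).map fun l => l = GateRole.out.code).and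
    (Regular.tail_eq 1 0 4 2 0 0)
  refine hR.linearTimeOn_decide 3 (fun q : ℕ × List Bool × ℕ => [q.1.bits, q.2.1, q.2.2.bits])
    (fun _ => rfl) _ (fun q => q.1.size) (2 * P.nameConst + 3) (fun q hq => ?_) _ _ fun q hq => ?_
  · obtain ⟨g, hg, he⟩ := (P.mem_gates _ _).mp hq.1
    have h1 := P.length_name_le q.1 g hg
    rw [he] at h1
    have h2 := Nat.size_le.mpr hq.2
    rw [length_fields]
    simp only [List.map_cons, List.map_nil, List.sum_cons, List.sum_nil, Nat.size_eq_bits_len]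
    nlinarith
  · set fs : ℕ → List Bool := fun j => [q.1.bits, q.2.1, q.2.2.bits].getD j []
    obtain ⟨g, hg, he⟩ := (P.mem_gates _ _).mp hq.1
    have h1 : fs 1 = GateRole.name g := he.symm
    have h2 := represents_of_eq_name h1
    have h3 : ∀ o, bitAt fs 2 o = q.2.2.testBit o := fun o => getD_bits _ _
    simp only [Nat.zero_mul, Nat.zero_add, h2 _, h3, h1, GateRole.take_name]
    have h4 : (∀ t, g.2.testBit t = q.2.2.testBit t) ↔ g.2 = q.2.2 :=
      ⟨Nat.eq_of_testBit_eq, fun h t => by rw [h]⟩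
    rw [h4, GateRole.code_injective.eq_iff]
    simp only [circuit, List.getElem?_map, Option.map_eq_some_iff, ← he,
      GateRole.name_injective.eq_iff]
    constructor
    · rintro ⟨h5, h6⟩
      refine ⟨g.2, ?_, Prod.ext h5.symm rfl⟩
      rw [h5] at hg
      rw [← h6]
      exact List.getElem?_range hg
    · rintro ⟨p, hp, rfl⟩
      refine ⟨rfl, ?_⟩
      obtain ⟨h7, h8⟩ := List.getElem?_eq_some_iff.mp hp
      rw [List.getElem_range] at h8
      exact h8.symm

end GuardedProjection

/-! ### The wires of the circuits -/

namespace GuardedProjection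

/-- The data of a guarded projection can be recognized by automata. -/
structure Recognizable (P : GuardedProjection) : Prop where
  imp : ∃ R, Regular R ∧ ∀ fs k, Represents fs 2 k → k < 2 ^ (4 * scale fs + 2 * P.par) →
    (R fs ↔ P.imp (scale fs) (k % 2 ^ (2 * scale fs + P.par)) (k / 2 ^ (2 * scale fs + P.par)))
  slot : ∃ R, Regular R ∧ ∀ fs k, Represents fs 2 k → k < 2 ^ P.width (scale fs) →
    R fs = P.slot (scale fs) k
  addr : ∃ R, Regular R ∧ ∀ fs j k, Represents fs 1 j → Represents fs 2 k →
    j < 2 ^ (2 * scale fs + P.par) → k < 2 ^ P.width (scale fs) →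
    (R fs ↔ j = P.addr (scale fs) k)
  dflt : ∃ R, Regular R ∧ ∀ fs k, Represents fs 2 k → k < 2 ^ P.width (scale fs) →
    (R fs ↔ P.dflt (scale fs) k)

variable {P : GuardedProjection}

theorem pair_getElem?_eq_some {α : Type} (x y z : α) (i : ℕ) :
    [x, y][i]? = some z ↔ i = 0 ∧ z = x ∨ i = 1 ∧ z = y := by
  rcases i with _ | _ | i
  · simp [eq_comm]
  · simp [eq_comm]
  · simp

theorem singleton_getElem?_eq_some {α : Type} (x z : α) (i : ℕ) :
    [x][i]? = some z ↔ i = 0 ∧ z = x := by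
  rcases i with _ | i
  · simp [eq_comm]
  · simp

open Classical in
-- Apart from the gate `valid`, every gate has at most two wires, which are checked case by case;
-- the wires of `valid` on good lengths list the clauses in order, so there the index is the clause
-- number. The number of a predecessor is `0`, the number of the gate, its remainder or quotient by
-- `n`, or an address recognized by assumption.
theorem Recognizable.exists_regular_wire (hP : P.Recognizable) : ∃ R, Regular R ∧
    ∀ (fs : ℕ → List Bool) (n : ℕ) (g h : GateRole × ℕ) (i : ℕ), fs 0 = n.bits →
      g.2 < P.bound n g.1 → h.2 < P.bound n h.1 →
      fs 1 = GateRole.name g → fs 2 = GateRole.name h → fs 3 = i.bits →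
      (R fs ↔ (P.preds n h)[i]? = some g) := by
  obtain ⟨I, hI, hI'⟩ := hP.imp
  obtain ⟨S, hS, hS'⟩ := hP.slot
  obtain ⟨A, hA, hA'⟩ := hP.addr
  obtain ⟨D, hD, hD'⟩ := hP.dflt
  obtain ⟨G, hG, hG'⟩ := P.exists_regular_good
  have T1 := fun t : GateRole => (Regular.take 4 1).map fun l => l = t.code
  have T2 := fun t : GateRole => (Regular.take 4 2).map fun l => l = t.code
  -- In binary the index `0` is the empty string and `1` is the string `[true]`.
  have i0 := (Regular.lt_length 3 0 0).not
  have i1 := (Regular.bit 3 0 0).and (Regular.lt_length 3 0 1).not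
  -- The offset `4` skips the role bits. `lo` and `hi` compare the first number with the remainder
  -- and the quotient of the second one by `2 ^ (2 * s + par)`, which is `n` for good lengths.
  have eq := Regular.tail_eq 1 0 4 2 0 4
  have lo := Regular.low_eq P.par 1 4 2 4
  have hi := Regular.tail_eq 1 0 4 2 2 (P.par + 4)
  have eqi := Regular.tail_eq 1 0 4 3 0 0
  have sl := fun s : Slot => hS.map fun q => q = s
  have rneg := (T2 .neg).and (i0.and ((T1 .input).and eq))
  have rclause := (T2 .clause).and ((i0.and ((T1 .neg).and lo)).or
    (i1.and ((T1 .input).and ((hI.and hi).or (hI.not.and lo)))))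
  have rvalid := (T2 .valid).and ((hG.and ((T1 .clause).and eqi)).or
    (hG.not.and (i0.and (T1 .zero))))
  have rinvalid := (T2 .invalid).and (i0.and (T1 .valid))
  have rguarded := (T2 .guarded).and ((i0.and (T1 .valid)).or (i1.and ((T1 .input).and eq)))
  have rguardedNeg := (T2 .guardedNeg).and ((i0.and (T1 .valid)).or (i1.and ((T1 .neg).and eq)))
  have rfirst := (hG.and ((((sl (.const false)).and (T1 .zero)).or
    ((sl (.const true)).and (T1 .valid))).or
    (((sl .pos).and ((T1 .guarded).and hA)).or ((sl .neg).and ((T1 .guardedNeg).and hA))))).or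
    (hG.not.and (T1 .zero))
  have rout := (T2 .out).and ((i0.and rfirst).or
    (i1.and ((hD.and (T1 .invalid)).or (hD.not.and (T1 .zero)))))
  refine ⟨_, ((rneg.or rclause).or (rvalid.or rinvalid)).or ((rguarded.or rguardedNeg).or rout),
    fun fs n g h i h0 hg hh h1 h2 h3 => ?_⟩
  have hs : scale fs = param n := by rw [scale, h0, Nat.size_eq_bits_len, param]
  have r1 : Represents fs 1 g.2 := represents_of_eq_name h1
  have r2 : Represents fs 2 h.2 := represents_of_eq_name h2
  have r3 : ∀ o, bitAt fs 3 o = i.testBit o := fun o => by rw [bitAt, h3, getD_bits]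
  have t1 : ∀ t : GateRole, (fs 1).take 4 = t.code ↔ g.1 = t := fun t => by
    rw [h1, GateRole.take_name, GateRole.code_injective.eq_iff]
  have t2 : ∀ t : GateRole, (fs 2).take 4 = t.code ↔ h.1 = t := fun t => by
    rw [h2, GateRole.take_name, GateRole.code_injective.eq_iff]
  have e0 : ¬ 0 * scale fs + 0 < (fs 3).length ↔ i = 0 := by
    rw [h3, lt_length_bits, Nat.zero_mul]; simp
  have e1 : (bitAt fs 3 (0 * scale fs + 0) = true ∧ ¬ 0 * scale fs + 1 < (fs 3).length) ↔
      i = 1 := by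
    rw [h3, lt_length_bits, Nat.zero_mul, r3, Nat.testBit_eq_decide_div_mod_eq]
    simp; omega
  have eeq : (∀ t, bitAt fs 1 (0 * scale fs + 4 + t) = bitAt fs 2 (0 * scale fs + 4 + t)) ↔
      g.2 = h.2 := by
    simp only [Nat.zero_mul, Nat.zero_add, r1 _, r2 _]
    exact ⟨Nat.eq_of_testBit_eq, fun h t => by rw [h]⟩
  have eeqi : (∀ t, bitAt fs 1 (0 * scale fs + 4 + t) = bitAt fs 3 (0 * scale fs + 0 + t)) ↔
      g.2 = i := by
    simp only [Nat.zero_mul, Nat.zero_add, r1 _, r3 _]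
    exact ⟨Nat.eq_of_testBit_eq, fun h t => by rw [h]⟩
  have ehi : (∀ t, bitAt fs 1 (0 * scale fs + 4 + t) =
      bitAt fs 2 (2 * scale fs + (P.par + 4) + t)) ↔
      g.2 = h.2 / 2 ^ (2 * param n + P.par) := by
    have := testBit_tail_eq_iff g.2 h.2 0 (2 * param n + P.par)
    rw [pow_zero, Nat.div_one] at this
    rw [← this]
    refine forall_congr' fun t => ?_
    rw [Nat.zero_mul, Nat.zero_add, Nat.zero_add, r1,
      show 2 * scale fs + (P.par + 4) + t = 4 + (2 * param n + P.par + t) by omega, r2]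
  have elo : g.2 < 2 ^ (2 * param n + P.par) →
      ((∀ t < 2 * scale fs + P.par, bitAt fs 1 (4 + t) = bitAt fs 2 (4 + t)) ↔
        g.2 = h.2 % 2 ^ (2 * param n + P.par)) := fun hlt => by
    have := testBit_chunk_eq_iff g.2 h.2 0 0 (2 * param n + P.par)
    simp only [pow_zero, Nat.div_one, Nat.mod_eq_of_lt hlt, Nat.zero_add] at this
    rw [← this, hs]
    simp only [r1 _, r2 _]
  simp only [t1, t2, e0, e1, eeq, eeqi, ehi, hG' fs n h0]
  obtain ⟨t, k⟩ := h
  obtain ⟨t', k'⟩ := g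
  simp only at *
  have hgood : needsGood t → P.Good n := ((P.lt_bound_iff n (t, k)).mp hh).1
  -- Each of these roles has a single gate, so the role alone identifies it.
  have hzero : t' = .valid ∨ t' = .invalid ∨ t' = .zero → k' = 0 := by
    rintro (rfl | rfl | rfl) <;> simpa [bound] using hg
  have hlt : needsGood t' → t' ≠ .clause → k' < 2 ^ (2 * param n + P.par) := fun h1 h2 => by
    have h3 := ((P.lt_bound_iff n (t', k')).mp hg).1 h1
    have h4 : n = 2 ^ (2 * param n + P.par) := h3
    rw [← h4]
    cases t' <;> first
      | exact h1.elim
      | exact (h2 rfl).elim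
      | (simp only [bound, if_pos h3] at hg; exact hg)
  cases t <;> simp only [reduceCtorEq, false_and, or_false, false_or, true_and, preds,
    singleton_getElem?_eq_some, pair_getElem?_eq_some, Prod.mk.injEq, List.getElem?_nil]
  case clause =>
    have hGn : n = 2 ^ (2 * param n + P.par) := hgood trivial
    have hk : k < 2 ^ (4 * scale fs + 2 * P.par) := by
      have := Nat.size_le.mp ((P.lt_bound_iff n (.clause, k)).mp hh).2
      rw [hs]; exact this
    rw [hI' fs k r2 hk, hs, ← hGn]
    have e2 : t' = .neg → ((∀ t < 2 * scale fs + P.par, bitAt fs 1 (4 + t) = bitAt fs 2 (4 + t)) ↔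
        k' = k % n) := fun h => by
      have := elo (hlt (by rw [h]; trivial) (by rw [h]; simp))
      rwa [← hGn] at this
    have e3 : t' = .input → ((∀ t < 2 * scale fs + P.par,
        bitAt fs 1 (4 + t) = bitAt fs 2 (4 + t)) ↔ k' = k % n) := fun h => by
      have := elo (hlt (by rw [h]; trivial) (by rw [h]; simp))
      rwa [← hGn] at this
    rw [hs] at e2 e3
    refine or_congr (and_congr_right fun _ => and_congr_right e2)
      (and_congr_right fun _ => and_congr_right fun h => ?_)
    rw [e3 h]
    by_cases hi : P.imp (param n) (k % n) (k / n) <;> simp [hi]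
  case valid =>
    by_cases hGn : P.Good n
    · simp only [hGn, true_and, not_true_eq_false, false_and, or_false, if_true,
        List.getElem?_map, Option.map_eq_some_iff, Prod.mk.injEq]
      constructor
      · rintro ⟨rfl, rfl⟩
        refine ⟨k', List.getElem?_range ?_, rfl, rfl⟩
        simpa [bound, hGn] using hg
      · rintro ⟨a, ha, rfl, rfl⟩
        obtain ⟨h7, h8⟩ := List.getElem?_eq_some_iff.mp ha
        rw [List.getElem_range] at h8
        exact ⟨rfl, h8.symm⟩
    · simp only [hGn, false_and, not_false_eq_true, true_and, false_or, if_false,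
        singleton_getElem?_eq_some, Prod.mk.injEq]
      exact and_congr_right fun _ => ⟨fun h => ⟨h, hzero (by simp [h])⟩, fun h => h.1⟩
  case invalid =>
    exact and_congr_right fun _ => ⟨fun h => ⟨h, hzero (by simp [h])⟩, fun h => h.1⟩
  case guarded =>
    refine or_congr (and_congr_right fun _ => ?_) Iff.rfl
    exact ⟨fun h => ⟨h, hzero (by simp [h])⟩, fun h => h.1⟩
  case guardedNeg =>
    refine or_congr (and_congr_right fun _ => ?_) Iff.rfl
    exact ⟨fun h => ⟨h, hzero (by simp [h])⟩, fun h => h.1⟩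
  case out =>
    have hk : k < 2 ^ P.width (scale fs) := by rw [hs]; exact hh
    rw [hS' fs k r2 hk, hD' fs k r2 hk, hs]
    refine or_congr (and_congr_right fun _ => ?_) (and_congr_right fun _ => ?_)
    · unfold first
      by_cases hGn : P.Good n
      · have ha : t' = .guarded ∨ t' = .guardedNeg → (A fs ↔ k' = P.addr (param n) k) := fun h => by
          rw [← hs]
          refine hA' fs k' k r1 r2 ?_ hk
          rw [hs]
          apply hlt <;> rcases h with rfl | rfl <;> simp [needsGood]
        simp only [hGn, true_and, not_true_eq_false, false_and, or_false, if_true]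
        cases P.slot (param n) k with
        | const b =>
          cases b <;> simp only [reduceCtorEq, Slot.const.injEq, false_and, or_false, true_and,
            false_or, Bool.false_eq_true, if_false, if_true, Prod.mk.injEq] <;>
            exact ⟨fun h => ⟨h, hzero (by simp [h])⟩, fun h => h.1⟩
        | pos =>
          simp only [reduceCtorEq, false_and, or_false, true_and, false_or, Prod.mk.injEq]
          exact and_congr_right fun h => ha (.inl h)
        | neg =>
          simp only [reduceCtorEq, false_and, true_and, false_or, Prod.mk.injEq]
          exact and_congr_right fun h => ha (.inr h)
      · simp only [hGn, false_and, not_false_eq_true, true_and, false_or, if_false, Prod.mk.injEq]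
        exact ⟨fun h => ⟨h, hzero (by simp [h])⟩, fun h => h.1⟩
    · by_cases hd : P.dflt (param n) k <;> simp only [hd, true_and, not_true_eq_false, false_and,
        or_false, if_true, not_false_eq_true, false_or, if_false, Prod.mk.injEq] <;>
        exact ⟨fun h => ⟨h, hzero (by simp [h])⟩, fun h => h.1⟩

open Classical in
theorem Recognizable.wire_query (hP : P.Recognizable) :
    LinearTimeOn (α := ℕ × List Bool × List Bool × ℕ)
      (fun q => q.2.1 ∈ (P.circuit q.1).gates ∧ q.2.2.1 ∈ (P.circuit q.1).gates ∧
        q.2.2.2 < 2 ^ (P.nameConst * (q.1.size + 1)))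
      (fun q => q.1.size)
      (fun q => fields [q.1.bits, q.2.1, q.2.2.1, q.2.2.2.bits])
      (fun q => [decide (((P.circuit q.1).preds q.2.2.1)[q.2.2.2]? = some q.2.1)]) := by
  obtain ⟨R, hR, hR'⟩ := hP.exists_regular_wire
  refine hR.linearTimeOn_decide 4
    (fun q : ℕ × List Bool × List Bool × ℕ => [q.1.bits, q.2.1, q.2.2.1, q.2.2.2.bits])
    (fun _ => rfl) _ (fun q => q.1.size) (3 * P.nameConst + 4) (fun q hq => ?_) _ _ fun q hq => ?_
  · obtain ⟨hq1, hq2, hq3⟩ := hq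
    obtain ⟨g, hg, he⟩ := (P.mem_gates _ _).mp hq1
    obtain ⟨g', hg', he'⟩ := (P.mem_gates _ _).mp hq2
    have h1 := P.length_name_le q.1 g hg
    have h2 := P.length_name_le q.1 g' hg'
    rw [he] at h1
    rw [he'] at h2
    have h3 := Nat.size_le.mpr hq3
    rw [length_fields]
    simp only [List.map_cons, List.map_nil, List.sum_cons, List.sum_nil, Nat.size_eq_bits_len]
    nlinarith
  · obtain ⟨hq1, hq2, hq3⟩ := hq
    obtain ⟨g, hg, he⟩ := (P.mem_gates _ _).mp hq1
    obtain ⟨g', hg', he'⟩ := (P.mem_gates _ _).mp hq2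
    rw [hR' _ q.1 g g' q.2.2.2 rfl hg hg' he.symm he'.symm rfl]
    simp only [circuit, ← he, ← he', GateRole.ofName_name, List.getElem?_map,
      Option.map_eq_some_iff, GateRole.name_injective.eq_iff, exists_eq_right]

/-- Guarded projections are computed by uniform families of circuits of constant depth and
polynomial size. -/
theorem Recognizable.uniformAC0 (hP : P.Recognizable) : UniformAC0 P.eval := by
  have hsize : ∀ n : ℕ, ∀ u ∈ (P.circuit n).gates, u.length ≤ P.nameConst * (n.size + 1) := by
    intro n u hu
    obtain ⟨g, hg, rfl⟩ := (P.mem_gates _ _).mp hu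
    exact P.length_name_le n g hg
  have hpow : ∀ n t, P.bound n t ≤ 2 ^ (P.nameConst * (n.size + 1)) := fun n t =>
    (P.bound_le n t).trans (Nat.pow_le_pow_right (by norm_num)
      (Nat.mul_le_mul (by unfold nameConst; omega) le_rfl))
  refine ⟨P.circuit, 5, P.slope + P.shift + 6, P.nameConst, fun x => P.run_circuit x, ?_,
    P.card_gates_le, hsize, ?_, ?_, P.kind_query, hP.wire_query, P.output_query⟩
  · intro n u _
    change (GateRole.ofName u).1.level ≤ 5
    cases (GateRole.ofName u).1 <;> simp [GateRole.level]
  · intro n u hu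
    obtain ⟨⟨t, k⟩, hg, rfl⟩ := (P.mem_gates _ _).mp hu
    have h2 : 2 ≤ 2 ^ (P.nameConst * (n.size + 1)) := by
      calc 2 = 2 ^ 1 := rfl
        _ ≤ _ := Nat.pow_le_pow_right (by norm_num) (by unfold nameConst; nlinarith)
    simp only [circuit, GateRole.ofName_name, List.length_map]
    cases t <;> simp only [preds, List.length_cons, List.length_nil] <;> try omega
    split_ifs with hG
    · rw [List.length_map, List.length_range]
      have := hpow n .clause
      simpa [bound, hG] using this
    · simp; omega
  · intro n
    simp only [circuit, List.length_map, List.length_range]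
    exact hpow n .out

end GuardedProjection

/-! ## The isomorphism type of the group of a code -/

section CodeGroups

open Equiv Equiv.Perm

variable {N : ℕ} (C : Submodule (ZMod 2) (Fin N → ZMod 2))

theorem signBit_eq_zero_iff (σ : Perm (Fin 5)) : signBit σ = 0 ↔ sign σ = 1 := by
  unfold signBit
  split_ifs with h <;> simp [h]

theorem signBit_one : signBit 1 = 0 := by simp [signBit]

theorem signBit_eq_iff (σ τ : Perm (Fin 5)) : signBit σ = signBit τ ↔ (sign σ = 1 ↔ sign τ = 1) := by
  unfold signBit
  split_ifs with h h' h' <;> simp [h, h']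

theorem mem_codeGroup (g : Fin N → Perm (Fin 5)) :
    g ∈ codeGroup C ↔ (fun i => signBit (g i)) ∈ C := Iff.rfl

theorem mulSingle_mem_codeGroup (i : Fin N) (σ : Perm (Fin 5)) (hσ : sign σ = 1) :
    Pi.mulSingle i σ ∈ codeGroup C := by
  rw [mem_codeGroup]
  convert C.zero_mem using 1
  funext k
  by_cases hk : k = i
  · subst hk; simpa using (signBit_eq_zero_iff σ).mpr hσ
  · simp [hk, signBit_one]

/-- The embedding of `A₅` as the alternating group on the block `i`. -/
def altHom (i : Fin N) : alternatingGroup (Fin 5) →* codeGroup C where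
  toFun σ := ⟨Pi.mulSingle i σ.1, mulSingle_mem_codeGroup C i σ.1 (mem_alternatingGroup.mp σ.2)⟩
  map_one' := by simp
  map_mul' σ τ := Subtype.ext (by simp [Pi.mulSingle_mul])

/-- The alternating group on the block `i`. -/
def altBlock (i : Fin N) : Subgroup (codeGroup C) := (altHom C i).range

theorem mem_altBlock (i : Fin N) (g : codeGroup C) :
    g ∈ altBlock C i ↔ (∀ k ≠ i, g.1 k = 1) ∧ sign (g.1 i) = 1 := by
  constructor
  · rintro ⟨σ, rfl⟩
    refine ⟨fun k hk => ?_, ?_⟩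
    · simp [altHom, hk]
    · simpa [altHom] using mem_alternatingGroup.mp σ.2
  · rintro ⟨h1, h2⟩
    refine ⟨⟨g.1 i, mem_alternatingGroup.mpr h2⟩, Subtype.ext (funext fun k => ?_)⟩
    by_cases hk : k = i
    · subst hk; simp [altHom]
    · simp [altHom, hk, h1 k hk]

instance altBlock_normal (i : Fin N) : (altBlock C i).Normal where
  conj_mem t ht g := by
    rw [mem_altBlock] at ht ⊢
    refine ⟨fun k hk => ?_, ?_⟩
    · simp [ht.1 k hk]
    · simp [ht.2]

/-- The centralizer of `A₅` in `S₅` is trivial: if `σ` moves `x` to `y`, choose distinct `z`, `w`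
outside `{x, y}`. The even permutation `τ = (y z)(y w)` fixes `x` and moves `y` to `w`, so `σ τ x =
y` but `τ σ x = w`. -/
theorem exists_even_not_commute (σ : Perm (Fin 5)) (hσ : σ ≠ 1) :
    ∃ τ : Perm (Fin 5), sign τ = 1 ∧ σ * τ ≠ τ * σ := by
  obtain ⟨x, hx⟩ : ∃ x, σ x ≠ x := by
    by_contra! h
    exact hσ (Equiv.ext h)
  have key : ∀ x y : Fin 5, y ≠ x → ∃ z w : Fin 5, z ≠ x ∧ z ≠ y ∧ w ≠ x ∧ w ≠ y ∧ z ≠ w := by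
    decide
  obtain ⟨z, w, h1, h2, h3, h4, h5⟩ := key x (σ x) hx
  refine ⟨swap (σ x) z * swap (σ x) w, by rw [Perm.sign_mul, sign_swap h2.symm, sign_swap h4.symm]; rfl,
    fun h => ?_⟩
  have h6 := congrArg (fun π => π x) h
  simp only [Perm.mul_apply, swap_apply_left] at h6
  rw [swap_apply_of_ne_of_ne hx.symm h3.symm, swap_apply_of_ne_of_ne hx.symm h1.symm,
    swap_apply_of_ne_of_ne h4 h5.symm] at h6
  exact h4 h6.symm

theorem exists_even_ne_one : ∃ σ : Perm (Fin 5), sign σ = 1 ∧ σ ≠ 1 :=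
  ⟨swap 0 1 * swap 1 2, by decide, by decide⟩

/-- A normal subgroup with an element that acts on the block `i` contains the alternating group on
this block. -/
theorem altBlock_le_of_normal (K : Subgroup (codeGroup C)) [hK : K.Normal] (g : codeGroup C)
    (hg : g ∈ K) (i : Fin N) (hi : g.1 i ≠ 1) : altBlock C i ≤ K := by
  obtain ⟨τ, hτ, hc⟩ := exists_even_not_commute (g.1 i) hi
  set t := altHom C i ⟨τ, mem_alternatingGroup.mpr hτ⟩ with ht
  have hti : t.1 i = τ := by simp [ht, altHom]
  have htk : ∀ k ≠ i, t.1 k = 1 := fun k hk => by simp [ht, altHom, hk]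
  -- The commutator of `g` and `t` lies in `K` by normality. Off the block `i` it is trivial because
  -- `t` is, and it is even on the block.
  have hmem : g * (t * g⁻¹ * t⁻¹) ∈ K := K.mul_mem hg (hK.conj_mem _ (K.inv_mem hg) t)
  have hblock : g * (t * g⁻¹ * t⁻¹) ∈ altBlock C i := by
    rw [mem_altBlock]
    refine ⟨fun k hk => by simp [htk k hk], ?_⟩
    simp only [Subgroup.coe_mul, Subgroup.coe_inv, Pi.mul_apply, Pi.inv_apply, Perm.sign_mul, Perm.sign_inv,
      hti, hτ]
    rcases Int.units_eq_one_or (sign (g.1 i)) with h | h <;> rw [h] <;> decide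
  have hne : g * (t * g⁻¹ * t⁻¹) ≠ 1 := fun h => by
    have h1 := congrArg (fun a : codeGroup C => a.1 i) h
    simp only [Subgroup.coe_mul, Subgroup.coe_inv, Pi.mul_apply, Pi.inv_apply, hti,
      Subgroup.coe_one, Pi.one_apply] at h1
    apply hc
    calc g.1 i * τ = g.1 i * (τ * (g.1 i)⁻¹ * τ⁻¹) * (τ * g.1 i) := by group
      _ = τ * g.1 i := by rw [h1, one_mul]
  obtain ⟨a, ha⟩ := hblock
  -- `A₅` is simple, so the normal subgroup pulled back along `altHom` is trivial or everything; the
  -- commutator excludes the former.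
  have hsimple := (inferInstance : (K.comap (altHom C i)).Normal).eq_bot_or_eq_top
  rcases hsimple with h | h
  · have : a ∈ K.comap (altHom C i) := by
      rw [Subgroup.mem_comap, ha]; exact hmem
    rw [h, Subgroup.mem_bot] at this
    rw [this, map_one] at ha
    exact absurd ha.symm hne
  · rintro _ ⟨b, rfl⟩
    have : b ∈ K.comap (altHom C i) := by rw [h]; trivial
    exact this

/-- A nontrivial normal subgroup contains a copy of the nonabelian group `A₅`. -/
theorem codeGroup_isFittingFree : IsFittingFree (codeGroup C) := by
  intro K hK hcomm
  by_contra hne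
  obtain ⟨g, hg1⟩ := Subgroup.ne_bot_iff_exists_ne_one.mp hne
  obtain ⟨i, hi⟩ : ∃ i, g.1.1 i ≠ 1 := by
    by_contra! h
    exact hg1 (Subtype.ext (Subtype.ext (funext h)))
  have hle := altBlock_le_of_normal C K g.1 g.2 i hi
  obtain ⟨σ, hσ, hσ1⟩ := exists_even_ne_one
  obtain ⟨τ, hτ, hc⟩ := exists_even_not_commute σ hσ1
  have := hcomm _ (hle ⟨⟨σ, mem_alternatingGroup.mpr hσ⟩, rfl⟩) _
    (hle ⟨⟨τ, mem_alternatingGroup.mpr hτ⟩, rfl⟩)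
  apply hc
  simpa [altHom] using congrArg (fun a : codeGroup C => a.1 i) this

theorem altBlock_ne_bot (i : Fin N) : altBlock C i ≠ ⊥ := by
  obtain ⟨σ, hσ, hσ1⟩ := exists_even_ne_one
  intro h
  have h1 : altHom C i ⟨σ, mem_alternatingGroup.mpr hσ⟩ ∈ altBlock C i := ⟨_, rfl⟩
  rw [h, Subgroup.mem_bot] at h1
  exact hσ1 (by simpa [altHom] using congrArg (fun a : codeGroup C => a.1 i) h1)

theorem eq_of_altBlock_le {i j : Fin N} (h : altBlock C i ≤ altBlock C j) : i = j := by
  by_contra hij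
  obtain ⟨σ, hσ, hσ1⟩ := exists_even_ne_one
  have h1 := h ⟨⟨σ, mem_alternatingGroup.mpr hσ⟩, rfl⟩
  rw [mem_altBlock] at h1
  exact hσ1 (by simpa [altHom] using h1.1 i hij)

theorem exists_altBlock_le (K : Subgroup (codeGroup C)) [K.Normal] (hK : K ≠ ⊥) :
    ∃ i, altBlock C i ≤ K := by
  obtain ⟨g, hg⟩ := Subgroup.ne_bot_iff_exists_ne_one.mp hK
  obtain ⟨i, hi⟩ : ∃ i, g.1.1 i ≠ 1 := by
    by_contra! h
    exact hg (Subtype.ext (Subtype.ext (funext h)))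
  exact ⟨i, altBlock_le_of_normal C K g.1 g.2 i hi⟩

/-! ### Isomorphisms permute the blocks and preserve signs -/

variable {C} {C' : Submodule (ZMod 2) (Fin N → ZMod 2)}

/-- The image of block `i` is normal and nontrivial, so it contains some block `j`. Applied to
`φ.symm`, the same argument finds a block `i'` inside the preimage of block `j`, hence inside block
`i`. Then `i' = i`, and all inclusions are equalities. -/
theorem exists_map_altBlock_eq (φ : codeGroup C ≃* codeGroup C') (i : Fin N) :
    ∃ j, (altBlock C i).map φ.toMonoidHom = altBlock C' j := by
  have hn : ((altBlock C i).map φ.toMonoidHom).Normal :=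
    (altBlock_normal C i).map _ φ.surjective
  obtain ⟨j, hj⟩ := exists_altBlock_le C' ((altBlock C i).map φ.toMonoidHom) (by
    rw [Ne, Subgroup.map_eq_bot_iff_of_injective _ φ.injective]
    exact altBlock_ne_bot C i)
  have hn' : ((altBlock C' j).map φ.symm.toMonoidHom).Normal :=
    (altBlock_normal C' j).map _ φ.symm.surjective
  obtain ⟨i', hi'⟩ := exists_altBlock_le C ((altBlock C' j).map φ.symm.toMonoidHom) (by
    rw [Ne, Subgroup.map_eq_bot_iff_of_injective _ φ.symm.injective]
    exact altBlock_ne_bot C' j)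
  have hback : (altBlock C' j).map φ.symm.toMonoidHom ≤ altBlock C i := by
    rintro _ ⟨x, hx, rfl⟩
    obtain ⟨y, hy, rfl⟩ := hj hx
    simpa using hy
  obtain rfl := eq_of_altBlock_le C (hi'.trans hback)
  refine ⟨j, le_antisymm ?_ hj⟩
  rintro _ ⟨y, hy, rfl⟩
  obtain ⟨x, hx, hxy⟩ := hi' hy
  rw [← hxy]
  simpa using hx

/-- The sign of a component can be read off from the conjugation action on the alternating group on
the corresponding block. -/
theorem sign_eq_one_iff_inner (g : codeGroup C) (i : Fin N) : sign (g.1 i) = 1 ↔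
    ∃ h ∈ altBlock C i, ∀ t ∈ altBlock C i, g * t * g⁻¹ = h * t * h⁻¹ := by
  constructor
  · intro hs
    refine ⟨altHom C i ⟨g.1 i, mem_alternatingGroup.mpr hs⟩, ⟨_, rfl⟩, fun t ht => ?_⟩
    rw [mem_altBlock] at ht
    refine Subtype.ext (funext fun k => ?_)
    by_cases hk : k = i
    · subst hk; simp [altHom]
    · simp [ht.1 k hk]
  · rintro ⟨h, hh, hconj⟩
    -- This quotient commutes with all even permutations, hence is trivial; so `g` and `h` agree on
    -- the block, and `h` is even there.
    have heq : (h.1 i)⁻¹ * g.1 i = 1 := by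
      by_contra hne
      obtain ⟨τ, hτ, hc⟩ := exists_even_not_commute _ hne
      have h1 := hconj _ ⟨⟨τ, mem_alternatingGroup.mpr hτ⟩, rfl⟩
      have h2 : g.1 i * τ * (g.1 i)⁻¹ = h.1 i * τ * (h.1 i)⁻¹ := by
        simpa [altHom] using congrArg (fun a : codeGroup C => a.1 i) h1
      apply hc
      calc (h.1 i)⁻¹ * g.1 i * τ = (h.1 i)⁻¹ * (g.1 i * τ * (g.1 i)⁻¹) * g.1 i := by group
        _ = τ * ((h.1 i)⁻¹ * g.1 i) := by rw [h2]; group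
    rw [inv_mul_eq_one] at heq
    rw [← heq]
    exact ((mem_altBlock C i h).mp hh).2

/-- The description of evenness in `sign_eq_one_iff_inner` uses only the group structure and the
subgroup of the block, and `φ` transports both. -/
theorem sign_apply_eq_one_iff (φ : codeGroup C ≃* codeGroup C') {i j : Fin N}
    (hij : (altBlock C i).map φ.toMonoidHom = altBlock C' j) (g : codeGroup C) :
    sign ((φ g).1 j) = 1 ↔ sign (g.1 i) = 1 := by
  rw [sign_eq_one_iff_inner, sign_eq_one_iff_inner, ← hij]
  constructor
  · rintro ⟨_, ⟨h, hh, rfl⟩, hc⟩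
    refine ⟨h, hh, fun t ht => φ.injective ?_⟩
    simpa using hc _ ⟨t, ht, rfl⟩
  · rintro ⟨h, hh, hc⟩
    refine ⟨φ h, ⟨h, hh, rfl⟩, ?_⟩
    rintro _ ⟨t, ht, rfl⟩
    simpa using congrArg φ (hc t ht)

theorem exists_signBit_eq (c : Fin N → ZMod 2) :
    ∃ g : Fin N → Perm (Fin 5), (fun i => signBit (g i)) = c := by
  refine ⟨fun i => if c i = 0 then 1 else swap 0 1, funext fun i => ?_⟩
  have h2 : ∀ a : ZMod 2, a ≠ 0 → a = 1 := by decide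
  by_cases h : c i = 0
  · simp [h, signBit_one]
  · simp only [h, if_false]
    rw [h2 _ h]; decide

theorem codeEquivalent_of_mulEquiv (φ : codeGroup C ≃* codeGroup C') : CodeEquivalent C C' := by
  choose σ hσ using exists_map_altBlock_eq φ
  have hinj : Function.Injective σ := fun i j hij => by
    have := (hσ i).trans ((congrArg _ hij).trans (hσ j).symm)
    exact eq_of_altBlock_le C (Subgroup.map_injective φ.injective this).le
  let π : Perm (Fin N) := Equiv.ofBijective σ (Finite.injective_iff_bijective.mp hinj)
  have hsign : ∀ (g : codeGroup C) i, signBit ((φ g).1 (π i)) = signBit (g.1 i) := fun g i =>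
    (signBit_eq_iff _ _).mpr (sign_apply_eq_one_iff φ (hσ i) g)
  -- The inverse appears because `LinearMap.funLeft` acts by precomposition, whereas `π` sends
  -- blocks of the first group to blocks of the second.
  refine ⟨π⁻¹, le_antisymm ?_ ?_⟩
  · rintro _ ⟨c, hc, rfl⟩
    obtain ⟨g, hg⟩ := exists_signBit_eq c
    have hmem : g ∈ codeGroup C := by rw [mem_codeGroup, hg]; exact hc
    have h1 := (φ ⟨g, hmem⟩).2
    rw [mem_codeGroup] at h1
    convert h1 using 1
    funext j
    obtain ⟨i, rfl⟩ := π.surjective j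
    rw [hsign, ← hg]
    simp [LinearMap.funLeft]
  · intro d hd
    obtain ⟨g', hg'⟩ := exists_signBit_eq d
    have hmem : g' ∈ codeGroup C' := by rw [mem_codeGroup, hg']; exact hd
    set g := φ.symm ⟨g', hmem⟩ with hgdef
    refine ⟨fun i => signBit (g.1 i), g.2, funext fun j => ?_⟩
    obtain ⟨i, rfl⟩ := π.surjective j
    rw [← hg', ← show (φ g).1 = g' by simp [hgdef]]
    simpa [LinearMap.funLeft] using (hsign g i).symm

/-- Relabelling the blocks, `g ↦ g ∘ π`, is compatible with coordinatewise signs. -/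
theorem mulEquiv_of_codeEquivalent (h : CodeEquivalent C C') :
    Nonempty (codeGroup C ≃* codeGroup C') := by
  obtain ⟨π, rfl⟩ := h
  refine ⟨⟨⟨fun g => ⟨g.1 ∘ π, ⟨_, g.2, rfl⟩⟩, fun g => ⟨g.1 ∘ π.symm, ?_⟩, fun g => ?_,
    fun g => ?_⟩, fun a b => rfl⟩⟩
  · obtain ⟨c, hc, he⟩ := g.2
    rw [mem_codeGroup]
    refine Eq.mp (congrArg (· ∈ C) (funext fun i => ?_)) hc
    have := congrFun he (π.symm i)
    simpa [LinearMap.funLeft, coordSign] using this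
  · exact Subtype.ext (funext fun i => by simp)
  · exact Subtype.ext (funext fun i => by simp)

theorem nonempty_mulEquiv_iff (C C' : Submodule (ZMod 2) (Fin N → ZMod 2)) :
    Nonempty (codeGroup C ≃* codeGroup C') ↔ CodeEquivalent C C' :=
  ⟨fun ⟨φ⟩ => codeEquivalent_of_mulEquiv φ, mulEquiv_of_codeEquivalent⟩

/-- The two 3-cycles share the point `2` and together move all five points, so `H` is transitive. A
transitive group of prime degree is primitive, and by Jordan's theorem a primitive group with a
3-cycle contains the alternating group. -/
theorem alternatingGroup_le_of_mem (H : Subgroup (Perm (Fin 5)))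
    (h1 : swap 0 1 * swap 1 2 ∈ H) (h2 : swap 2 3 * swap 3 4 ∈ H) :
    alternatingGroup (Fin 5) ≤ H := by
  have hreach : ∀ x : Fin 5, ∃ h ∈ H, h (2 : Fin 5) = x := by
    intro x
    fin_cases x
    · exact ⟨_, h1, by decide⟩
    · exact ⟨_, H.mul_mem h1 h1, by decide⟩
    · exact ⟨1, H.one_mem, rfl⟩
    · exact ⟨_, h2, by decide⟩
    · exact ⟨_, H.mul_mem h2 h2, by decide⟩
  have : MulAction.IsPretransitive H (Fin 5) := ⟨fun x y => by
    obtain ⟨a, ha, rfl⟩ := hreach x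
    obtain ⟨b, hb, rfl⟩ := hreach y
    exact ⟨⟨b * a⁻¹, H.mul_mem hb (H.inv_mem ha)⟩, by simp [Subgroup.smul_def]⟩⟩
  have : MulAction.IsPreprimitive H (Fin 5) :=
    MulAction.IsPreprimitive.of_prime_card (by simpa using Nat.prime_five)
  refine alternatingGroup_le_of_isPreprimitive_of_isThreeCycle_mem this ?_ h1
  rw [← card_support_eq_three_iff]
  decide

end CodeGroups

/-! ## Permutations generating the group of a code -/

section Blocks

open Equiv Equiv.Perm

noncomputable section

/-- The permutations of five points that the generators apply to single blocks. -/
def genPerm (t : ℕ) : Perm (Fin 5) :=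
  if t = 0 then swap 0 1 else if t = 1 then swap 0 1 * swap 1 2
  else if t = 2 then swap 2 3 * swap 3 4 else 1

/-- Whether the generator number `v` of type `t` moves points of the block `i`, for a code spanned
by words with supports `{i | R v i}`. -/
def IsActive (R : ℕ → ℕ → Prop) (t v i : ℕ) : Prop := t = 0 ∧ R v i ∨ (t = 1 ∨ t = 2) ∧ v = i

open Classical in
/-- The generators: for each word `v` the product of transpositions on its support, and for each
block two generators of the alternating group. -/
def blockGen (w m : ℕ) (R : ℕ → ℕ → Prop) (g : Fin (2 ^ (w + 3))) : Fin m → Perm (Fin 5) :=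
  fun i => if IsActive R (g / 2 ^ w) (g % 2 ^ w) i then genPerm (g / 2 ^ w) else 1

open Classical in
/-- The code of length `m` spanned by the words with supports `{i | R v i}`, for `v < 2 ^ w`. -/
def supportCode (w m : ℕ) (R : ℕ → ℕ → Prop) : Submodule (ZMod 2) (Fin m → ZMod 2) :=
  Submodule.span (ZMod 2) (Set.range fun (v : Fin (2 ^ w)) (i : Fin m) => if R v i then 1 else 0)

variable {w m : ℕ} {R : ℕ → ℕ → Prop}

theorem sign_genPerm {t : ℕ} (ht : t ≠ 0) : sign (genPerm t) = 1 := by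
  unfold genPerm
  rw [if_neg ht]
  split_ifs <;> decide

theorem signBit_genPerm_zero : signBit (genPerm 0) = 1 := by decide

/-- Only three types of generators and five points per block matter, but eight values are reserved
for each, so that types and points are groups of three binary digits. The surplus generators are
trivial and the surplus points are fixed. -/
theorem generator_lt {t v : ℕ} (ht : t < 8) (hv : v < 2 ^ w) : t * 2 ^ w + v < 2 ^ (w + 3) := by
  rw [pow_add]
  have : t * 2 ^ w ≤ 7 * 2 ^ w := Nat.mul_le_mul_right _ (by omega)
  omega

open Classical in
theorem blockGen_apply {t v : ℕ} (ht : t < 8) (hv : v < 2 ^ w) :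
    blockGen w m R ⟨t * 2 ^ w + v, generator_lt ht hv⟩ =
      fun i : Fin m => if IsActive R t v i then genPerm t else 1 := by
  have h1 : (t * 2 ^ w + v) / 2 ^ w = t := by
    rw [mul_comm, Nat.mul_add_div (by positivity), Nat.div_eq_of_lt hv, add_zero]
  have h2 : (t * 2 ^ w + v) % 2 ^ w = v := by
    rw [mul_comm, Nat.mul_add_mod, Nat.mod_eq_of_lt hv]
  unfold blockGen
  dsimp only
  rw [h1, h2]

/-- The generators have sign patterns in the code. Conversely, the closure contains `A₅ ^ m` and,
for each codeword, an element with this sign pattern; two elements with equal sign patterns differ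
by an element of `A₅ ^ m`. The bound on `m` ensures that every block has its own pair of 3-cycles.
-/
theorem closure_blockGen (hm : m ≤ 2 ^ w) :
    Subgroup.closure (Set.range (blockGen w m R)) = codeGroup (supportCode w m R) := by
  classical
  apply le_antisymm
  · rw [Subgroup.closure_le]
    rintro _ ⟨g, rfl⟩
    rw [SetLike.mem_coe, mem_codeGroup]
    by_cases ht : (g : ℕ) / 2 ^ w = 0
    · refine Submodule.subset_span ⟨⟨g % 2 ^ w, Nat.mod_lt _ (by positivity)⟩, funext fun i => ?_⟩
      simp only [blockGen, ht, IsActive, true_and, zero_ne_one, OfNat.zero_ne_ofNat, or_self,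
        false_and, or_false]
      split_ifs
      · exact signBit_genPerm_zero.symm
      · exact signBit_one.symm
    · convert (supportCode w m R).zero_mem using 1
      funext i
      simp only [blockGen]
      split_ifs
      · exact (signBit_eq_zero_iff _).mpr (sign_genPerm ht)
      · exact signBit_one
  · set H := Subgroup.closure (Set.range (blockGen w m R)) with hH
    have hmem : ∀ g, blockGen w m R g ∈ H := fun g => Subgroup.subset_closure ⟨g, rfl⟩
    have hsingle : ∀ (i : Fin m) (t : ℕ), t = 1 ∨ t = 2 → Pi.mulSingle i (genPerm t) ∈ H := by
      intro i t ht
      convert hmem ⟨t * 2 ^ w + i, generator_lt (by omega) (by omega)⟩ using 1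
      rw [blockGen_apply (by omega : t < 8) (i.2.trans_le hm)]
      funext k
      by_cases hk : k = i
      · subst hk; simp [IsActive, ht]
      · have h1 : (i : ℕ) ≠ k := fun h => hk (Fin.ext h.symm)
        have h0 : t ≠ 0 := by omega
        simp [hk, IsActive, h1, h0]
    have halt : ∀ (i : Fin m) (σ : Perm (Fin 5)), sign σ = 1 → Pi.mulSingle i σ ∈ H := by
      intro i σ hσ
      have := alternatingGroup_le_of_mem
        (H.comap (MonoidHom.mulSingle (fun _ : Fin m => Perm (Fin 5)) i))
        (hsingle i 1 (Or.inl rfl)) (hsingle i 2 (Or.inr rfl))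
      exact this (mem_alternatingGroup.mpr hσ)
    have hword : ∀ c ∈ supportCode w m R, ∃ h ∈ H, (fun i => signBit (h i)) = c := by
      intro c hc
      induction hc using Submodule.span_induction with
      | mem c hc =>
        obtain ⟨v, rfl⟩ := hc
        refine ⟨_, hmem ⟨0 * 2 ^ w + v, generator_lt (by omega) v.2⟩, funext fun i => ?_⟩
        rw [blockGen_apply (by norm_num : 0 < 8) v.2]
        simp only [IsActive, true_and, zero_ne_one, OfNat.zero_ne_ofNat, or_self,
          false_and, or_false]
        split_ifs
        · exact signBit_genPerm_zero
        · exact signBit_one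
      | zero => exact ⟨1, H.one_mem, funext fun i => signBit_one⟩
      | add a b _ _ ha hb =>
        obtain ⟨g, hg, rfl⟩ := ha
        obtain ⟨h, hh, rfl⟩ := hb
        exact ⟨g * h, H.mul_mem hg hh, funext fun i => signBit_mul _ _⟩
      | smul r a _ ha =>
        have h2 : ∀ r : ZMod 2, r = 0 ∨ r = 1 := by decide
        rcases h2 r with rfl | rfl
        · exact ⟨1, H.one_mem, by funext i; simpa using signBit_one⟩
        · simpa using ha
    intro g hg
    obtain ⟨h, hh, heq⟩ := hword _ ((mem_codeGroup _ _).mp hg)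
    -- Every component of `h⁻¹ * g` is even, so it is a product of even permutations of single
    -- blocks.
    have : h⁻¹ * g ∈ H := Subgroup.pi_mem_of_mulSingle_mem _ fun i => halt i _ (by
      have h1 := (signBit_eq_iff _ _).mp (congrFun heq i)
      simp only [Pi.mul_apply, Pi.inv_apply, Perm.sign_mul, Perm.sign_inv]
      rcases Int.units_eq_one_or (sign (h i)) with h2 | h2 <;>
        rcases Int.units_eq_one_or (sign (g i)) with h3 | h3 <;> simp_all)
    simpa using H.mul_mem hh this

/-- The blocks of five points: the point `q` of the block `i` has the number `q * 2 ^ w + i`. -/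
def blockEmbedding (w m : ℕ) (hm : m ≤ 2 ^ w) : (Σ _ : Fin m, Fin 5) ↪ Fin (2 ^ (w + 3)) where
  toFun a := ⟨a.2 * 2 ^ w + a.1, generator_lt (by omega) (a.1.2.trans_le hm)⟩
  inj' := by
    rintro ⟨i, q⟩ ⟨i', q'⟩ h
    have h := Fin.mk.inj h
    simp only at h
    have hi := i.2.trans_le hm
    have hi' := i'.2.trans_le hm
    have h1 : i = i' := by
      have := congrArg (· % 2 ^ w) h
      simp only [mul_comm _ (2 ^ w), Nat.mul_add_mod, Nat.mod_eq_of_lt hi,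
        Nat.mod_eq_of_lt hi'] at this
      exact Fin.ext this
    subst h1
    have h2 : (q : ℕ) = q' := Nat.eq_of_mul_eq_mul_right (by positivity) (Nat.add_right_cancel h)
    rw [Fin.ext h2]

/-- The generators as permutations of the points. -/
def blockPerms (w m : ℕ) (hm : m ≤ 2 ^ w) (R : ℕ → ℕ → Prop) (g : Fin (2 ^ (w + 3))) :
    Perm (Fin (2 ^ (w + 3))) :=
  blockAction (blockEmbedding w m hm) (blockGen w m R g)

theorem generated_blockPerms (hm : m ≤ 2 ^ w) :
    generated (blockPerms w m hm R) =
      (codeGroup (supportCode w m R)).map (blockAction (blockEmbedding w m hm)) := by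
  rw [← closure_blockGen hm, MonoidHom.map_closure, ← Set.range_comp]
  rfl

theorem blockAction_injective {N M : ℕ} (e : (Σ _ : Fin N, Fin 5) ↪ Fin M) :
    Function.Injective (blockAction e) :=
  (viaEmbeddingHom_injective e).comp sigmaCongrRightHom_injective

/-- The group generated by the generators is the group of the code. -/
def generatedEquiv (hm : m ≤ 2 ^ w) :
    codeGroup (supportCode w m R) ≃* generated (blockPerms w m hm R) :=
  ((codeGroup (supportCode w m R)).equivMapOfInjective _
    (blockAction_injective (blockEmbedding w m hm))).trans
    (MulEquiv.subgroupCongr (generated_blockPerms hm).symm)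

theorem IsFittingFree.of_mulEquiv {G H : Type*} [Group G] [Group H] (hG : IsFittingFree G)
    (φ : G ≃* H) : IsFittingFree H := by
  intro K hK hcomm
  have hn : (K.comap φ.toMonoidHom).Normal := hK.comap _
  have := hG _ hn fun a ha b hb => φ.injective (by simpa using hcomm _ ha _ hb)
  rw [Subgroup.eq_bot_iff_forall] at this ⊢
  intro x hx
  have h1 := this (φ.symm x) (by simpa using hx)
  simpa using h1

theorem isFittingFree_generated (hm : m ≤ 2 ^ w) :
    IsFittingFree (generated (blockPerms w m hm R)) :=
  (codeGroup_isFittingFree _).of_mulEquiv (generatedEquiv hm)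

theorem nonempty_generated_mulEquiv_iff {R' : ℕ → ℕ → Prop} (hm : m ≤ 2 ^ w) :
    Nonempty (generated (blockPerms w m hm R) ≃* generated (blockPerms w m hm R')) ↔
      CodeEquivalent (supportCode w m R) (supportCode w m R') := by
  rw [← nonempty_mulEquiv_iff]
  exact ⟨fun ⟨φ⟩ => ⟨((generatedEquiv hm).trans φ).trans (generatedEquiv hm).symm⟩,
    fun ⟨φ⟩ => ⟨((generatedEquiv hm).symm.trans φ).trans (generatedEquiv hm)⟩⟩

/-- For length `0` the group is trivial, while for length `1` it contains `A₅`. These are the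
outputs on invalid inputs. -/
theorem not_nonempty_generated_mulEquiv {R' : ℕ → ℕ → Prop} (hm : 1 ≤ 2 ^ w) (h0 : 0 ≤ 2 ^ w) :
    ¬ Nonempty (generated (blockPerms w 1 hm R) ≃* generated (blockPerms w 0 h0 R')) := by
  rintro ⟨φ⟩
  obtain ⟨σ, hσ, hne⟩ := exists_even_ne_one
  have ψ := ((generatedEquiv hm).trans φ).trans (generatedEquiv h0).symm
  have := ψ.injective (Subsingleton.elim (ψ ⟨_, mulSingle_mem_codeGroup _ 0 σ hσ⟩) (ψ 1))
  exact hne (by simpa using congrFun (congrArg Subtype.val this) 0)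

/-- The action of `genPerm t` on numbers, fixing all numbers that are not points of a block. -/
def genMove (t k : ℕ) : ℕ := if h : k < 5 then genPerm t ⟨k, h⟩ else k

open Classical in
-- The low digits of a point are its block, which is preserved, and the high digits its position in
-- the block. `genMove` fixes positions from `5` on, so the surplus points need no separate case.
theorem blockPerms_apply_eq_iff (hm : m ≤ 2 ^ w) (g i j : Fin (2 ^ (w + 3))) :
    blockPerms w m hm R g i = j ↔ (j : ℕ) % 2 ^ w = i % 2 ^ w ∧ (j : ℕ) / 2 ^ w =
      if (i : ℕ) % 2 ^ w < m ∧ IsActive R (g / 2 ^ w) (g % 2 ^ w) (i % 2 ^ w) then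
        genMove (g / 2 ^ w) (i / 2 ^ w) else i / 2 ^ w := by
  have hj : ∀ a b : ℕ, b < 2 ^ w → ((j : ℕ) % 2 ^ w = b ∧ (j : ℕ) / 2 ^ w = a ↔ a * 2 ^ w + b = j) := by
    intro a b hb
    constructor
    · rintro ⟨rfl, rfl⟩; rw [mul_comm]; exact Nat.div_add_mod _ _
    · intro h
      rw [← h, mul_comm, Nat.mul_add_mod, Nat.mod_eq_of_lt hb, Nat.mul_add_div (by positivity),
        Nat.div_eq_of_lt hb]
      exact ⟨rfl, rfl⟩
  rw [hj _ _ (Nat.mod_lt _ (by positivity))]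
  by_cases hi : (i : ℕ) % 2 ^ w < m ∧ (i : ℕ) / 2 ^ w < 5
  · have he : i = blockEmbedding w m hm ⟨⟨_, hi.1⟩, ⟨_, hi.2⟩⟩ := by
      apply Fin.ext
      change (i : ℕ) = i / 2 ^ w * 2 ^ w + i % 2 ^ w
      rw [mul_comm]; exact (Nat.div_add_mod _ _).symm
    have happ : blockPerms w m hm R g i =
        blockEmbedding w m hm ⟨⟨_, hi.1⟩, blockGen w m R g ⟨_, hi.1⟩ ⟨_, hi.2⟩⟩ := by
      conv_lhs => rw [he]
      exact viaEmbedding_apply _ _ _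
    rw [happ, Fin.ext_iff]
    simp only [blockEmbedding, blockGen, hi.1, true_and, genMove, hi.2,
      dite_true]
    split_ifs <;> rfl
  · have hfix : blockPerms w m hm R g i = i := by
      refine viaEmbedding_apply_of_notMem _ _ _ ?_
      rintro ⟨⟨k, q⟩, hk⟩
      have hk : (q : ℕ) * 2 ^ w + k = i := congrArg Fin.val hk
      have hlt := k.2.trans_le hm
      apply hi
      rw [← hk, mul_comm, Nat.mul_add_mod, Nat.mod_eq_of_lt hlt, Nat.mul_add_div (by positivity),
        Nat.div_eq_of_lt hlt]
      exact ⟨k.2, q.2⟩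
    have : (if (i : ℕ) % 2 ^ w < m ∧ IsActive R (g / 2 ^ w) (g % 2 ^ w) (i % 2 ^ w) then
        genMove (g / 2 ^ w) (i / 2 ^ w) else i / 2 ^ w) = (i : ℕ) / 2 ^ w := by
      split_ifs with h
      · rw [genMove, dif_neg fun h5 => hi ⟨h.1, h5⟩]
      · rfl
    rw [hfix, this, mul_comm, Nat.div_add_mod, Fin.ext_iff]

end

end Blocks

/-! ## The encoding of permutations -/

theorem bitString_inj {l l' : ℕ} {P Q : ℕ → Prop} :
    bitString l P = bitString l' Q ↔ l = l' ∧ ∀ p < l, (P p ↔ Q p) := by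
  unfold bitString
  constructor
  · intro h
    have hl : l = l' := by simpa using congrArg List.length h
    subst hl
    refine ⟨rfl, fun p hp => ?_⟩
    have := List.map_inj_left.mp h p (List.mem_range.mpr hp)
    simpa using this
  · rintro ⟨rfl, h⟩
    exact List.map_congr_left fun p hp => by simpa using h p (List.mem_range.mp hp)

theorem length_bitString (l : ℕ) (P : ℕ → Prop) : (bitString l P).length = l := by simp [bitString]

theorem getD_bitString {l p : ℕ} (P : ℕ → Prop) (hp : p < l) :
    (bitString l P).getD p false = true ↔ P p := by
  simp [bitString, hp]

theorem digit_eq (s j x : ℕ) (hj : j < 2 ^ s) :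
    (x * 2 ^ s + j) % 2 ^ s = j ∧ (x * 2 ^ s + j) / 2 ^ s = x := by
  rw [mul_comm, Nat.mul_add_mod, Nat.mod_eq_of_lt hj, Nat.mul_add_div (by positivity),
        Nat.div_eq_of_lt hj]
  exact ⟨rfl, rfl⟩

theorem digits_of_three {s b g i j : ℕ} (hg : g < 2 ^ s) (hi : i < 2 ^ s) (hj : j < 2 ^ s) :
    (((b * 2 ^ s + g) * 2 ^ s + i) * 2 ^ s + j) / 2 ^ (3 * s) = b ∧
    digit s 2 (((b * 2 ^ s + g) * 2 ^ s + i) * 2 ^ s + j) = g ∧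
    digit s 1 (((b * 2 ^ s + g) * 2 ^ s + i) * 2 ^ s + j) = i ∧
    digit s 0 (((b * 2 ^ s + g) * 2 ^ s + i) * 2 ^ s + j) = j := by
  unfold digit
  rw [show 3 * s = s + s + s by ring, show s * 2 = s + s by ring, pow_add, pow_add, mul_one,
    mul_zero, pow_zero, Nat.div_one, ← Nat.div_div_eq_div_mul, ← Nat.div_div_eq_div_mul,
    (digit_eq s j _ hj).1, (digit_eq s j _ hj).2, (digit_eq s i _ hi).1, (digit_eq s i _ hi).2,
    (digit_eq s g _ hg).1, (digit_eq s g _ hg).2]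
  exact ⟨rfl, rfl, rfl, rfl⟩

theorem three_digits_lt {s b g i j c : ℕ} (hb : b < c) (hg : g < 2 ^ s) (hi : i < 2 ^ s)
    (hj : j < 2 ^ s) : ((b * 2 ^ s + g) * 2 ^ s + i) * 2 ^ s + j < c * 2 ^ (3 * s) := by
  have step : ∀ x y z : ℕ, x < y → z < 2 ^ s → x * 2 ^ s + z < y * 2 ^ s := fun x y z hx hz =>
    calc x * 2 ^ s + z < (x + 1) * 2 ^ s := by rw [add_mul]; omega
      _ ≤ y * 2 ^ s := Nat.mul_le_mul_right _ hx
  rw [show 3 * s = s + s + s by ring, pow_add, pow_add, ← mul_assoc, ← mul_assoc]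
  exact step _ _ _ (step _ _ _ (step _ _ _ hb hg) hi) hj

section Encoding

variable {s s' L M L' M' : ℕ} {S T : Fin L → Equiv.Perm (Fin M)} {S' T' : Fin L' → Equiv.Perm (Fin M')}

/-- The language quantifies over all encodings, so they must be uniquely readable: the length yields
`s`, the first two tables yield `L` and `M`, and the other two the permutations. -/
theorem encodePermutations_inj (hL : L ≤ 2 ^ s) (hM : M ≤ 2 ^ s) (hL' : L' ≤ 2 ^ s') (hM' : M' ≤ 2 ^ s')
    (h : encodePermutations s S T = encodePermutations s' S' T') :
    ∃ (h1 : L' = L) (h2 : M' = M), S = (by subst h1 h2; exact S') ∧ T = (by subst h1 h2; exact T') := by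
  obtain ⟨hlen, hbit⟩ := bitString_inj.mp h
  obtain rfl : s = s' := by
    have := Nat.pow_right_injective le_rfl (Nat.eq_of_mul_eq_mul_left (by norm_num) hlen)
    omega
  have hpos : 0 < 2 ^ s := by positivity
  have key : ∀ b g i j, b < 4 → g < 2 ^ s → i < 2 ^ s → j < 2 ^ s → _ := fun b g i j hb hg hi hj =>
    hbit _ (three_digits_lt hb hg hi hj)
  simp only at key
  have hLL : L' = L := by
    by_contra hne
    rcases Nat.lt_or_gt_of_ne hne with hlt | hlt
    · have := key 0 L' 0 0 (by omega) (by omega) hpos hpos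
      obtain ⟨e1, e2, e3, e4⟩ := digits_of_three (s := s) (b := 0) (g := L') (i := 0) (j := 0)
        (by omega) hpos hpos
      rw [e1, e2, e3, e4] at this
      simp [hlt] at this
    · have := key 0 L 0 0 (by omega) (by omega) hpos hpos
      obtain ⟨e1, e2, e3, e4⟩ := digits_of_three (s := s) (b := 0) (g := L) (i := 0) (j := 0)
        (by omega) hpos hpos
      rw [e1, e2, e3, e4] at this
      simp at this
      omega
  have hMM : M' = M := by
    by_contra hne
    rcases Nat.lt_or_gt_of_ne hne with hlt | hlt
    · have := key 1 M' 0 0 (by omega) (by omega) hpos hpos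
      obtain ⟨e1, e2, e3, e4⟩ := digits_of_three (s := s) (b := 1) (g := M') (i := 0) (j := 0)
        (by omega) hpos hpos
      rw [e1, e2, e3, e4] at this
      simp [hlt] at this
    · have := key 1 M 0 0 (by omega) (by omega) hpos hpos
      obtain ⟨e1, e2, e3, e4⟩ := digits_of_three (s := s) (b := 1) (g := M) (i := 0) (j := 0)
        (by omega) hpos hpos
      rw [e1, e2, e3, e4] at this
      simp at this
      omega
  subst hLL hMM
  refine ⟨rfl, rfl, funext fun g => Equiv.ext fun i => ?_, funext fun g => Equiv.ext fun i => ?_⟩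
  · have := key 2 g i (S g i) (by omega) (by omega) (by omega) (by omega)
    obtain ⟨e1, e2, e3, e4⟩ := digits_of_three (s := s) (b := 2) (g := g) (i := i) (j := S g i)
      (by omega) (by omega) (by omega)
    rw [e1, e2, e3, e4] at this
    have h1 := this.mp (by simp)
    simp at h1
    exact h1.symm
  · have := key 3 g i (T g i) (by omega) (by omega) (by omega) (by omega)
    obtain ⟨e1, e2, e3, e4⟩ := digits_of_three (s := s) (b := 3) (g := g) (i := i) (j := T g i)
      (by omega) (by omega) (by omega)
    rw [e1, e2, e3, e4] at this
    have h1 := this.mp (by simp)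
    simp at h1
    exact h1.symm

theorem encodePermutations_mem_iff (hL : L ≤ 2 ^ s) (hM : M ≤ 2 ^ s)
    (hS : IsFittingFree (generated S)) (hT : IsFittingFree (generated T)) :
    encodePermutations s S T ∈ FittingFreeIsomorphism ↔
      Nonempty (generated S ≃* generated T) := by
  constructor
  · rintro ⟨s', L', M', S', T', hL', hM', he, -, -, hiso⟩
    obtain ⟨rfl, rfl, rfl, rfl⟩ := encodePermutations_inj hL hM hL' hM' he
    exact hiso
  · intro h
    exact ⟨s, L, M, S, T, hL, hM, rfl, hS, hT, h⟩

end Encoding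

/-! ## Recognizing relations between the digits of two numbers -/

theorem Regular.bitAt (f α β : ℕ) : Regular fun fs => bitAt fs f (α * scale fs + β) := by
  classical
  simpa using (Regular.bit f α β).map fun p => decide p

/-- The clock covers `scale` positions; the induction peels off one such piece and starts the
remaining range one slope further. The `c` leftover positions are treated individually. -/
theorem Regular.forall_chunk (φ : Bool → Bool → Prop) (a c f α β f' α' β' : ℕ) : Regular fun fs =>
    ∀ t < a * scale fs + c,
      φ (_root_.bitAt fs f (α * scale fs + β + t)) (_root_.bitAt fs f' (α' * scale fs + β' + t)) := by
  induction a generalizing α α' with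
  | zero =>
    have h := Regular.forall_lt c fun t =>
      (Regular.bitAt f α (β + t)).map₂ (Regular.bitAt f' α' (β' + t)) φ
    simpa [add_assoc] using h
  | succ a ih =>
    have h1 := Regular.all (ι := Bool) (fun i => cond i ⟨f, α, β⟩ ⟨f', α', β'⟩)
      (fun b c => b = true → φ ((c true).getD false) ((c false).getD false)) (by simp)
    have h1 : Regular fun fs => ∀ t < scale fs, φ (_root_.bitAt fs f (α * scale fs + β + t))
        (_root_.bitAt fs f' (α' * scale fs + β' + t)) := by
      simpa [BitStream.get, BitStream.start, _root_.bitAt] using h1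
    convert h1.and (ih (α + 1) (α' + 1)) using 2 with fs
    have h2 : ∀ x y t, (x + 1) * scale fs + y + t = x * scale fs + y + (scale fs + t) :=
      fun x y t => by ring
    simp only [h2]
    refine ⟨fun h => ⟨fun t ht => h t ?_, fun t ht => h (scale fs + t) ?_⟩, fun h t ht => ?_⟩
    · rw [add_mul]; omega
    · rw [add_mul]; omega
    · rcases lt_or_ge t (scale fs) with h3 | h3
      · exact h.1 t h3
      · obtain ⟨t, rfl⟩ := Nat.exists_eq_add_of_le h3
        exact h.2 t (by rw [add_mul] at ht; omega)

/-- Any string represents some number. This supplies the irrelevant number `j` when a property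
concerns only the second number. -/
theorem exists_represents (fs : ℕ → List Bool) (f : ℕ) : ∃ k, Represents fs f k := by
  refine ⟨Nat.ofBits fun i : Fin (fs f).length => bitAt fs f (4 + i), fun o => ?_⟩
  rcases lt_or_ge o (fs f).length with h | h
  · rw [Nat.testBit_ofBits_lt _ _ h]
  · rw [Nat.testBit_ofBits_ge _ _ h, bitAt, List.getElem?_eq_none (by omega)]
    rfl

/-- A function of the scale and of two numbers, given by the fields `1` and `2` behind prefixes of
four bits, is regular. -/
def DigitRegular {τ : Type} (F : ℕ → ℕ → ℕ → τ) : Prop :=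
  ∃ R, Regular R ∧ ∀ fs j k, Represents fs 1 j → Represents fs 2 k → R fs = F (scale fs) j k

namespace DigitRegular

variable {τ τ₁ τ₂ : Type}

theorem const (a : τ) : DigitRegular fun _ _ _ => a :=
  ⟨_, Regular.const a, fun _ _ _ _ _ => rfl⟩

theorem map {F : ℕ → ℕ → ℕ → τ₁} (hF : DigitRegular F) (g : τ₁ → τ) :
    DigitRegular fun s j k => g (F s j k) := by
  obtain ⟨R, hR, h⟩ := hF
  exact ⟨_, hR.map g, fun fs j k hj hk => congrArg g (h fs j k hj hk)⟩

theorem map₂ {F : ℕ → ℕ → ℕ → τ₁} {G : ℕ → ℕ → ℕ → τ₂} (hF : DigitRegular F)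
    (hG : DigitRegular G) (g : τ₁ → τ₂ → τ) : DigitRegular fun s j k => g (F s j k) (G s j k) := by
  obtain ⟨R, hR, h⟩ := hF
  obtain ⟨R', hR', h'⟩ := hG
  exact ⟨_, hR.map₂ hR' g, fun fs j k hj hk => congrArg₂ g (h fs j k hj hk) (h' fs j k hj hk)⟩

theorem and {P Q : ℕ → ℕ → ℕ → Prop} (hP : DigitRegular P) (hQ : DigitRegular Q) :
    DigitRegular fun s j k => P s j k ∧ Q s j k := hP.map₂ hQ And

theorem or {P Q : ℕ → ℕ → ℕ → Prop} (hP : DigitRegular P) (hQ : DigitRegular Q) :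
    DigitRegular fun s j k => P s j k ∨ Q s j k := hP.map₂ hQ Or

theorem ite {P : ℕ → ℕ → ℕ → Prop} [∀ s j k, Decidable (P s j k)] {F G : ℕ → ℕ → ℕ → τ}
    (hP : DigitRegular P) (hF : DigitRegular F) (hG : DigitRegular G) :
    DigitRegular fun s j k => if P s j k then F s j k else G s j k := by
  classical
  convert hP.map₂ (hF.map₂ hG Prod.mk) fun p a => if p then a.1 else a.2

theorem congr {F G : ℕ → ℕ → ℕ → τ} (hF : DigitRegular F) (h : ∀ s j k, F s j k = G s j k) :
    DigitRegular G := by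
  obtain rfl : F = G := funext fun s => funext fun j => funext fun k => h s j k
  exact hF

/-- The field of the first or of the second number. -/
def fieldOf (u : Bool) : ℕ := cond u 1 2

theorem bitAt_eq {fs : ℕ → List Bool} {j k : ℕ} (hj : Represents fs 1 j) (hk : Represents fs 2 k)
    (u : Bool) (o : ℕ) : bitAt fs (fieldOf u) (4 + o) = (cond u j k).testBit o := by
  cases u
  · exact hk o
  · exact hj o

theorem eq_chunk (a c : ℕ) (u : Bool) (α β : ℕ) (u' : Bool) (α' β' : ℕ) :
    DigitRegular fun s j k => cond u j k / 2 ^ (α * s + β) % 2 ^ (a * s + c) =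
      cond u' j k / 2 ^ (α' * s + β') % 2 ^ (a * s + c) := by
  refine ⟨_, Regular.forall_chunk (· = ·) a c (fieldOf u) α (4 + β) (fieldOf u') α' (4 + β'),
    fun fs j k hj hk => ?_⟩
  have h1 : ∀ x y t, x * scale fs + (4 + y) + t = 4 + (x * scale fs + y + t) := fun x y t => by ring
  simp only [h1, bitAt_eq hj hk]
  exact propext (testBit_chunk_eq_iff _ _ _ _ _)

theorem chunk_zero (a c : ℕ) (u : Bool) (α β : ℕ) :
    DigitRegular fun s j k => cond u j k / 2 ^ (α * s + β) % 2 ^ (a * s + c) = 0 := by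
  refine ⟨_, Regular.forall_chunk (fun x _ => x = false) a c (fieldOf u) α (4 + β) 0 0 0,
    fun fs j k hj hk => ?_⟩
  have h1 : ∀ x y t, x * scale fs + (4 + y) + t = 4 + (x * scale fs + y + t) := fun x y t => by ring
  simp only [h1, bitAt_eq hj hk]
  have := testBit_chunk_eq_iff (cond u j k) 0 (α * scale fs + β) 0 (a * scale fs + c)
  simp only [Nat.zero_testBit, Nat.zero_div, Nat.zero_mod] at this
  exact propext this

theorem le_chunk (u : Bool) (α β : ℕ) (u' : Bool) (α' β' : ℕ) :
    DigitRegular fun s j k => cond u j k / 2 ^ (α * s + β) % 2 ^ s ≤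
      cond u' j k / 2 ^ (α' * s + β') % 2 ^ s := by
  refine ⟨_, Regular.chunk_le (fieldOf u) α (4 + β) (fieldOf u') α' (4 + β'), fun fs j k hj hk => ?_⟩
  have h1 : ∀ x y t, x * scale fs + (4 + y) + t = 4 + (x * scale fs + y + t) := fun x y t => by ring
  simp only [h1, bitAt_eq hj hk]
  exact propext (leBits_testBit_iff _ _ _ _ _)

/-- A chunk of constant length has finitely many values, so it can be returned; longer chunks can
only be compared. -/
theorem chunk (c : ℕ) (u : Bool) (α β : ℕ) :
    DigitRegular fun s j k => cond u j k / 2 ^ (α * s + β) % 2 ^ c := by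
  refine ⟨_, (Regular.pi (ι := Fin c) fun i => Regular.bitAt (fieldOf u) α (4 + β + i)).map Nat.ofBits,
    fun fs j k hj hk => ?_⟩
  have h1 : ∀ x y t, x * scale fs + (4 + y + t) = 4 + (x * scale fs + y + t) := fun x y t => by ring
  simp only [h1, bitAt_eq hj hk]
  refine Nat.eq_of_testBit_eq fun o => ?_
  rw [Nat.testBit_mod_two_pow, Nat.testBit_div_two_pow]
  rcases lt_or_ge o c with h | h
  · rw [Nat.testBit_ofBits_lt _ _ h]; simp [h, add_comm]
  · rw [Nat.testBit_ofBits_ge _ _ h]; simp [h]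

/-- The recognition of a property of the second number. -/
theorem exists_regular {F : ℕ → ℕ → τ} (hF : DigitRegular fun s _ k => F s k) :
    ∃ R, Regular R ∧ ∀ fs k, Represents fs 2 k → R fs = F (scale fs) k := by
  obtain ⟨R, hR, h⟩ := hF
  refine ⟨R, hR, fun fs k hk => ?_⟩
  obtain ⟨j, hj⟩ := exists_represents fs 1
  exact h fs j k hj hk

end DigitRegular

/-! ## Guarded projections onto block permutations -/

open Classical in
/-- The bit selected between two constants `X` and `Y` by a slot. -/
noncomputable def Slot.select (X Y : Prop) (l : Slot) : Slot :=
  if X then if Y then .const true else l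
  else if Y then match l with
    | .const b => .const !b
    | .pos => .neg
    | .neg => .pos
  else .const false

/-- The value of a slot if the input bit is `a`. -/
def Slot.Holds (a : Bool) : Slot → Prop
  | .const b => b = true
  | .pos => a = true
  | .neg => a = false

open Classical in
theorem Slot.holds_select (X Y : Prop) (l : Slot) (a : Bool) :
    (l.select X Y).Holds a ↔ if l.Holds a then X else Y := by
  by_cases hX : X <;> by_cases hY : Y <;> cases l <;> simp [Slot.select, hX, hY, Slot.Holds]

/-- The data of a guarded projection from pairs of tables to the generators of two groups of codes
of length at most `2 ^ (slope * s + shift)`: the slot `lit s t v i` tells whether the generator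
number `v` of type `t` acts on the block `i`. -/
structure BlockScheme where
  par : ℕ
  par_pos : 1 ≤ par
  par_le : par ≤ 2
  slope : ℕ
  shift : ℕ
  imp : ℕ → ℕ → ℕ → Prop
  lit : ℕ → ℕ → ℕ → ℕ → Slot
  addr : ℕ → ℕ → ℕ → ℕ → ℕ → ℕ
  addr_lt : ∀ s b t v i, b < 4 → v < 2 ^ (slope * s + shift) → i < 2 ^ (slope * s + shift) →
    addr s b t v i < 2 ^ (2 * s + par)

namespace BlockScheme

noncomputable section

variable (B : BlockScheme)

/-- The logarithm of the maximal number of blocks. -/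
def logBlocks (s : ℕ) : ℕ := B.slope * s + B.shift

/-- The table containing an output position. -/
def table (s p : ℕ) : ℕ := p / 2 ^ (3 * B.logBlocks s + 9) % 2 ^ 2

/-- The type of the generator that an output position refers to. -/
def type (s p : ℕ) : ℕ := p / 2 ^ (3 * B.logBlocks s + 6) % 2 ^ 3

/-- The number of the generator within its type. -/
def word (s p : ℕ) : ℕ := p / 2 ^ (2 * B.logBlocks s + 6) % 2 ^ B.logBlocks s

/-- The position of the argument in its block. -/
def point (s p : ℕ) : ℕ := p / 2 ^ (2 * B.logBlocks s + 3) % 2 ^ 3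

/-- The block of the argument. -/
def block (s p : ℕ) : ℕ := p / 2 ^ (B.logBlocks s + 3) % 2 ^ B.logBlocks s

/-- The position of the value in its block. -/
def point' (s p : ℕ) : ℕ := p / 2 ^ B.logBlocks s % 2 ^ 3

/-- The block of the value. -/
def block' (s p : ℕ) : ℕ := p % 2 ^ B.logBlocks s

open Classical in
/-- The guarded projection of a block scheme. On invalid inputs its values encode generators of the
alternating group of degree five and of the trivial group. -/
def projection : GuardedProjection where
  par := B.par
  par_pos := B.par_pos
  par_le := B.par_le
  slope := 3 * B.slope
  shift := 3 * B.shift + 11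
  imp := B.imp
  slot s p :=
    if B.table s p < 2 then .const true
    else if B.block' s p = B.block s p then
      (B.lit s (B.type s p) (B.word s p) (B.block s p)).select
        (B.point' s p = genMove (B.type s p) (B.point s p)) (B.point' s p = B.point s p)
    else .const false
  addr s p := B.addr s (B.table s p) (B.type s p) (B.word s p) (B.block s p)
  dflt s p := B.table s p < 2 ∨ B.block' s p = B.block s p ∧ B.point' s p =
    if B.table s p = 2 ∧ (B.type s p = 1 ∨ B.type s p = 2) ∧ B.word s p = 0 ∧ B.block s p = 0 then
      genMove (B.type s p) (B.point s p) else B.point s p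
  addr_lt s p _ := B.addr_lt s _ _ _ _ (Nat.mod_lt _ (by positivity)) (Nat.mod_lt _ (by positivity))
    (Nat.mod_lt _ (by positivity))

/-- With `w = logBlocks s`, an output position consists of, from the top: the table (2 bits), the
type (3), the word (`w`), the point and the block of the argument (`3 + w`) and of the value (`3 +
w`). The total is `3 * w + 11`. -/
theorem width_projection (s : ℕ) :
    2 ^ B.projection.width s = 4 * 2 ^ (3 * (B.logBlocks s + 3)) := by
  rw [show (4 : ℕ) = 2 ^ 2 by norm_num, ← pow_add]
  congr 1
  change 3 * B.slope * s + (3 * B.shift + 11) = _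
  unfold logBlocks
  ring

/-- A digit in base `2 ^ (w + 3)` splits into `w` low bits, for the word or the block, and three
high bits, for the type or the point. -/
theorem digit_div (w k p : ℕ) :
    digit (w + 3) k p % 2 ^ w = p / 2 ^ ((w + 3) * k) % 2 ^ w ∧
    digit (w + 3) k p / 2 ^ w = p / 2 ^ ((w + 3) * k + w) % 2 ^ 3 := by
  unfold digit
  rw [pow_add 2 w 3, pow_add, ← Nat.div_div_eq_div_mul]
  exact ⟨Nat.mod_mul_right_mod _ _ _, Nat.mod_mul_right_div_self _ _ _⟩

open Classical in
-- Both the number of generators and the number of points are the full `2 ^ (w + 3)`, so the first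
-- two tables consist of ones.
theorem encodePermutations_blockPerms (s : ℕ) {m m' : ℕ} (hm : m ≤ 2 ^ B.logBlocks s)
    (hm' : m' ≤ 2 ^ B.logBlocks s) (R R' : ℕ → ℕ → Prop) :
    encodePermutations (B.logBlocks s + 3) (blockPerms (B.logBlocks s) m hm R)
        (blockPerms (B.logBlocks s) m' hm' R') =
      bitString (2 ^ B.projection.width s) fun p => B.table s p < 2 ∨
        B.block' s p = B.block s p ∧ B.point' s p =
          if (B.table s p = 2 ∧ B.block s p < m ∧ IsActive R (B.type s p) (B.word s p) (B.block s p)) ∨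
            (B.table s p = 3 ∧ B.block s p < m' ∧
              IsActive R' (B.type s p) (B.word s p) (B.block s p))
          then genMove (B.type s p) (B.point s p) else B.point s p := by
  rw [width_projection]
  refine bitString_inj.mpr ⟨rfl, fun p hp => ?_⟩
  have hb : p / 2 ^ (3 * (B.logBlocks s + 3)) = B.table s p := by
    rw [table, show 3 * B.logBlocks s + 9 = 3 * (B.logBlocks s + 3) by ring, Nat.mod_eq_of_lt]
    exact Nat.div_lt_of_lt_mul (by linarith)
  have hb4 : B.table s p < 4 := Nat.mod_lt _ (by positivity)
  have hlt : ∀ k, digit (B.logBlocks s + 3) k p < 2 ^ (B.logBlocks s + 3) := fun k => Nat.mod_lt _ (by positivity)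
  have hv : digit (B.logBlocks s + 3) 2 p % 2 ^ B.logBlocks s = B.word s p := by
    rw [(digit_div (B.logBlocks s) 2 p).1, word]; ring_nf
  have ht : digit (B.logBlocks s + 3) 2 p / 2 ^ B.logBlocks s = B.type s p := by
    rw [(digit_div (B.logBlocks s) 2 p).2, type]; ring_nf
  have hi : digit (B.logBlocks s + 3) 1 p % 2 ^ B.logBlocks s = B.block s p := by
    rw [(digit_div (B.logBlocks s) 1 p).1, block]; ring_nf
  have hk : digit (B.logBlocks s + 3) 1 p / 2 ^ B.logBlocks s = B.point s p := by
    rw [(digit_div (B.logBlocks s) 1 p).2, point]; ring_nf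
  have hi' : digit (B.logBlocks s + 3) 0 p % 2 ^ B.logBlocks s = B.block' s p := by
    rw [(digit_div (B.logBlocks s) 0 p).1, block']; simp
  have hk' : digit (B.logBlocks s + 3) 0 p / 2 ^ B.logBlocks s = B.point' s p := by
    rw [(digit_div (B.logBlocks s) 0 p).2, point']; simp
  simp only [hb, hlt, exists_true_left, blockPerms_apply_eq_iff, hv, ht, hi, hk, hi', hk', and_true]
  generalize B.table s p = b at *
  interval_cases b <;> simp

variable {B} {x : List Bool}

/-- On valid inputs, the projection writes generators of two groups of codes. -/
theorem eval_of_valid {s w : ℕ} (hs : GuardedProjection.param x.length = s)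
    (hw : B.logBlocks s = w) (hx : B.projection.Valid x) {m : ℕ} (hm : m ≤ 2 ^ w)
    (R : ℕ → ℕ → ℕ → Prop)
    (h : ∀ b t v i, b = 2 ∨ b = 3 → v < 2 ^ w → i < 2 ^ w →
      ((B.lit s t v i).Holds (x.getD (B.addr s b t v i) false) ↔ i < m ∧ IsActive (R b) t v i)) :
    B.projection.eval x =
      encodePermutations (w + 3) (blockPerms w m hm (R 2)) (blockPerms w m hm (R 3)) := by
  subst hs hw
  classical
  rw [encodePermutations_blockPerms, GuardedProjection.eval]
  refine bitString_inj.mpr ⟨rfl, fun p hp => ?_⟩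
  rw [if_pos hx]
  have hbit : B.projection.bit x p ↔ (B.projection.slot (GuardedProjection.param x.length) p).Holds
      (x.getD (B.projection.addr (GuardedProjection.param x.length) p) false) := by
    unfold GuardedProjection.bit
    split <;> rename_i h <;> rw [h] <;> rfl
  rw [hbit]
  set s := GuardedProjection.param x.length
  have hb4 : B.table s p < 4 := Nat.mod_lt _ (by positivity)
  have key := h (B.table s p) (B.type s p) (B.word s p) (B.block s p)
  simp only [projection]
  by_cases hb : B.table s p < 2
  · simp [hb, Slot.Holds]
  · have hb2 : B.table s p = 2 ∨ B.table s p = 3 := by omega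
    have key := key hb2 (Nat.mod_lt _ (by positivity)) (Nat.mod_lt _ (by positivity))
    by_cases hi : B.block' s p = B.block s p
    · rw [if_neg hb, if_pos hi, Slot.holds_select]
      simp only [key]
      rcases hb2 with hb2 | hb2 <;> simp only [hb2, hi] <;> norm_num <;> split_ifs <;> rfl
    · simp [hb, hi, Slot.Holds]

/-- On invalid inputs, the projection writes generators of two groups that are not isomorphic. -/
theorem eval_of_not_valid (hx : ¬ B.projection.Valid x) :
    B.projection.eval x = encodePermutations (B.logBlocks (GuardedProjection.param x.length) + 3)
      (blockPerms (B.logBlocks (GuardedProjection.param x.length)) 1 Nat.one_le_two_pow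
        fun _ _ => False)
      (blockPerms (B.logBlocks (GuardedProjection.param x.length)) 0 (Nat.zero_le _)
        fun _ _ => False) := by
  classical
  rw [encodePermutations_blockPerms, GuardedProjection.eval]
  refine bitString_inj.mpr ⟨rfl, fun p hp => ?_⟩
  rw [if_neg hx]
  set s := GuardedProjection.param x.length
  simp only [projection]
  have : ∀ t v i : ℕ, i < 1 ∧ IsActive (fun _ _ => False) t v i ↔
      (t = 1 ∨ t = 2) ∧ v = 0 ∧ i = 0 := by
    intro t v i
    simp only [IsActive, and_false, false_or]
    constructor
    · rintro ⟨h1, h2, h3⟩; exact ⟨h2, by omega, by omega⟩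
    · rintro ⟨h1, h2, h3⟩; exact ⟨by omega, h1, by omega⟩
  simp only [this, Nat.not_lt_zero, false_and, and_false, or_false]

variable (B)

theorem eval_mem_instance (hvalid : B.projection.Valid x → ∃ (r m : ℕ) (h : m ≤ 2 ^ r)
    (R R' : ℕ → ℕ → Prop), B.projection.eval x =
      encodePermutations (r + 3) (blockPerms r m h R) (blockPerms r m h R')) :
    B.projection.eval x ∈ FittingFreeInstance := by
  by_cases hx : B.projection.Valid x
  · obtain ⟨r, m, h, R, R', he⟩ := hvalid hx
    exact ⟨_, _, _, _, _, le_rfl, le_rfl, he, isFittingFree_generated h, isFittingFree_generated h⟩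
  · exact ⟨_, _, _, _, _, le_rfl, le_rfl, eval_of_not_valid hx, isFittingFree_generated _,
      isFittingFree_generated _⟩

theorem eval_not_mem (hx : ¬ B.projection.Valid x) :
    B.projection.eval x ∉ FittingFreeIsomorphism := by
  rw [eval_of_not_valid hx, encodePermutations_mem_iff le_rfl le_rfl (isFittingFree_generated _)
    (isFittingFree_generated _)]
  exact not_nonempty_generated_mulEquiv _ _

theorem eval_mem_iff {r m : ℕ} (h : m ≤ 2 ^ r) {R R' : ℕ → ℕ → Prop}
    (he : B.projection.eval x =
      encodePermutations (r + 3) (blockPerms r m h R) (blockPerms r m h R')) :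
    B.projection.eval x ∈ FittingFreeIsomorphism ↔
      CodeEquivalent (supportCode r m R) (supportCode r m R') := by
  rw [he, encodePermutations_mem_iff le_rfl le_rfl (isFittingFree_generated _)
    (isFittingFree_generated _), nonempty_generated_mulEquiv_iff]

theorem digitRegular_table : DigitRegular fun s _ p => B.table s p :=
  (DigitRegular.chunk 2 false (3 * B.slope) (3 * B.shift + 9)).congr fun s _ p => by
    simp only [table, logBlocks, cond_false]; ring_nf

theorem digitRegular_type : DigitRegular fun s _ p => B.type s p :=
  (DigitRegular.chunk 3 false (3 * B.slope) (3 * B.shift + 6)).congr fun s _ p => by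
    simp only [type, logBlocks, cond_false]; ring_nf

theorem digitRegular_point : DigitRegular fun s _ p => B.point s p :=
  (DigitRegular.chunk 3 false (2 * B.slope) (2 * B.shift + 3)).congr fun s _ p => by
    simp only [point, logBlocks, cond_false]; ring_nf

theorem digitRegular_point' : DigitRegular fun s _ p => B.point' s p :=
  (DigitRegular.chunk 3 false B.slope B.shift).congr fun s _ p => by
    simp only [point', logBlocks, cond_false]

theorem digitRegular_block_eq : DigitRegular fun s _ p => B.block' s p = B.block s p :=
  (DigitRegular.eq_chunk B.slope B.shift false 0 0 false B.slope (B.shift + 3)).congr fun s _ p => by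
    simp only [block', block, logBlocks, cond_false]; ring_nf; simp

theorem digitRegular_word_eq : DigitRegular fun s _ p => B.word s p = B.block s p :=
  (DigitRegular.eq_chunk B.slope B.shift false (2 * B.slope) (2 * B.shift + 6) false B.slope
    (B.shift + 3)).congr fun s _ p => by
    simp only [word, block, logBlocks, cond_false]; ring_nf

theorem digitRegular_word_zero : DigitRegular fun s _ p => B.word s p = 0 :=
  (DigitRegular.chunk_zero B.slope B.shift false (2 * B.slope) (2 * B.shift + 6)).congr
    fun s _ p => by simp only [word, logBlocks, cond_false]; ring_nf

theorem digitRegular_block_zero : DigitRegular fun s _ p => B.block s p = 0 :=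
  (DigitRegular.chunk_zero B.slope B.shift false B.slope (B.shift + 3)).congr
    fun s _ p => by simp only [block, logBlocks, cond_false]; ring_nf

/-- A projection of a block scheme is uniform if the data of the scheme can be recognized by
automata. -/
theorem uniformAC0
    (himp : DigitRegular fun s _ k => B.imp s (k % 2 ^ (2 * s + B.par))
      (k / 2 ^ (2 * s + B.par) % 2 ^ (2 * s + B.par)))
    (hlit : DigitRegular fun s _ p => B.lit s (B.type s p) (B.word s p) (B.block s p))
    (haddr : DigitRegular fun s j p => j % 2 ^ (2 * s + B.par) =
      B.addr s (B.table s p) (B.type s p) (B.word s p) (B.block s p)) :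
    UniformAC0 B.projection.eval := by
  classical
  refine GuardedProjection.Recognizable.uniformAC0 ⟨?_, ?_, ?_, ?_⟩
  · obtain ⟨R, hR, h⟩ := himp.exists_regular
    refine ⟨R, hR, fun fs k hk hlt => iff_of_eq ((h fs k hk).trans ?_)⟩
    have : k / 2 ^ (2 * scale fs + B.par) < 2 ^ (2 * scale fs + B.par) := by
      refine Nat.div_lt_of_lt_mul ?_
      rw [← pow_add]
      refine hlt.trans_eq ?_
      change 2 ^ (4 * scale fs + 2 * B.par) = _
      ring_nf
    rw [Nat.mod_eq_of_lt this]
    rfl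
  · have hsel := (((B.digitRegular_type.map₂ B.digitRegular_point
      fun t k => (t, k)).map₂ B.digitRegular_point' fun a k' => (a, k')).map₂ hlit
      fun a l => l.select (a.2 = genMove a.1.1 a.1.2) (a.2 = a.1.2))
    obtain ⟨R, hR, h⟩ := DigitRegular.exists_regular (F := B.projection.slot) <|
      (B.digitRegular_table.map (· < 2)).ite (.const (Slot.const true))
        (B.digitRegular_block_eq.ite hsel (.const (Slot.const false)))
    exact ⟨R, hR, fun fs k hk _ => h fs k hk⟩
  · obtain ⟨R, hR, h⟩ := haddr
    refine ⟨R, hR, fun fs j k hj hk hlt _ => iff_of_eq ((h fs j k hj hk).trans ?_)⟩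
    dsimp only
    rw [Nat.mod_eq_of_lt (show j < 2 ^ (2 * scale fs + B.par) from hlt)]
    rfl
  · have hact := ((B.digitRegular_table.map (· = 2)).and
      ((B.digitRegular_type.map fun t => t = 1 ∨ t = 2).and
        (B.digitRegular_word_zero.and B.digitRegular_block_zero)))
    have hval := hact.ite (B.digitRegular_type.map₂ B.digitRegular_point genMove)
      B.digitRegular_point
    obtain ⟨R, hR, h⟩ := DigitRegular.exists_regular (F := B.projection.dflt) <|
      (B.digitRegular_table.map (· < 2)).or
        (B.digitRegular_block_eq.and (B.digitRegular_point'.map₂ hval Eq))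
    exact ⟨R, hR, fun fs k hk _ => iff_of_eq (h fs k hk)⟩

end

end BlockScheme

/-! ## Tables of bits -/

/-- The position of the entry `(i, j)` of the table number `b`, for tables of size `2 ^ s`. -/
def cell (s b i j : ℕ) : ℕ := (b * 2 ^ s + i) * 2 ^ s + j

theorem cell_digits {s i j : ℕ} (b : ℕ) (hi : i < 2 ^ s) (hj : j < 2 ^ s) :
    cell s b i j / 2 ^ (2 * s) = b ∧ digit s 1 (cell s b i j) = i ∧ digit s 0 (cell s b i j) = j := by
  unfold digit cell
  rw [two_mul, pow_add, mul_one, mul_zero, pow_zero, Nat.div_one, ← Nat.div_div_eq_div_mul,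
    (digit_eq s j _ hj).1, (digit_eq s j _ hj).2, (digit_eq s i _ hi).1, (digit_eq s i _ hi).2]
  exact ⟨rfl, rfl, rfl⟩

theorem digit_lt (s k p : ℕ) : digit s k p < 2 ^ s := Nat.mod_lt _ (by positivity)

theorem cell_of_digits (s p : ℕ) : cell s (p / 2 ^ (2 * s)) (digit s 1 p) (digit s 0 p) = p := by
  unfold cell digit
  rw [two_mul, pow_add, mul_one, mul_zero, pow_zero, Nat.div_one, ← Nat.div_div_eq_div_mul]
  have h1 := Nat.div_add_mod (p / 2 ^ s) (2 ^ s)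
  have h2 := Nat.div_add_mod p (2 ^ s)
  rw [mul_comm (p / 2 ^ s / 2 ^ s), h1, mul_comm (p / 2 ^ s), h2]

theorem cell_lt {s b i j c : ℕ} (hb : b < c) (hi : i < 2 ^ s) (hj : j < 2 ^ s) :
    cell s b i j < c * 2 ^ (2 * s) := by
  have step : ∀ x y z : ℕ, x < y → z < 2 ^ s → x * 2 ^ s + z < y * 2 ^ s := fun x y z hx hz =>
    calc x * 2 ^ s + z < (x + 1) * 2 ^ s := by rw [add_mul]; omega
      _ ≤ y * 2 ^ s := Nat.mul_le_mul_right _ hx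
  rw [two_mul, pow_add, ← mul_assoc]
  exact step _ _ _ (step _ _ _ hb hi) hj

theorem mod_div_mod_two_pow (k n o l : ℕ) (h : o + l ≤ n) :
    k % 2 ^ n / 2 ^ o % 2 ^ l = k / 2 ^ o % 2 ^ l := by
  refine Nat.eq_of_testBit_eq fun t => ?_
  simp only [Nat.testBit_mod_two_pow, Nat.testBit_div_two_pow]
  by_cases ht : t < l
  · simp [ht, show t + o < n by omega]
  · simp [ht]

theorem mod_eq_cell_iff {s par b i j : ℕ} (p : ℕ) (hb : b < 2 ^ par) (hi : i < 2 ^ s) (hj : j < 2 ^ s) :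
    p % 2 ^ (2 * s + par) = cell s b i j ↔
      p / 2 ^ (2 * s) % 2 ^ par = b ∧ digit s 1 p = i ∧ digit s 0 p = j := by
  have h1 : p % 2 ^ (2 * s + par) / 2 ^ (2 * s) = p / 2 ^ (2 * s) % 2 ^ par := by
    rw [pow_add, Nat.mod_mul_right_div_self]
  have h2 : ∀ k < 2, digit s k (p % 2 ^ (2 * s + par)) = digit s k p := fun k hk =>
    mod_div_mod_two_pow _ _ _ _ (by nlinarith)
  obtain ⟨e1, e2, e3⟩ := cell_digits b hi hj
  constructor
  · intro h
    rw [← h1, ← h2 1 (by norm_num), ← h2 0 (by norm_num), h]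
    exact ⟨e1, e2, e3⟩
  · rintro ⟨rfl, rfl, rfl⟩
    rw [← h1, ← h2 1 (by norm_num), ← h2 0 (by norm_num), cell_of_digits]

/-- The entry `(i, j)` of the table number `b` in a string of tables of size `2 ^ s`. -/
def entry (x : List Bool) (s b i j : ℕ) : Prop := x.getD (cell s b i j) false = true

theorem eq_bitString {x : List Bool} {c s : ℕ} {P : ℕ → Prop} (hx : x.length = c * 2 ^ (2 * s))
    (h : ∀ b < c, ∀ i < 2 ^ s, ∀ j < 2 ^ s, entry x s b i j ↔ P (cell s b i j)) :
    x = bitString (c * 2 ^ (2 * s)) P := by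
  refine List.ext_getElem (by rw [hx, length_bitString]) fun p hp hp' => ?_
  have hb : p / 2 ^ (2 * s) < c := Nat.div_lt_of_lt_mul (by rw [mul_comm, ← hx]; exact hp)
  have key := h _ hb _ (digit_lt s 1 p) _ (digit_lt s 0 p)
  rw [entry, cell_of_digits, List.getD_eq_getElem _ _ hp] at key
  rw [Bool.eq_iff_iff, key, ← getD_bitString P (by simpa [bitString] using hp'),
    List.getD_eq_getElem _ _ hp']

theorem param_two_pow {s par : ℕ} (h1 : 1 ≤ par) (h2 : par ≤ 2) :
    GuardedProjection.param (2 ^ (2 * s + par)) = s := by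
  rw [GuardedProjection.param, Nat.size_pow]
  omega

/-- Recovers a dimension, or a number of vertices, from a table whose ones form an initial segment.
-/
theorem exists_threshold (n : ℕ) (P : ℕ → Prop) (hP : ∀ i < n, ∀ j ≤ i, P i → P j) :
    ∃ d ≤ n, ∀ i < n, P i ↔ i < d := by
  induction n with
  | zero => exact ⟨0, le_rfl, fun i hi => absurd hi (Nat.not_lt_zero i)⟩
  | succ n ih =>
    by_cases h : P n
    · exact ⟨n + 1, le_rfl, fun i hi => ⟨fun _ => hi, fun _ => hP n (by omega) i (by omega) h⟩⟩
    · obtain ⟨d, hd, hd'⟩ := ih fun i hi => hP i (by omega)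
      refine ⟨d, by omega, fun i hi => ?_⟩
      rcases Nat.lt_succ_iff_lt_or_eq.mp hi with h1 | rfl
      · exact hd' i h1
      · exact ⟨fun h2 => absurd h2 h, fun h2 => by omega⟩

theorem GuardedProjection.valid_iff (P : GuardedProjection) {x : List Bool} {s : ℕ}
    (hx : x.length = 2 ^ (2 * s + P.par)) : P.Valid x ↔
      ∀ b < 2 ^ P.par, ∀ i < 2 ^ s, ∀ j < 2 ^ s, ∀ b' < 2 ^ P.par, ∀ i' < 2 ^ s, ∀ j' < 2 ^ s,
        P.imp s (cell s b i j) (cell s b' i' j') → entry x s b i j → entry x s b' i' j' := by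
  have hs := param_two_pow (s := s) P.par_pos P.par_le
  have hcell : ∀ b < 2 ^ P.par, ∀ i < 2 ^ s, ∀ j < 2 ^ s, cell s b i j < x.length :=
    fun b hb i hi j hj => by
      rw [hx, pow_add, mul_comm]; exact cell_lt hb hi hj
  unfold Valid Good
  rw [show param x.length = s by rw [hx, hs]]
  constructor
  · intro h b hb i hi j hj b' hb' i' hi' j' hj'
    exact h.2 _ (hcell b hb i hi j hj) _ (hcell b' hb' i' hi' j' hj')
  · refine fun h => ⟨hx, fun a ha a' ha' => ?_⟩
    have hb : ∀ p < x.length, p / 2 ^ (2 * s) < 2 ^ P.par := fun p hp =>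
      Nat.div_lt_of_lt_mul (by rw [← pow_add, ← hx]; exact hp)
    have key := h _ (hb a ha) _ (digit_lt s 1 a) _ (digit_lt s 0 a) _ (hb a' ha') _
      (digit_lt s 1 a') _ (digit_lt s 0 a')
    simpa only [entry, cell_of_digits] using key

/-! ## The reduction from Linear Code Equivalence -/

section Matrices

/-- The implications that characterize the encodings of pairs of matrices: in the first two tables
the rows filled with ones are an initial segment, and these tables bound the row indices and the
column indices of the ones in the other two tables. -/
def matrixImp (s p q : ℕ) : Prop :=
  (p / 2 ^ (2 * s) < 2 ∧ q / 2 ^ (2 * s) = p / 2 ^ (2 * s) ∧ digit s 1 q ≤ digit s 1 p) ∨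
  (2 ≤ p / 2 ^ (2 * s) ∧ q / 2 ^ (2 * s) = 0 ∧ digit s 1 q = digit s 1 p) ∨
  (2 ≤ p / 2 ^ (2 * s) ∧ q / 2 ^ (2 * s) = 1 ∧ digit s 1 q = digit s 0 p)

/-- The block scheme for pairs of matrices. -/
def matrixScheme : BlockScheme where
  par := 2
  par_pos := by norm_num
  par_le := le_rfl
  slope := 1
  shift := 0
  imp := matrixImp
  lit _ t v i := if t = 0 ∨ (t = 1 ∨ t = 2) ∧ v = i then .pos else .const false
  addr s b t v i := cell s (if t = 0 then b else 1) v i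
  addr_lt s b t v i hb hv hi := by
    rw [pow_add, mul_comm]
    refine cell_lt ?_ (by simpa using hv) (by simpa using hi)
    split_ifs
    · exact hb
    · norm_num

/-- The support of the rows of a matrix. -/
def matrixSupport {d m : ℕ} (A : Matrix (Fin d) (Fin m) (ZMod 2)) (v i : ℕ) : Prop :=
  ∃ (hv : v < d) (hi : i < m), A ⟨v, hv⟩ ⟨i, hi⟩ = 1

/-- The `2 ^ w - d` additional words are zero and do not change the span. -/
theorem supportCode_matrixSupport {d m w : ℕ} (A : Matrix (Fin d) (Fin m) (ZMod 2)) (hd : d ≤ 2 ^ w) :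
    supportCode w m (matrixSupport A) = rowCode A := by
  classical
  have h2 : ∀ a : ZMod 2, (if a = 1 then 1 else 0) = a := by decide
  apply le_antisymm <;> rw [supportCode, rowCode, Submodule.span_le]
  · rintro _ ⟨v, rfl⟩
    by_cases hv : (v : ℕ) < d
    · refine Submodule.subset_span ⟨⟨v, hv⟩, funext fun i => ?_⟩
      simp only [matrixSupport, hv, i.2, exists_true_left, Fin.eta]
      exact (h2 _).symm
    · rw [show (fun (v : Fin (2 ^ w)) (i : Fin m) => if matrixSupport A v i then (1 : ZMod 2) else 0) v
        = 0 from funext fun i => by simp [matrixSupport, hv]]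
      exact Submodule.zero_mem _
  · rintro _ ⟨v, rfl⟩
    refine Submodule.subset_span ⟨⟨v, v.2.trans_le hd⟩, funext fun i => ?_⟩
    simp only [matrixSupport, v.2, i.2, exists_true_left, Fin.eta]
    exact h2 _

theorem entry_encodeMatrices {s d m : ℕ} (A B : Matrix (Fin d) (Fin m) (ZMod 2)) {b i j : ℕ}
    (hb : b < 4) (hi : i < 2 ^ s) (hj : j < 2 ^ s) : entry (encodeMatrices s A B) s b i j ↔
      (b = 0 ∧ i < d) ∨ (b = 1 ∧ i < m) ∨ (b = 2 ∧ matrixSupport A i j) ∨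
        (b = 3 ∧ matrixSupport B i j) := by
  rw [entry, encodeMatrices, getD_bitString _ (cell_lt hb hi hj)]
  obtain ⟨e1, e2, e3⟩ := cell_digits b hi hj
  simp only [e1, e2, e3, matrixSupport]

theorem length_encodeMatrices {s d m : ℕ} (A B : Matrix (Fin d) (Fin m) (ZMod 2)) :
    (encodeMatrices s A B).length = 2 ^ (2 * s + 2) := by
  rw [encodeMatrices, length_bitString, pow_add]
  ring

theorem matrixScheme_valid_iff {x : List Bool} {s : ℕ} (hx : x.length = 2 ^ (2 * s + 2)) :
    matrixScheme.projection.Valid x ↔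
      ∀ b < 4, ∀ i < 2 ^ s, ∀ j < 2 ^ s, ∀ b' < 4, ∀ i' < 2 ^ s, ∀ j' < 2 ^ s,
        (b < 2 ∧ b' = b ∧ i' ≤ i ∨ 2 ≤ b ∧ b' = 0 ∧ i' = i ∨ 2 ≤ b ∧ b' = 1 ∧ i' = j) →
          entry x s b i j → entry x s b' i' j' := by
  rw [matrixScheme.projection.valid_iff hx]
  refine forall₃_congr fun b hb i => forall₃_congr fun hi j hj => forall₃_congr fun b' hb' i' =>
    forall₃_congr fun hi' j' hj' => ?_
  obtain ⟨e1, e2, e3⟩ := cell_digits b hi hj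
  obtain ⟨f1, f2, f3⟩ := cell_digits b' hi' hj'
  change (matrixImp _ _ _ → _) ↔ _
  simp only [matrixImp, e1, e2, e3, f1, f2]

theorem valid_encodeMatrices {s d m : ℕ} (A B : Matrix (Fin d) (Fin m) (ZMod 2)) :
    matrixScheme.projection.Valid (encodeMatrices s A B) := by
  rw [matrixScheme_valid_iff (length_encodeMatrices A B)]
  intro b hb i hi j hj b' hb' i' hi' j' hj' h
  rw [entry_encodeMatrices A B hb hi hj, entry_encodeMatrices A B hb' hi' hj']
  rintro (h1 | h1 | ⟨h1, h2, h3, -⟩ | ⟨h1, h2, h3, -⟩) <;> omega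

/-- Converse of `valid_encodeMatrices`: `d` and `m` are read off from the first columns of the
tables `0` and `1`, whose rows are constant, and the implications confine the ones of the other
tables to the first `d` rows and `m` columns. Hence valid inputs are exactly the encodings. -/
theorem exists_encodeMatrices {x : List Bool} (hx : matrixScheme.projection.Valid x) :
    ∃ (s d m : ℕ) (A B : Matrix (Fin d) (Fin m) (ZMod 2)), d ≤ 2 ^ s ∧ m ≤ 2 ^ s ∧
      x = encodeMatrices s A B := by
  classical
  set s := GuardedProjection.param x.length
  have hlen : x.length = 2 ^ (2 * s + 2) := hx.1
  rw [matrixScheme_valid_iff hlen] at hx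
  have h0 : 0 < 2 ^ s := by positivity
  obtain ⟨d, hd, hd'⟩ := exists_threshold (2 ^ s) (fun i => entry x s 0 i 0) fun i hi j hj =>
    hx 0 (by omega) i hi 0 h0 0 (by omega) j (by omega) 0 h0 (by omega)
  obtain ⟨m, hm, hm'⟩ := exists_threshold (2 ^ s) (fun i => entry x s 1 i 0) fun i hi j hj =>
    hx 1 (by omega) i hi 0 h0 1 (by omega) j (by omega) 0 h0 (by omega)
  refine ⟨s, d, m, fun i j => if entry x s 2 i j then 1 else 0,
    fun i j => if entry x s 3 i j then 1 else 0, hd, hm, ?_⟩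
  refine eq_bitString (by rw [hlen, pow_add, mul_comm]; rfl) fun b hb i hi j hj => ?_
  obtain ⟨e1, e2, e3⟩ := cell_digits b hi hj
  simp only [e1, e2, e3]
  have hbound : ∀ b, b = 2 ∨ b = 3 → (entry x s b i j ↔ ∃ (_ : i < d) (_ : j < m), entry x s b i j) := by
    intro b hb
    refine ⟨fun h => ⟨(hd' i hi).mp ?_, (hm' j hj).mp ?_, h⟩, fun ⟨_, _, h⟩ => h⟩
    · exact hx b (by omega) i hi j hj 0 (by omega) i hi 0 h0 (by omega) h
    · exact hx b (by omega) i hi j hj 1 (by omega) j hj 0 h0 (by omega) h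
  interval_cases b
  · have := hx 0 (by omega) i hi j hj 0 (by omega) i hi 0 h0 (by omega)
    have h' := hx 0 (by omega) i hi 0 h0 0 (by omega) i hi j hj (by omega)
    simpa using (show entry x s 0 i j ↔ entry x s 0 i 0 from ⟨this, h'⟩).trans (hd' i hi)
  · have := hx 1 (by omega) i hi j hj 1 (by omega) i hi 0 h0 (by omega)
    have h' := hx 1 (by omega) i hi 0 h0 1 (by omega) i hi j hj (by omega)
    simpa using (show entry x s 1 i j ↔ entry x s 1 i 0 from ⟨this, h'⟩).trans (hm' i hi)
  · simpa using hbound 2 (Or.inl rfl)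
  · simpa using hbound 3 (Or.inr rfl)

theorem eval_encodeMatrices {s d m : ℕ} (A B : Matrix (Fin d) (Fin m) (ZMod 2)) (hm : m ≤ 2 ^ s) :
    matrixScheme.projection.eval (encodeMatrices s A B) = encodePermutations (s + 3)
      (blockPerms s m hm (matrixSupport A)) (blockPerms s m hm (matrixSupport B)) := by
  have hs : GuardedProjection.param (encodeMatrices s A B).length = s := by
    rw [length_encodeMatrices, param_two_pow (by norm_num) le_rfl]
  refine BlockScheme.eval_of_valid hs (by simp [BlockScheme.logBlocks, matrixScheme])
    (valid_encodeMatrices (s := s) A B) hm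
    (fun b => if b = 2 then matrixSupport A else matrixSupport B) ?_
  · intro b t v i hb hv hi
    change (Slot.Holds _ (if _ then _ else _)) ↔ _
    have hR : ∀ (C : Matrix (Fin d) (Fin m) (ZMod 2)), matrixSupport C v i → i < m :=
      fun C h => h.2.1
    have hentry : ∀ b < 4, (encodeMatrices s A B).getD (cell s b v i) false = true ↔ _ :=
      fun b hb => entry_encodeMatrices A B hb hv hi
    by_cases ht : t = 0
    · simp only [ht, true_or, if_true, Slot.Holds]
      change (List.getD _ (cell s (if 0 = 0 then b else 1) v i) _ = _) ↔ _
      rw [if_pos rfl, hentry b (by omega)]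
      rcases hb with rfl | rfl <;> simp [IsActive] <;> exact hR _
    · by_cases h : (t = 1 ∨ t = 2) ∧ v = i
      · obtain ⟨h, rfl⟩ := h
        simp only [h, and_self, or_true, if_true, Slot.Holds]
        change (List.getD _ (cell s (if t = 0 then b else 1) v v) _ = _) ↔ _
        -- Row `v` of table `1` is filled with ones exactly if `v < m`, so its cell `(v, v)` tells
        -- whether block `v` exists.
        rw [if_neg ht, hentry 1 (by omega)]
        simp [IsActive, ht, h]
      · simp [ht, h, Slot.Holds, IsActive]

theorem uniformAC0_matrixScheme : UniformAC0 matrixScheme.projection.eval := by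
  have hw : ∀ s, matrixScheme.logBlocks s = s := fun s => by
    simp [BlockScheme.logBlocks, matrixScheme]
  refine matrixScheme.uniformAC0 ?_ ?_ ?_
  -- The pair `(p, q)` occupies one number, with `p` in the low `2 * s + 2` bits. So the column, row
  -- and table of `p` start at `0`, `s`, `2 * s`, and those of `q` at `2 * s + 2`, `3 * s + 2`, `4 *
  -- s + 2`.
  · have htab := DigitRegular.chunk 2 false 2 0
    have htab' := DigitRegular.chunk 2 false 4 2
    have hle := DigitRegular.le_chunk false 3 2 false 1 0
    have heq := DigitRegular.eq_chunk 1 0 false 3 2 false 1 0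
    have heq' := DigitRegular.eq_chunk 1 0 false 3 2 false 0 0
    have h2 := htab.map (2 ≤ ·)
    refine (((htab.map (· < 2)).and ((htab'.map₂ htab (· = ·)).and hle)).or
      ((h2.and ((htab'.map (· = 0)).and heq)).or
        (h2.and ((htab'.map (· = 1)).and heq')))).congr fun s _ k => ?_
    change _ = matrixImp s (k % 2 ^ (2 * s + 2)) (k / 2 ^ (2 * s + 2) % 2 ^ (2 * s + 2))
    have e1 : ∀ k, k % 2 ^ (2 * s + 2) / 2 ^ (2 * s) = k / 2 ^ (2 * s) % 2 ^ 2 := fun k => by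
      rw [pow_add, Nat.mod_mul_right_div_self]
    have e2 : ∀ k, ∀ l < 2, digit s l (k % 2 ^ (2 * s + 2)) = k / 2 ^ (l * s) % 2 ^ s :=
      fun k l hl => by
        rw [mul_comm l]; exact mod_div_mod_two_pow _ _ _ _ (by nlinarith)
    simp only [matrixImp, e1, e2 _ 1 (by norm_num), e2 _ 0 (by norm_num),
      Nat.div_div_eq_div_mul, ← pow_add, cond_false]
    ring_nf
  · refine DigitRegular.ite (((matrixScheme.digitRegular_type.map (· = 0)).or
      ((matrixScheme.digitRegular_type.map fun t => t = 1 ∨ t = 2).and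
        matrixScheme.digitRegular_word_eq))) (.const Slot.pos) (.const (Slot.const false))
  · have htab := (DigitRegular.chunk 2 true 2 0).map₂
      (matrixScheme.digitRegular_type.map₂ matrixScheme.digitRegular_table
        fun t b => if t = 0 then b else 1) (· = ·)
    -- Here `logBlocks s = s`, so in an output position the block starts at `s + 3` and the word at
    -- `2 * s + 6`.
    have hword := DigitRegular.eq_chunk 1 0 true 1 0 false 2 6
    have hblock := DigitRegular.eq_chunk 1 0 true 0 0 false 1 3
    refine (htab.and (hword.and hblock)).congr fun s j p => ?_
    change _ = (j % 2 ^ (2 * s + 2) = cell s (if _ = 0 then _ else 1) _ _)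
    rw [mod_eq_cell_iff]
    · simp only [BlockScheme.word, BlockScheme.block, hw, cond_true, cond_false, digit]
      ring_nf
    · split_ifs
      · exact Nat.mod_lt _ (by positivity)
      · norm_num
    · exact (Nat.mod_lt _ (by positivity)).trans_eq (by rw [hw])
    · exact (Nat.mod_lt _ (by positivity)).trans_eq (by rw [hw])

end Matrices

/-! ## Codes of graphs -/

section GraphCodes

variable {N : ℕ} {U : Type} (θ : Fin N ≃ Fin 8 × U × U) (E E' : U → U → Prop)

open Classical in
/-- The codeword of a vertex. The coordinates `(0, e, c)` with `E e c` record the incidences of the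
vertices with the edges, and the coordinates `(k, u, c)` with `k ≠ 0` all belong to the vertex `u`. -/
noncomputable def graphWord (u : U) : Fin N → ZMod 2 := fun i =>
  if (u = (θ i).2.1 ∨ (θ i).1 = 0 ∧ u = (θ i).2.2) ∧
    E (θ i).2.1 (if (θ i).1 = 0 then (θ i).2.2 else (θ i).2.1) then 1 else 0

/-- The code spanned by the codewords of the vertices. -/
noncomputable def graphCode : Submodule (ZMod 2) (Fin N → ZMod 2) :=
  Submodule.span (ZMod 2) (Set.range (graphWord θ E))

theorem graphWord_ne_zero_iff (u : U) (i : Fin N) : graphWord θ E u i ≠ 0 ↔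
    (u = (θ i).2.1 ∨ (θ i).1 = 0 ∧ u = (θ i).2.2) ∧
      E (θ i).2.1 (if (θ i).1 = 0 then (θ i).2.2 else (θ i).2.1) := by
  classical
  unfold graphWord
  split_ifs with h <;> simp_all

theorem zmod_two_eq_of_ne_zero_iff {a b : ZMod 2} (h : a ≠ 0 ↔ b ≠ 0) : a = b := by
  revert a b; decide

variable {θ E E'}

theorem graphWord_symm_ne_zero_iff (u v : U) {k : Fin 8} (hk : k ≠ 0) (x : U) :
    graphWord θ E v (θ.symm (k, u, x)) ≠ 0 ↔ v = u ∧ E u u := by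
  rw [graphWord_ne_zero_iff]
  simp [hk]

/-- In the copies `k ≠ 0` only the word of `u` can be nonzero at a coordinate `(k, u, x)`, and it
has the same value at all of them. By linearity every codeword is constant there, and `(1, u, u)`
serves as the representative. -/
theorem graphCode_apply {c : Fin N → ZMod 2} (hc : c ∈ graphCode θ E) {k : Fin 8} (hk : k ≠ 0)
    (u x : U) : c (θ.symm (k, u, x)) = c (θ.symm (1, u, u)) := by
  induction hc using Submodule.span_induction with
  | mem c hc =>
    obtain ⟨v, rfl⟩ := hc
    exact zmod_two_eq_of_ne_zero_iff (by
      rw [graphWord_symm_ne_zero_iff _ _ hk, graphWord_symm_ne_zero_iff _ _ (by decide)])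
  | zero => rfl
  | add a b _ _ ha hb => rw [Pi.add_apply, Pi.add_apply, ha, hb]
  | smul r a _ ha => rw [Pi.smul_apply, Pi.smul_apply, ha]

theorem graphWord_eq_zero (hsymm : ∀ a b, E a b → E b a) (hrefl : ∀ a b, E a b → E a a) {u : U}
    (hu : ¬ E u u) : graphWord θ E u = 0 := by
  funext i
  by_contra h
  obtain ⟨h1, h2⟩ := (graphWord_ne_zero_iff θ E u i).mp h
  rcases h1 with h1 | ⟨h0, h1⟩
  · exact hu (by rw [h1]; exact hrefl _ _ h2)
  · rw [if_pos h0, ← h1] at h2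
    exact hu (hrefl _ _ (hsymm _ _ h2))

/-- The entry at `(1, u, u)` is the coefficient of the word of `u`. Padding vertices, for which `E u
u` fails, have zero words and contribute nothing. -/
theorem eq_sum_graphWord [Fintype U] (hsymm : ∀ a b, E a b → E b a)
    (hrefl : ∀ a b, E a b → E a a) {c : Fin N → ZMod 2} (hc : c ∈ graphCode θ E) :
    c = ∑ u, c (θ.symm (1, u, u)) • graphWord θ E u := by
  induction hc using Submodule.span_induction with
  | mem c hc =>
    obtain ⟨v, rfl⟩ := hc
    rw [Finset.sum_eq_single v]
    · by_cases hv : E v v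
      · have := (graphWord_symm_ne_zero_iff (θ := θ) v v (show (1 : Fin 8) ≠ 0 by decide) v).mpr
          ⟨rfl, hv⟩
        rw [(by decide : ∀ a : ZMod 2, a ≠ 0 → a = 1) _ this, one_smul]
      · simp [graphWord_eq_zero hsymm hrefl hv]
    · intro u _ huv
      have := (graphWord_symm_ne_zero_iff (θ := θ) (E := E) u v (show (1 : Fin 8) ≠ 0 by decide) u).not.mpr
        fun h => huv h.1.symm
      rw [not_not.mp this, zero_smul]
    · simp
  | zero => simp
  | add a b _ _ ha hb =>
    conv_lhs => rw [ha, hb]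
    simp [add_smul, Finset.sum_add_distrib]
  | smul r a _ ha =>
    conv_lhs => rw [ha]
    simp [Finset.smul_sum, mul_smul]

theorem card_ne_zero_comp {α β : Type} [Fintype α] [Fintype β] (e : α ≃ β) (c : β → ZMod 2) :
    (Finset.univ.filter fun a => c (e a) ≠ 0).card = (Finset.univ.filter fun b => c b ≠ 0).card :=
  Finset.card_bijective e e.bijective (by simp)

/-- The support lies in the coordinates `(k, u, c)`, of which there are `8 * card U`, and `(0, e,
u)`, of which there are `card U`. -/
theorem card_graphWord_le [Fintype U] (u : U) :
    (Finset.univ.filter fun i => graphWord θ E u i ≠ 0).card ≤ 9 * Fintype.card U := by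
  classical
  rw [← card_ne_zero_comp θ.symm]
  calc _ ≤ ((Finset.univ.image fun a : Fin 8 × U => (a.1, u, a.2)) ∪
        Finset.univ.image fun e : U => ((0 : Fin 8), e, u)).card := by
        refine Finset.card_le_card fun ⟨k, e, c⟩ h => ?_
        have h := ((graphWord_ne_zero_iff θ E u _).mp (Finset.mem_filter.mp h).2).1
        rw [Equiv.apply_symm_apply] at h
        rcases h with rfl | ⟨rfl, rfl⟩ <;> simp
    _ ≤ 8 * Fintype.card U + Fintype.card U := by
        refine (Finset.card_union_le _ _).trans (Nat.add_le_add (Finset.card_image_le.trans ?_)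
          (Finset.card_image_le.trans le_rfl))
        simp
    _ = 9 * Fintype.card U := by ring

/-- Each of two vertices with nonzero coefficient contributes all its `7 * card U` private
coordinates, and no cancellation can occur there. -/
theorem le_card_of_mem_graphCode [Fintype U] {c : Fin N → ZMod 2} (hc : c ∈ graphCode θ E) {u v : U}
    (huv : u ≠ v) (hu : c (θ.symm (1, u, u)) ≠ 0) (hv : c (θ.symm (1, v, v)) ≠ 0) :
    14 * Fintype.card U ≤ (Finset.univ.filter fun i => c i ≠ 0).card := by
  classical
  rw [← card_ne_zero_comp θ.symm]
  have hinj : Function.Injective fun a : Fin 7 × Bool × U =>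
      (a.1.succ, if a.2.1 then u else v, a.2.2) := by
    rintro ⟨k, b, x⟩ ⟨k', b', x'⟩ h
    simp only [Prod.mk.injEq, Fin.succ_inj] at h
    obtain ⟨rfl, h, rfl⟩ := h
    cases b <;> cases b' <;> simp_all
  calc 14 * Fintype.card U = (Finset.univ.image fun a : Fin 7 × Bool × U =>
        (a.1.succ, if a.2.1 then u else v, a.2.2)).card := by
        rw [Finset.card_image_of_injective _ hinj, Finset.card_univ]
        simp [← mul_assoc]
    _ ≤ _ := by
        refine Finset.card_le_card fun y h => ?_
        obtain ⟨⟨k, b, x⟩, -, rfl⟩ := Finset.mem_image.mp h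
        rw [Finset.mem_filter, graphCode_apply hc (Fin.succ_ne_zero k)]
        cases b <;> simpa

/-- The codewords of the vertices are the only nonzero words of small weight. -/
theorem exists_eq_graphWord [Fintype U] [Nonempty U] (hsymm : ∀ a b, E a b → E b a)
    (hrefl : ∀ a b, E a b → E a a) {c : Fin N → ZMod 2} (hc : c ∈ graphCode θ E) (h0 : c ≠ 0)
    (hle : (Finset.univ.filter fun i => c i ≠ 0).card ≤ 9 * Fintype.card U) :
    ∃ u, E u u ∧ c = graphWord θ E u := by
  have hsum := eq_sum_graphWord hsymm hrefl hc
  obtain ⟨u, hu⟩ : ∃ u, c (θ.symm (1, u, u)) ≠ 0 := by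
    by_contra! h
    exact h0 (by rw [hsum]; simp [h])
  have hc' : c = graphWord θ E u := by
    rw [hsum, Finset.sum_eq_single u]
    · rw [(by decide : ∀ a : ZMod 2, a ≠ 0 → a = 1) _ hu, one_smul]
    · intro v _ hvu
      by_contra hv
      -- A second vertex would force weight at least `14 * card U`, which exceeds `9 * card U`
      -- because `U` is nonempty.
      have := le_card_of_mem_graphCode hc hvu (fun h => hv (by rw [h, zero_smul])) hu
      have := Fintype.card_pos (α := U)
      omega
    · simp
  refine ⟨u, ?_, hc'⟩
  rw [hc'] at hu
  exact ((graphWord_symm_ne_zero_iff _ _ (by decide) _).mp hu).2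

theorem graphWord_injective {u v : U} (hu : E u u) (h : graphWord θ E u = graphWord θ E v) :
    u = v := by
  have := (graphWord_symm_ne_zero_iff (θ := θ) u u (show (1 : Fin 8) ≠ 0 by decide) u).mpr ⟨rfl, hu⟩
  rw [h, graphWord_symm_ne_zero_iff _ _ (by decide)] at this
  exact this.1.symm

theorem graphWord_ne_zero {u : U} (hu : E u u) : graphWord θ E u ≠ 0 := fun h =>
  (graphWord_symm_ne_zero_iff (θ := θ) u u (show (1 : Fin 8) ≠ 0 by decide) u).mpr ⟨rfl, hu⟩
    (by rw [h]; rfl)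

/-- Adjacency of distinct vertices can be read off from the supports of their codewords. -/
theorem adj_iff_exists (hsymm : ∀ a b, E a b → E b a) {u v : U} (huv : u ≠ v) :
    E u v ↔ ∃ i, graphWord θ E u i ≠ 0 ∧ graphWord θ E v i ≠ 0 := by
  simp only [graphWord_ne_zero_iff]
  constructor
  · intro h
    exact ⟨θ.symm (0, u, v), by simpa using h⟩
  · rintro ⟨i, ⟨h1, h2⟩, ⟨h3, -⟩⟩
    rcases h1 with h1 | ⟨h0, h1⟩
    · rcases h3 with h3 | ⟨h0, h3⟩
      · exact absurd (h1.trans h3.symm) huv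
      · rw [if_pos h0, ← h1, ← h3] at h2
        exact h2
    · rcases h3 with h3 | ⟨-, h3⟩
      · rw [if_pos h0, ← h1, ← h3] at h2
        exact hsymm _ _ h2
      · exact absurd (h1.trans h3.symm) huv

/-- Permuting coordinates preserves weights, so the low-weight words, which are those of the
vertices, are mapped to each other; it also preserves whether two supports meet, which is adjacency.
-/
theorem exists_map_of_codeEquivalent [Fintype U] [Nonempty U] (hsymm : ∀ a b, E a b → E b a)
    (hsymm' : ∀ a b, E' a b → E' b a) (hrefl' : ∀ a b, E' a b → E' a a)
    (h : CodeEquivalent (graphCode θ E) (graphCode θ E')) :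
    ∃ φ : {u // E u u} → {u // E' u u}, Function.Injective φ ∧
      ∀ u v : {u // E u u}, u ≠ v → (E u v ↔ E' (φ u) (φ v)) := by
  obtain ⟨σ, hσ⟩ := h
  have hex : ∀ u : {u // E u u}, ∃ u' : {u // E' u u},
      graphWord θ E u ∘ σ = graphWord θ E' u' := by
    intro u
    have hmem : graphWord θ E u ∘ σ ∈ graphCode θ E' := by
      rw [← hσ]
      exact ⟨_, Submodule.subset_span ⟨u.1, rfl⟩, rfl⟩
    have hne : graphWord θ E u ∘ σ ≠ 0 := fun h0 => graphWord_ne_zero (θ := θ) u.2 (by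
      funext i
      simpa using congrFun h0 (σ.symm i))
    obtain ⟨u', h1, h2⟩ := exists_eq_graphWord hsymm' hrefl' hmem hne
      ((card_ne_zero_comp σ _).trans_le (card_graphWord_le u.1))
    exact ⟨⟨u', h1⟩, h2⟩
  choose φ hφ using hex
  have hinj : Function.Injective φ := fun u v huv => by
    have h1 : graphWord θ E u ∘ σ = graphWord θ E v ∘ σ := by rw [hφ, hφ, huv]
    exact Subtype.ext (graphWord_injective u.2 (σ.surjective.injective_comp_right h1))
  refine ⟨φ, hinj, fun u v huv => ?_⟩
  rw [adj_iff_exists (θ := θ) hsymm fun h => huv (Subtype.ext h),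
    adj_iff_exists (θ := θ) hsymm' fun h => huv (hinj (Subtype.ext h)), ← hφ, ← hφ]
  exact (σ.surjective.exists (p := fun i => graphWord θ E u i ≠ 0 ∧ graphWord θ E v i ≠ 0))

theorem codeEquivalent_of_perm (π : Equiv.Perm U) (hπ : ∀ a b, E' (π a) (π b) ↔ E a b) :
    CodeEquivalent (graphCode θ E) (graphCode θ E') := by
  -- The inverse of `π` is used since `LinearMap.funLeft` precomposes with the permutation of the
  -- coordinates.
  let τ : Equiv.Perm (Fin 8 × U × U) := (Equiv.refl _).prodCongr (π.symm.prodCongr π.symm)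
  refine ⟨(θ.trans τ).trans θ.symm, ?_⟩
  have key : ∀ u, LinearMap.funLeft (ZMod 2) (ZMod 2) ((θ.trans τ).trans θ.symm) (graphWord θ E u) =
      graphWord θ E' (π u) := by
    intro u
    funext i
    refine zmod_two_eq_of_ne_zero_iff ?_
    rw [LinearMap.funLeft_apply, graphWord_ne_zero_iff, graphWord_ne_zero_iff]
    obtain ⟨⟨k, e, c⟩, rfl⟩ := θ.symm.surjective i
    obtain ⟨e, rfl⟩ := π.surjective e
    obtain ⟨c, rfl⟩ := π.surjective c
    by_cases hk : k = 0 <;> simp [τ, hk, hπ]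
  rw [graphCode, graphCode, Submodule.map_span, ← Set.range_comp]
  congr 1
  have : (LinearMap.funLeft (ZMod 2) (ZMod 2) ((θ.trans τ).trans θ.symm)) ∘ graphWord θ E =
      graphWord θ E' ∘ π := funext key
  rw [this, π.surjective.range_comp]

end GraphCodes

/-! ## The reduction from Graph Isomorphism -/

section Graphs

/-- The adjacency relation of a graph, made reflexive and extended to all numbers. -/
def graphRel {n : ℕ} (G : SimpleGraph (Fin n)) (a b : ℕ) : Prop :=
  a = b ∧ a < n ∨ ∃ (ha : a < n) (hb : b < n), G.Adj ⟨a, ha⟩ ⟨b, hb⟩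

theorem graphRel_symm {n : ℕ} (G : SimpleGraph (Fin n)) {a b : ℕ} (h : graphRel G a b) :
    graphRel G b a := by
  rcases h with ⟨rfl, h⟩ | ⟨ha, hb, h⟩
  · exact Or.inl ⟨rfl, h⟩
  · exact Or.inr ⟨hb, ha, h.symm⟩

theorem graphRel_self {n : ℕ} (G : SimpleGraph (Fin n)) (a : ℕ) : graphRel G a a ↔ a < n := by
  simp [graphRel]

theorem graphRel_left {n : ℕ} (G : SimpleGraph (Fin n)) {a b : ℕ} (h : graphRel G a b) :
    graphRel G a a := by
  rw [graphRel_self]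
  rcases h with ⟨-, h⟩ | ⟨h, -, -⟩ <;> exact h

theorem graphRel_iff_adj {n : ℕ} (G : SimpleGraph (Fin n)) {u v : Fin n} (h : u ≠ v) :
    graphRel G u v ↔ G.Adj u v := by
  simp [graphRel, Fin.val_inj, h]

/-- The numbering of the coordinates of the code of a graph with at most `2 ^ s` vertices. -/
def graphCoord (s : ℕ) : Fin (2 ^ (2 * s + 3)) ≃ Fin 8 × Fin (2 ^ s) × Fin (2 ^ s) where
  toFun i := (⟨i / 2 ^ (2 * s), Nat.div_lt_of_lt_mul (i.2.trans_eq (pow_add _ _ _))⟩,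
    ⟨digit s 1 i, digit_lt s 1 i⟩, ⟨digit s 0 i, digit_lt s 0 i⟩)
  invFun y := ⟨cell s y.1 y.2.1 y.2.2, (cell_lt y.1.2 y.2.1.2 y.2.2.2).trans_eq (by ring)⟩
  left_inv i := Fin.ext (cell_of_digits s i)
  right_inv y := by
    obtain ⟨e1, e2, e3⟩ := cell_digits y.1 y.2.1.2 y.2.2.2
    exact Prod.ext (Fin.ext e1) (Prod.ext (Fin.ext e2) (Fin.ext e3))

/-- The supports of the codewords of the vertices of a graph. -/
def graphSupport (s : ℕ) {n : ℕ} (G : SimpleGraph (Fin n)) (v i : ℕ) : Prop :=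
  (v % 2 ^ s = digit s 1 i ∨ i / 2 ^ (2 * s) = 0 ∧ v % 2 ^ s = digit s 0 i) ∧
    graphRel G (digit s 1 i) (if i / 2 ^ (2 * s) = 0 then digit s 0 i else digit s 1 i)

/-- There are `2 ^ (2 * s + 3)` words but only `2 ^ s` vertices; reducing the word number modulo `2
^ s` repeats each word, which leaves the span unchanged. -/
theorem supportCode_graphSupport (s : ℕ) {n : ℕ} (G : SimpleGraph (Fin n)) :
    supportCode (2 * s + 3) (2 ^ (2 * s + 3)) (graphSupport s G) =
      graphCode (graphCoord s) fun a b => graphRel G a b := by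
  classical
  have hword : ∀ (v : ℕ) (u : Fin (2 ^ s)), v % 2 ^ s = u →
      (fun i : Fin (2 ^ (2 * s + 3)) => if graphSupport s G v i then (1 : ZMod 2) else 0) =
        graphWord (graphCoord s) (fun a b => graphRel G a b) u := by
    intro v u hvu
    funext i
    refine zmod_two_eq_of_ne_zero_iff ?_
    rw [graphWord_ne_zero_iff]
    simp [graphSupport, graphCoord, Fin.ext_iff, hvu, apply_ite Fin.val]
  rw [supportCode, graphCode]
  congr 1
  apply Set.Subset.antisymm
  · rintro _ ⟨v, rfl⟩
    exact ⟨⟨v % 2 ^ s, Nat.mod_lt _ (by positivity)⟩, (hword v _ rfl).symm⟩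
  · rintro _ ⟨u, rfl⟩
    exact ⟨⟨u, u.2.trans_le (Nat.pow_le_pow_right (by norm_num) (by omega))⟩,
      hword u u (Nat.mod_eq_of_lt u.2)⟩

theorem codeEquivalent_graphSupport_iff {s n : ℕ} (hn : n ≤ 2 ^ s) (G H : SimpleGraph (Fin n)) :
    CodeEquivalent (supportCode (2 * s + 3) (2 ^ (2 * s + 3)) (graphSupport s G))
      (supportCode (2 * s + 3) (2 ^ (2 * s + 3)) (graphSupport s H)) ↔ Nonempty (G ≃g H) := by
  rw [supportCode_graphSupport, supportCode_graphSupport]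
  constructor
  · intro h
    obtain ⟨φ, hinj, hφ⟩ := exists_map_of_codeEquivalent
      (E := fun a b : Fin (2 ^ s) => graphRel G a b) (E' := fun a b : Fin (2 ^ s) => graphRel H a b)
      (fun _ _ => graphRel_symm G)
      (fun _ _ => graphRel_symm H) (fun _ _ => graphRel_left H) h
    let ι : Fin n → {u : Fin (2 ^ s) // graphRel G u u} := fun u =>
      ⟨⟨u, u.2.trans_le hn⟩, (graphRel_self G _).mpr u.2⟩
    let ψ : Fin n → Fin n := fun u => ⟨(φ (ι u)).1, (graphRel_self H _).mp (φ (ι u)).2⟩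
    -- The code argument gives only an injective map; both graphs have `n` vertices, so it is
    -- bijective.
    have hψ : Function.Injective ψ := fun u v huv => by
      have h1 := hinj (Subtype.ext (Fin.ext (Fin.mk.inj huv)))
      exact Fin.ext (Fin.mk.inj (Subtype.mk.inj h1))
    refine ⟨⟨Equiv.ofBijective ψ (Finite.injective_iff_bijective.mp hψ), fun {u v} => ?_⟩⟩
    by_cases huv : u = v
    · subst huv; simp
    · have hne : ι u ≠ ι v := fun h => huv (Fin.ext (Fin.mk.inj (Subtype.mk.inj h)))
      exact ((graphRel_iff_adj H fun h => huv (hψ h)).symm.trans (hφ (ι u) (ι v) hne).symm).trans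
        (graphRel_iff_adj G huv)
  · rintro ⟨φ⟩
    -- The isomorphism is extended by the identity on the padding vertices.
    let π : Equiv.Perm (Fin (2 ^ s)) := Equiv.Perm.viaEmbedding φ.toEquiv (Fin.castLEEmb hn)
    have hπ : ∀ u : Fin n, π (Fin.castLE hn u) = Fin.castLE hn (φ u) := fun u =>
      Equiv.Perm.viaEmbedding_apply φ.toEquiv (Fin.castLEEmb hn) u
    have hπ' : ∀ a : Fin (2 ^ s), (π a : ℕ) < n ↔ (a : ℕ) < n := by
      intro a
      by_cases ha : (a : ℕ) < n
      · simp only [ha, iff_true]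
        rw [show a = Fin.castLE hn ⟨a, ha⟩ from rfl, hπ]
        exact (φ _).2
      · rw [show π a = a from Equiv.Perm.viaEmbedding_apply_of_notMem φ.toEquiv (Fin.castLEEmb hn) a (by
          rintro ⟨b, rfl⟩; exact ha b.2)]
    refine codeEquivalent_of_perm π fun a b => ?_
    by_cases hab : a = b
    · subst hab; rw [graphRel_self, graphRel_self, hπ']
    · by_cases h : (a : ℕ) < n ∧ (b : ℕ) < n
      · have hne : (⟨a, h.1⟩ : Fin n) ≠ ⟨b, h.2⟩ := fun h => hab (Fin.ext (Fin.mk.inj h))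
        have h1 := hπ ⟨a, h.1⟩
        have h2 := hπ ⟨b, h.2⟩
        rw [show Fin.castLE hn ⟨a, h.1⟩ = a from rfl] at h1
        rw [show Fin.castLE hn ⟨b, h.2⟩ = b from rfl] at h2
        rw [h1, h2]
        refine (graphRel_iff_adj H (φ.injective.ne hne)).trans ?_
        rw [φ.map_adj_iff]
        exact (graphRel_iff_adj G hne).symm
      · have hno : ∀ (K : SimpleGraph (Fin n)) (x y : ℕ), graphRel K x y → x < n ∧ y < n :=
          fun K x y hxy => ⟨(graphRel_self K x).mp (graphRel_left K hxy),
            (graphRel_self K y).mp (graphRel_left K (graphRel_symm K hxy))⟩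
        refine iff_of_false (fun h' => h ?_) fun h' => h (hno G _ _ h')
        simpa only [hπ'] using hno H _ _ h'

/-- The implications that characterize the encodings of pairs of graphs: the tables are symmetric,
their common diagonal is an initial segment, and it bounds the row indices of their ones. -/
def graphImp (s p q : ℕ) : Prop :=
  (q / 2 ^ (2 * s) = p / 2 ^ (2 * s) ∧ digit s 1 q = digit s 0 p ∧ digit s 0 q = digit s 1 p) ∨
  (digit s 1 p = digit s 0 p ∧ digit s 1 q = digit s 0 q ∧ digit s 1 q ≤ digit s 1 p) ∨
  (q / 2 ^ (2 * s) = p / 2 ^ (2 * s) ∧ digit s 1 q = digit s 1 p ∧ digit s 0 q = digit s 1 p)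

/-- The block scheme for pairs of graphs. -/
def graphScheme : BlockScheme where
  par := 1
  par_pos := le_rfl
  par_le := by norm_num
  slope := 2
  shift := 3
  imp := graphImp
  lit s t v i :=
    if t = 0 ∧ (v % 2 ^ s = digit s 1 i ∨ i / 2 ^ (2 * s) = 0 ∧ v % 2 ^ s = digit s 0 i) then .pos
    else if (t = 1 ∨ t = 2) ∧ v = i then .const true else .const false
  addr s b _ _ i :=
    cell s (b % 2) (digit s 1 i) (if i / 2 ^ (2 * s) = 0 then digit s 0 i else digit s 1 i)
  addr_lt s b t v i hb hv hi := by
    rw [pow_add, pow_one, mul_comm (2 ^ (2 * s))]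
    exact cell_lt (Nat.mod_lt _ (by norm_num)) (digit_lt _ _ _)
      (by split_ifs <;> exact digit_lt _ _ _)

theorem entry_encodeGraphs {s n : ℕ} (G H : SimpleGraph (Fin n)) {b i j : ℕ}
    (hb : b < 2) (hi : i < 2 ^ s) (hj : j < 2 ^ s) : entry (encodeGraphs s G H) s b i j ↔
      graphRel (if b = 0 then G else H) i j := by
  rw [entry, encodeGraphs, getD_bitString _ (cell_lt hb hi hj)]
  obtain ⟨e1, e2, e3⟩ := cell_digits b hi hj
  simp only [e1, e2, e3, graphRel]
  interval_cases b <;> simp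

theorem length_encodeGraphs {s n : ℕ} (G H : SimpleGraph (Fin n)) :
    (encodeGraphs s G H).length = 2 ^ (2 * s + 1) := by
  rw [encodeGraphs, length_bitString, pow_add]
  ring

theorem graphScheme_valid_iff {x : List Bool} {s : ℕ} (hx : x.length = 2 ^ (2 * s + 1)) :
    graphScheme.projection.Valid x ↔
      ∀ b < 2, ∀ i < 2 ^ s, ∀ j < 2 ^ s, ∀ b' < 2, ∀ i' < 2 ^ s, ∀ j' < 2 ^ s,
        (b' = b ∧ i' = j ∧ j' = i ∨ i = j ∧ i' = j' ∧ i' ≤ i ∨ b' = b ∧ i' = i ∧ j' = i) →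
          entry x s b i j → entry x s b' i' j' := by
  rw [graphScheme.projection.valid_iff hx]
  refine forall₃_congr fun b hb i => forall₃_congr fun hi j hj => forall₃_congr fun b' hb' i' =>
    forall₃_congr fun hi' j' hj' => ?_
  obtain ⟨e1, e2, e3⟩ := cell_digits b hi hj
  obtain ⟨f1, f2, f3⟩ := cell_digits b' hi' hj'
  change (graphImp _ _ _ → _) ↔ _
  simp only [graphImp, e1, e2, e3, f1, f2, f3]

theorem valid_encodeGraphs {s n : ℕ} (G H : SimpleGraph (Fin n)) :
    graphScheme.projection.Valid (encodeGraphs s G H) := by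
  rw [graphScheme_valid_iff (length_encodeGraphs G H)]
  intro b hb i hi j hj b' hb' i' hi' j' hj' h
  rw [entry_encodeGraphs G H hb hi hj, entry_encodeGraphs G H hb' hi' hj']
  rcases h with ⟨rfl, rfl, rfl⟩ | ⟨rfl, rfl, h⟩ | ⟨rfl, rfl, rfl⟩
  · exact graphRel_symm _
  · rw [graphRel_self, graphRel_self]; omega
  · exact graphRel_left _

/-- The implications between diagonal cells also link the two tables, so both diagonals have the
same threshold `n`. An entry forces the diagonal entry of its row and, by symmetry, that of its
column, so the ones lie in the first `n` rows and columns. -/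
theorem exists_encodeGraphs {x : List Bool} (hx : graphScheme.projection.Valid x) :
    ∃ (s n : ℕ) (G H : SimpleGraph (Fin n)), n ≤ 2 ^ s ∧ x = encodeGraphs s G H := by
  set s := GuardedProjection.param x.length
  have hlen : x.length = 2 ^ (2 * s + 1) := hx.1
  rw [graphScheme_valid_iff hlen] at hx
  obtain ⟨n, hn, hn'⟩ := exists_threshold (2 ^ s) (fun i => entry x s 0 i i) fun i hi j hj =>
    hx 0 (by omega) i hi i hi 0 (by omega) j (by omega) j (by omega) (by omega)
  have hdiag : ∀ b < 2, ∀ i < 2 ^ s, entry x s b i i ↔ i < n := fun b hb i hi => by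
    rw [← hn' i hi]
    exact ⟨hx b hb i hi i hi 0 (by omega) i hi i hi (by omega),
      hx 0 (by omega) i hi i hi b hb i hi i hi (by omega)⟩
  have hsymm : ∀ b < 2, ∀ i < 2 ^ s, ∀ j < 2 ^ s, entry x s b i j → entry x s b j i :=
    fun b hb i hi j hj => hx b hb i hi j hj b hb j hj i hi (by omega)
  let Γ (b : ℕ) (hb : b < 2) : SimpleGraph (Fin n) :=
    { Adj := fun u v => u ≠ v ∧ entry x s b u v
      symm := ⟨fun u v h => ⟨h.1.symm, hsymm b hb u (by omega) v (by omega) h.2⟩⟩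
      loopless := ⟨fun u h => h.1 rfl⟩ }
  refine ⟨s, n, Γ 0 (by omega), Γ 1 (by omega), hn, ?_⟩
  refine eq_bitString (by rw [hlen, pow_add]; ring) fun b hb i hi j hj => ?_
  obtain ⟨e1, e2, e3⟩ := cell_digits b hi hj
  simp only [e1, e2, e3]
  have key : ∀ b (hb : b < 2), entry x s b i j ↔
      i = j ∧ i < n ∨ ∃ (hi : i < n) (hj : j < n), (Γ b hb).Adj ⟨i, hi⟩ ⟨j, hj⟩ := by
    intro b hb
    by_cases hij : i = j
    · subst hij
      rw [hdiag b hb i hi]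
      simp
    · have h1 : entry x s b i j → i < n := fun h => (hdiag b hb i hi).mp
        (hx b hb i hi j hj b hb i hi i hi (by omega) h)
      have h2 : entry x s b i j → j < n := fun h => (hdiag b hb j hj).mp
        (hx b hb j hj i hi b hb j hj j hj (by omega) (hsymm b hb i hi j hj h))
      simp only [Γ, hij, false_and, false_or, Ne, Fin.mk.injEq, not_false_eq_true, true_and]
      exact ⟨fun h => ⟨h1 h, h2 h, h⟩, fun ⟨_, _, h⟩ => h⟩
  interval_cases b
  · simpa using key 0 (by omega)
  · simpa using key 1 (by omega)

/-- The code has the full length `2 ^ (2 * s + 3)` for every graph, so all blocks exist and the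
generators of types `1` and `2` do not depend on the input. The output tables `2` and `3` consult
the input tables `0` and `1`, hence `b % 2`. -/
theorem eval_encodeGraphs {s n : ℕ} (G H : SimpleGraph (Fin n)) :
    graphScheme.projection.eval (encodeGraphs s G H) = encodePermutations (2 * s + 3 + 3)
      (blockPerms (2 * s + 3) (2 ^ (2 * s + 3)) le_rfl (graphSupport s G))
      (blockPerms (2 * s + 3) (2 ^ (2 * s + 3)) le_rfl (graphSupport s H)) := by
  have hs : GuardedProjection.param (encodeGraphs s G H).length = s := by
    rw [length_encodeGraphs, param_two_pow le_rfl (by norm_num)]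
  refine BlockScheme.eval_of_valid hs rfl (valid_encodeGraphs (s := s) G H) le_rfl
    (fun b => if b = 2 then graphSupport s G else graphSupport s H) ?_
  · intro b t v i hb hv hi
    change Slot.Holds (List.getD _ (cell s (b % 2) (digit s 1 i)
      (if i / 2 ^ (2 * s) = 0 then digit s 0 i else digit s 1 i)) _) (if _ then _ else if _ then _ else _) ↔ _
    have hentry : (encodeGraphs s G H).getD (cell s (b % 2) (digit s 1 i)
        (if i / 2 ^ (2 * s) = 0 then digit s 0 i else digit s 1 i)) false = true ↔ _ :=
      entry_encodeGraphs G H (Nat.mod_lt _ (by norm_num)) (digit_lt s 1 i)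
        (by split_ifs <;> exact digit_lt _ _ _)
    have hR : (if b = 2 then graphSupport s G else graphSupport s H) v i ↔
        (v % 2 ^ s = digit s 1 i ∨ i / 2 ^ (2 * s) = 0 ∧ v % 2 ^ s = digit s 0 i) ∧
          graphRel (if b % 2 = 0 then G else H) (digit s 1 i)
            (if i / 2 ^ (2 * s) = 0 then digit s 0 i else digit s 1 i) := by
      rcases hb with rfl | rfl <;> rfl
    have hholds : ∀ (X Y : Prop) [Decidable X] [Decidable Y] (a : Bool), Slot.Holds a
        (if X then .pos else if Y then .const true else .const false) ↔ X ∧ a = true ∨ ¬ X ∧ Y := by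
      intro X Y _ _ a
      split_ifs <;> simp_all [Slot.Holds]
    have ht : t = 0 → ¬ (t = 1 ∨ t = 2) := by omega
    rw [hholds, hentry]
    simp only [hi, true_and, IsActive, hR]
    constructor
    · rintro (⟨⟨h1, h2⟩, h3⟩ | ⟨-, h⟩)
      · exact Or.inl ⟨h1, h2, h3⟩
      · exact Or.inr h
    · rintro (⟨h1, h2, h3⟩ | h)
      · exact Or.inl ⟨⟨h1, h2⟩, h3⟩
      · exact Or.inr ⟨fun h' => ht h'.1 h.1, h⟩

theorem uniformAC0_graphScheme : UniformAC0 graphScheme.projection.eval := by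
  have hw : ∀ s, graphScheme.logBlocks s = 2 * s + 3 := fun _ => rfl
  -- With `logBlocks s = 2 * s + 3`, the block starts at bit `2 * s + 6` of an output position and
  -- the word at `4 * s + 12`. The block itself consists of the column, the row and the number of
  -- the copy, starting at its bits `0`, `s` and `2 * s`.
  have hfst : ∀ s p, digit s 1 (graphScheme.block s p) = p / 2 ^ (3 * s + 6) % 2 ^ s := by
    intro s p
    rw [BlockScheme.block, hw, digit, mod_div_mod_two_pow _ _ _ _ (by omega),
      Nat.div_div_eq_div_mul, ← pow_add]
    ring_nf
  have hsnd : ∀ s p, digit s 0 (graphScheme.block s p) = p / 2 ^ (2 * s + 6) % 2 ^ s := by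
    intro s p
    rw [BlockScheme.block, hw, digit, mod_div_mod_two_pow _ _ _ _ (by omega),
      Nat.div_div_eq_div_mul, ← pow_add]
    ring_nf
  have hcopy : ∀ s p, graphScheme.block s p / 2 ^ (2 * s) = p / 2 ^ (4 * s + 6) % 2 ^ 3 := by
    intro s p
    rw [BlockScheme.block, hw, pow_add _ (2 * s) 3, Nat.mod_mul_right_div_self,
      Nat.div_div_eq_div_mul, ← pow_add]
    ring_nf
  have hrow : ∀ s p, graphScheme.word s p % 2 ^ s = p / 2 ^ (4 * s + 12) % 2 ^ s := by
    intro s p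
    rw [BlockScheme.word, hw, Nat.mod_mod_of_dvd _ (pow_dvd_pow 2 (by omega))]
    ring_nf
  have hzero := (DigitRegular.chunk 3 false 4 6).map (· = 0)
  refine graphScheme.uniformAC0 ?_ ?_ ?_
  -- For a pair `(p, q)` the low `2 * s + 1` bits are `p`, so the column, row and table of `q` start
  -- at `2 * s + 1`, `3 * s + 1` and `4 * s + 1`.
  · have htab := (DigitRegular.chunk 1 false 4 1).map₂ (DigitRegular.chunk 1 false 2 0) (· = ·)
    have h10 := DigitRegular.eq_chunk 1 0 false 3 1 false 0 0
    have h01 := DigitRegular.eq_chunk 1 0 false 2 1 false 1 0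
    have hp := DigitRegular.eq_chunk 1 0 false 1 0 false 0 0
    have hq := DigitRegular.eq_chunk 1 0 false 3 1 false 2 1
    have hle := DigitRegular.le_chunk false 3 1 false 1 0
    have h11 := DigitRegular.eq_chunk 1 0 false 3 1 false 1 0
    refine ((htab.and (h10.and h01)).or ((hp.and (hq.and hle)).or
      (htab.and (h11.and h01)))).congr fun s _ k => ?_
    change _ = graphImp s (k % 2 ^ (2 * s + 1)) (k / 2 ^ (2 * s + 1) % 2 ^ (2 * s + 1))
    have e1 : ∀ k, k % 2 ^ (2 * s + 1) / 2 ^ (2 * s) = k / 2 ^ (2 * s) % 2 ^ 1 := fun k => by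
      rw [pow_add, Nat.mod_mul_right_div_self]
    have e2 : ∀ k, ∀ l < 2, digit s l (k % 2 ^ (2 * s + 1)) = k / 2 ^ (l * s) % 2 ^ s :=
      fun k l hl => by
        rw [mul_comm l]; exact mod_div_mod_two_pow _ _ _ _ (by nlinarith)
    simp only [graphImp, e1, e2 _ 1 (by norm_num), e2 _ 0 (by norm_num),
      Nat.div_div_eq_div_mul, ← pow_add, cond_false]
    ring_nf
  · have h1 := DigitRegular.eq_chunk 1 0 false 4 12 false 3 6
    have h0 := DigitRegular.eq_chunk 1 0 false 4 12 false 2 6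
    refine (((graphScheme.digitRegular_type.map (· = 0)).and (h1.or (hzero.and h0))).ite
      (.const Slot.pos) (((graphScheme.digitRegular_type.map fun t => t = 1 ∨ t = 2).and
        graphScheme.digitRegular_word_eq).ite (.const (Slot.const true))
          (.const (Slot.const false)))).congr fun s _ p => ?_
    change _ = (if _ ∧ (_ ∨ _) then _ else if _ then _ else _)
    simp only [hrow, hfst, hsnd, hcopy, cond_false, one_mul, add_zero]
  · have htab := (DigitRegular.chunk 1 true 2 0).map₂ (graphScheme.digitRegular_table.map (· % 2))
      (· = ·)
    have h1 := DigitRegular.eq_chunk 1 0 true 1 0 false 3 6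
    have h0 := DigitRegular.eq_chunk 1 0 true 0 0 false 2 6
    have h0' := DigitRegular.eq_chunk 1 0 true 0 0 false 3 6
    refine (htab.and (h1.and (hzero.ite h0 h0'))).congr fun s j p => ?_
    change _ = (j % 2 ^ (2 * s + 1) = cell s (_ % 2) _ (if _ then _ else _))
    rw [mod_eq_cell_iff]
    · simp only [hfst, hsnd, hcopy, cond_true, cond_false]
      simp only [digit]
      split_ifs <;> ring_nf
    · exact Nat.mod_lt _ (by norm_num)
    · exact digit_lt _ _ _
    · split_ifs <;> exact digit_lt _ _ _

end Graphs

/-! ### The group theory and the two reductions combined -/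

theorem theorem2 :
    -- for every code `C`, the group `G_C` is Fitting-free, and `G_C ≅ G_C'` iff `C` and `C'` are
    -- permutation-equivalent
    (∀ (N : ℕ) (C : Submodule (ZMod 2) (Fin N → ZMod 2)), IsFittingFree (codeGroup C)) ∧
    (∀ (N : ℕ) (C C' : Submodule (ZMod 2) (Fin N → ZMod 2)),
      Nonempty (codeGroup C ≃* codeGroup C') ↔ CodeEquivalent C C') ∧
    -- the reduction from Linear Code Equivalence, which sends codes `C` and `C'` to generating
    -- permutations of `G_C` and `G_C'`
    (∃ f : List Bool → List Bool,
      IsUniformAC0Reduction f LinearCodeEquivalence FittingFreeIsomorphism ∧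
      (∀ x, f x ∈ FittingFreeInstance) ∧
      (∀ (s d m : ℕ) (A B : Matrix (Fin d) (Fin m) (ZMod 2)), d ≤ 2 ^ s → m ≤ 2 ^ s →
        ∃ (r L M : ℕ) (S T : Fin L → Equiv.Perm (Fin M)) (e : (Σ _ : Fin m, Fin 5) ↪ Fin M),
          L ≤ 2 ^ r ∧ M ≤ 2 ^ r ∧
          f (encodeMatrices s A B) = encodePermutations r S T ∧
          generated S = (codeGroup (rowCode A)).map (blockAction e) ∧
          generated T = (codeGroup (rowCode B)).map (blockAction e))) ∧
    -- the reduction from Graph Isomorphism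
    (∃ g : List Bool → List Bool,
      IsUniformAC0Reduction g GraphIsomorphism FittingFreeIsomorphism ∧
      ∀ x, g x ∈ FittingFreeInstance) := by
  refine ⟨fun _ C => codeGroup_isFittingFree C, fun _ => nonempty_mulEquiv_iff,
    ⟨matrixScheme.projection.eval, ⟨uniformAC0_matrixScheme, fun x => ?_⟩, fun x => ?_,
      fun s d m A B hd hm => ?_⟩,
    ⟨graphScheme.projection.eval, ⟨uniformAC0_graphScheme, fun x => ?_⟩, fun x => ?_⟩⟩
  · constructor
    · rintro ⟨s, d, m, A, B, hd, hm, rfl, h⟩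
      rw [matrixScheme.eval_mem_iff hm (eval_encodeMatrices A B hm), supportCode_matrixSupport A hd,
        supportCode_matrixSupport B hd]
      exact h
    · intro h
      -- Outputs on invalid inputs are pairs of nonisomorphic groups, so an output in the language
      -- certifies that the input is an encoding.
      have hx : matrixScheme.projection.Valid x := by
        by_contra hx
        exact matrixScheme.eval_not_mem hx h
      obtain ⟨s, d, m, A, B, hd, hm, rfl⟩ := exists_encodeMatrices hx
      rw [matrixScheme.eval_mem_iff hm (eval_encodeMatrices A B hm), supportCode_matrixSupport A hd,
        supportCode_matrixSupport B hd] at h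
      exact ⟨s, d, m, A, B, hd, hm, rfl, h⟩
  · refine matrixScheme.eval_mem_instance fun hx => ?_
    obtain ⟨s, d, m, A, B, hd, hm, rfl⟩ := exists_encodeMatrices hx
    exact ⟨s, m, hm, _, _, eval_encodeMatrices A B hm⟩
  · refine ⟨s + 3, _, _, _, _, blockEmbedding s m hm, le_rfl, le_rfl, eval_encodeMatrices A B hm,
      ?_, ?_⟩
    · rw [generated_blockPerms, supportCode_matrixSupport A hd]
    · rw [generated_blockPerms, supportCode_matrixSupport B hd]
  · constructor
    · rintro ⟨s, n, G, H, hn, rfl, h⟩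
      rw [graphScheme.eval_mem_iff le_rfl (eval_encodeGraphs G H), codeEquivalent_graphSupport_iff hn]
      exact h
    · intro h
      have hx : graphScheme.projection.Valid x := by
        by_contra hx
        exact graphScheme.eval_not_mem hx h
      obtain ⟨s, n, G, H, hn, rfl⟩ := exists_encodeGraphs hx
      rw [graphScheme.eval_mem_iff le_rfl (eval_encodeGraphs G H),
        codeEquivalent_graphSupport_iff hn] at h
      exact ⟨s, n, G, H, hn, rfl, h⟩
  · refine graphScheme.eval_mem_instance fun hx => ?_
    obtain ⟨s, n, G, H, hn, rfl⟩ := exists_encodeGraphs hx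
    exact ⟨_, _, le_rfl, _, _, eval_encodeGraphs G H⟩
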